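/- Let $\Gamma$ be a connected compact metric graph with finite vertex set $V$ and finite edge set $E$ (loops and multiple edges allowed); each edge $e$ is identified with an interval $[0,L_e]$, $L_e>0$. Let $q:\Gamma\to\mathbb{R}$ be piecewise continuous. At each vertex $v$ impose either a $\delta$-type condition with coefficient $\chi_v\in\mathbb{R}$ or, allowed only at vertices of degree one, the Dirichlet condition $f(v)=0$. For a real magnetic potential (one-form) $A$ of class $H^1$ on each edge, let $H^A$ be the operator $$H^A f=-\Big(\frac{d}{dx}-iA\Big)^2 f+qf$$ on the complex-valued functions $f$ that belong to $H^2(e)$ for every edge $e$, are continuous at the vertices, vanish at the Dirichlet vertices, and satisfy at every other vertex $v$ $$\sum_{e}\Big(\frac{df}{dx_e}(v)-iA_e(v)f(v)\Big)=\chi_v f(v),$$ where the sum is over the edge ends at $v$ and both the derivative and $A$ are taken in the direction into the edge. Denote by $\lambda_1(H^A)\le\lambda_2(H^A)\le\dots$ the eigenvalues of $H^A$, repeated according to multiplicity. Let $\beta=|E|-|V|+1$ and let $\sigma_1,\dots,\sigma_\beta$ be closed walks that generate the fundamental group of $\Gamma$. The fluxes of $A$ are $\alpha_j=\oint_{\sigma_j}A\,dx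 \mod 2\pi$, $j=1,\dots,\beta$. Suppose that $\lambda=\lambda_n(H^0)$ ($n\ge1$) is a simple eigenvalue of $H^0$, and that its eigenfunction $\psi$ is non-zero at every vertex that does not carry the Dirichlet condition. Then the number $\phi$ of zeros of $\psi$ in the interiors of the edges is finite; $\lambda_n(H^A)$ depends on $A$ only through its fluxes, so that there is a unique function $\lambda_n(\boldsymbol\alpha)$ on $\mathbb{R}^\beta$ with $\lambda_n(\boldsymbol\alpha)=\lambda_n(H^A)$ whenever $A$ has the fluxes $\boldsymbol\alpha$ modulo $2\pi$; this function is $C^2$ near $\boldsymbol\alpha=(0,\dots,0)$; the point $(0,\dots,0)$ is a non-degenerate critical point of it (the gradient vanishes and the Hessian is non-degenerate); and the Morse index of this critical point (the largest dimension of a subspace on which the Hessian is negative definite) equals the nodal surplus $\phi-(n-1)$. -/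

import Mathlib

open MeasureTheory Filter Topology

/-! ### Sobolev spaces on an interval -/

/-- `g` is the weak derivative of the `H¹` function `f` on `[0, L]`: `f` is absolutely continuous
there, with derivative `g ∈ L²(0, L)`.  Only the values on `[0, L]` matter; `f` is the
continuous representative, so that `f 0` and `f L` are its boundary values. -/
def HasH1Deriv {F : Type*} [NormedAddCommGroup F] [NormedSpace ℝ F]
    (L : ℝ) (f g : ℝ → F) : Prop :=
  MemLp g 2 (volume.restrict (Set.Icc 0 L)) ∧
    ∀ x ∈ Set.Icc 0 L, f x = f 0 + ∫ t in (0 : ℝ)..x, g t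

/-- `q` is piecewise continuous on `[0, L]`: it is continuous off a finite set and has finite
one-sided limits everywhere. -/
def PiecewiseContinuous (L : ℝ) (q : ℝ → ℝ) : Prop :=
  (∃ S : Set ℝ, S.Finite ∧ ∀ x ∈ Set.Icc 0 L \ S, ContinuousWithinAt q (Set.Icc 0 L) x) ∧
    (∀ x ∈ Set.Ico 0 L, ∃ l : ℝ, Tendsto q (𝓝[>] x) (𝓝 l)) ∧
    (∀ x ∈ Set.Ioc 0 L, ∃ l : ℝ, Tendsto q (𝓝[<] x) (𝓝 l))

namespace HasH1Deriv

theorem intervalIntegrable {F : Type*} [NormedAddCommGroup F] [NormedSpace ℝ F] {L : ℝ}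
    {f g : ℝ → F} (h : HasH1Deriv L f g) {x : ℝ} (hx : x ∈ Set.Icc 0 L) :
    IntervalIntegrable g volume 0 x := by
  have h1 : IntegrableOn g (Set.Icc 0 L) := h.1.integrable (by norm_num)
  rw [intervalIntegrable_iff_integrableOn_Ioc_of_le hx.1]
  exact h1.mono_set fun t ht => ⟨ht.1.le, ht.2.trans hx.2⟩

theorem zero {F : Type*} [NormedAddCommGroup F] [NormedSpace ℝ F] (L : ℝ) :
    HasH1Deriv L (fun _ => (0 : F)) (fun _ => 0) :=
  ⟨MemLp.zero, fun x _ => by simp⟩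

theorem add {F : Type*} [NormedAddCommGroup F] [NormedSpace ℝ F] {L : ℝ}
    {f g f' g' : ℝ → F} (h : HasH1Deriv L f g) (h' : HasH1Deriv L f' g') :
    HasH1Deriv L (fun x => f x + f' x) (fun x => g x + g' x) := by
  refine ⟨h.1.add h'.1, fun x hx => ?_⟩
  simp only
  rw [h.2 x hx, h'.2 x hx,
    intervalIntegral.integral_add (h.intervalIntegrable hx) (h'.intervalIntegrable hx)]
  abel

theorem const_mul {L : ℝ} {f g : ℝ → ℂ} (h : HasH1Deriv L f g) (c : ℂ) :
    HasH1Deriv L (fun x => c * f x) (fun x => c * g x) := by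
  refine ⟨h.1.const_mul c, fun x hx => ?_⟩
  simp only
  rw [h.2 x hx, intervalIntegral.integral_const_mul]
  ring

end HasH1Deriv

/-! ### Quantum graphs -/

/-- A compact metric graph with finitely many vertices and edges (loops and multiple edges are
allowed), together with an electric potential and `δ`-type vertex conditions.  The edge `e` is
identified with `[0, length e]`, the point `0` being `src e` and the point `length e` being
`tgt e`. -/
structure QuantumGraph (V E : Type*) [DecidableEq V] [Fintype E] where
  src : E → V
  tgt : E → V
  length : E → ℝ
  length_pos : ∀ e, 0 < length e
  /-- the electric potential -/
  q : E → ℝ → ℝ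
  q_piecewiseContinuous : ∀ e, PiecewiseContinuous (length e) (q e)
  /-- the vertices with Dirichlet condition, all of degree one -/
  dirichlet : Set V
  degree_dirichlet : ∀ v ∈ dirichlet,
    (Finset.univ.filter fun e => src e = v).card + (Finset.univ.filter fun e => tgt e = v).card = 1
  /-- the coefficients of the `δ`-type conditions (irrelevant on `dirichlet`) -/
  χ : V → ℝ

namespace QuantumGraph

variable {V E : Type*} [DecidableEq V] [Fintype E]

/-- A word of oriented edges is a walk from `u` to `v`; `(e, true)` is the edge `e` traversed
from `src e` to `tgt e`, and `(e, false)` is the reversed edge. -/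
def IsWalk (G : QuantumGraph V E) : V → List (E × Bool) → V → Prop
  | u, [], v => u = v
  | u, (e, true) :: w, v => u = G.src e ∧ IsWalk G (G.tgt e) w v
  | u, (e, false) :: w, v => u = G.tgt e ∧ IsWalk G (G.src e) w v

/-- Any two vertices are joined by a walk. -/
def Connected (G : QuantumGraph V E) : Prop :=
  Nonempty V ∧ ∀ u v, ∃ w, G.IsWalk u w v

/-- The first Betti number `|E| - |V| + 1` (the natural subtraction does not truncate when the
graph is connected). -/
def betti [Fintype V] (_ : QuantumGraph V E) : ℕ :=
  Fintype.card E + 1 - Fintype.card V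

theorem IsWalk.append {G : QuantumGraph V E} {w₁ w₂ : List (E × Bool)} {a b c : V}
    (h₁ : G.IsWalk a w₁ b) (h₂ : G.IsWalk b w₂ c) : G.IsWalk a (w₁ ++ w₂) c := by
  induction w₁ generalizing a with
  | nil => cases h₁; exact h₂
  | cons p w ih => obtain ⟨e, _ | _⟩ := p <;> exact ⟨h₁.1, ih h₁.2⟩

theorem IsWalk.invRev {G : QuantumGraph V E} {w : List (E × Bool)} {a b : V}
    (h : G.IsWalk a w b) : G.IsWalk b (FreeGroup.invRev w) a := by
  induction w generalizing a with
  | nil => exact Eq.symm h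
  | cons p w ih =>
    rw [FreeGroup.invRev_cons]
    obtain ⟨e, _ | _⟩ := p <;> refine (ih h.2).append ?_ <;>
      simp [FreeGroup.invRev, IsWalk, h.1]

/-- The fundamental group of the graph at the base point `v₀`.  Closed walks are homotopic
exactly if they become equal after cancelling backtracks, that is, if they are equal in the free
group on the edges; the fundamental group is therefore the subgroup of `FreeGroup E` formed by
the closed walks at `v₀`. -/
def fundamentalGroup (G : QuantumGraph V E) (v₀ : V) : Subgroup (FreeGroup E) where
  carrier := {g | ∃ w, G.IsWalk v₀ w v₀ ∧ FreeGroup.mk w = g}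
  one_mem' := ⟨[], rfl, rfl⟩
  mul_mem' := by
    rintro _ _ ⟨w₁, h₁, rfl⟩ ⟨w₂, h₂, rfl⟩
    exact ⟨w₁ ++ w₂, h₁.append h₂, FreeGroup.mul_mk.symm⟩
  inv_mem' := by
    rintro _ ⟨w, h, rfl⟩
    exact ⟨FreeGroup.invRev w, h.invRev, FreeGroup.inv_mk.symm⟩

/-- A magnetic potential: a real one-form, of class `H¹` on each edge.  `A e` is its coefficient
in the coordinate of the edge `e`; traversing `e` backwards changes the sign. -/
structure MagneticPotential (G : QuantumGraph V E) where
  A : E → ℝ → ℝ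
  regular : ∀ e, ∃ A' : ℝ → ℝ, HasH1Deriv (G.length e) (A e) A'

/-- The zero magnetic potential. -/
instance (G : QuantumGraph V E) : Zero G.MagneticPotential :=
  ⟨⟨fun _ _ => 0, fun _ => ⟨fun _ => 0, HasH1Deriv.zero _⟩⟩⟩

/-- The integral of `A` over a (homotopy class of a) walk. -/
noncomputable def flux {G : QuantumGraph V E} (A : G.MagneticPotential) (γ : FreeGroup E) : ℝ :=
  (FreeGroup.lift (fun e => Multiplicative.ofAdd (∫ x in (0 : ℝ)..G.length e, A.A e x)) γ).toAdd

/-- The vertex conditions for a function `f` with (covariant) derivative `D` along the edges: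
continuity, `f(v) = 0` at the Dirichlet vertices, and at all other vertices the `δ`-type
condition, in which the derivatives are taken into the edges. -/
def VertexConditions (G : QuantumGraph V E) (f D : E → ℝ → ℂ) : Prop :=
  ∃ val : V → ℂ,
    (∀ e, f e 0 = val (G.src e) ∧ f e (G.length e) = val (G.tgt e)) ∧
    (∀ v ∈ G.dirichlet, val v = 0) ∧
    ∀ v ∉ G.dirichlet,
      ∑ e with G.src e = v, D e 0 - ∑ e with G.tgt e = v, D e (G.length e) = (G.χ v : ℂ) * val v

/-- The covariant derivative `f' - i A f`, where `f'` is the derivative of `f`. -/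
noncomputable def covDeriv {G : QuantumGraph V E} (A : G.MagneticPotential)
    (f f' : E → ℝ → ℂ) : E → ℝ → ℂ :=
  fun e x => f' e x - Complex.I * A.A e x * f e x

/-- `f` is in the domain of the magnetic Schrödinger operator `H^A = -(d/dx - iA)² + q` and
`H^A f = h`: the function `f` is in `H²` of every edge, it satisfies the vertex conditions, and
the equation holds almost everywhere.  Here `D' e` is the derivative of `(d/dx - iA) f`. -/
def SchrodingerMapsTo {G : QuantumGraph V E} (A : G.MagneticPotential)
    (f h : E → ℝ → ℂ) : Prop :=
  ∃ f' f'' D' : E → ℝ → ℂ,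
    (∀ e, HasH1Deriv (G.length e) (f e) (f' e)) ∧
    (∀ e, HasH1Deriv (G.length e) (f' e) (f'' e)) ∧
    (∀ e, HasH1Deriv (G.length e) (covDeriv A f f' e) (D' e)) ∧
    G.VertexConditions f (covDeriv A f f') ∧
    ∀ e, ∀ᵐ x ∂volume.restrict (Set.Icc 0 (G.length e)),
      -(covDeriv A (covDeriv A f f') D' e x) + G.q e x * f e x = h e x

/-- The eigenspace of `H^A` for the real number `μ`.  A function on the graph is a family of
functions on the intervals `[0, length e]`, extended by zero. -/
noncomputable def eigenspace {G : QuantumGraph V E} (A : G.MagneticPotential) (μ : ℝ) :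
    Submodule ℂ (E → ℝ → ℂ) where
  carrier := {f | (∀ e, ∀ x ∉ Set.Icc 0 (G.length e), f e x = 0) ∧
    SchrodingerMapsTo A f (fun e x => (μ : ℂ) * f e x)}
  zero_mem' := by
    refine ⟨fun _ _ _ => rfl, fun _ _ => 0, fun _ _ => 0, fun _ _ => 0, fun _ => HasH1Deriv.zero _,
      fun _ => HasH1Deriv.zero _, fun e => ?_, ⟨fun _ => 0, ?_, ?_, ?_⟩, fun e => ?_⟩
    · have hD : covDeriv A 0 (fun _ _ => 0) e = fun _ => 0 := by funext x; simp [covDeriv]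
      rw [hD]; exact HasH1Deriv.zero _
    · simp
    · simp
    · simp [covDeriv]
    · simp [covDeriv]
  add_mem' := by
    rintro f g ⟨hf0, f1, f2, f3, hf1, hf2, hf3, ⟨vf, hfc, hfd, hfv⟩, hf⟩
      ⟨hg0, g1, g2, g3, hg1, hg2, hg3, ⟨vg, hgc, hgd, hgv⟩, hg⟩
    have hD : covDeriv A (f + g) (f1 + g1) =
        fun e x => covDeriv A f f1 e x + covDeriv A g g1 e x := by
      funext e x; simp only [covDeriv, Pi.add_apply]; ring
    refine ⟨fun e x hx => by simp [hf0 e x hx, hg0 e x hx], f1 + g1, f2 + g2, f3 + g3,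
      fun e => (hf1 e).add (hg1 e), fun e => (hf2 e).add (hg2 e), fun e => ?_,
      ⟨vf + vg, fun e => ?_, fun v hv => ?_, fun v hv => ?_⟩, fun e => ?_⟩
    · rw [hD]; exact (hf3 e).add (hg3 e)
    · simp [(hfc e).1, (hfc e).2, (hgc e).1, (hgc e).2]
    · simp [hfd v hv, hgd v hv]
    · rw [hD]
      simp only [Finset.sum_add_distrib, Pi.add_apply]
      linear_combination hfv v hv + hgv v hv
    · filter_upwards [hf e, hg e] with x hx hy
      simp only [covDeriv, Pi.add_apply] at hx hy ⊢
      linear_combination hx + hy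
  smul_mem' := by
    rintro c f ⟨hf0, f1, f2, f3, hf1, hf2, hf3, ⟨vf, hfc, hfd, hfv⟩, hf⟩
    have hD : covDeriv A (c • f) (c • f1) = fun e x => c * covDeriv A f f1 e x := by
      funext e x; simp only [covDeriv, Pi.smul_apply, smul_eq_mul]; ring
    refine ⟨fun e x hx => by simp [hf0 e x hx], c • f1, c • f2, c • f3,
      fun e => (hf1 e).const_mul c, fun e => (hf2 e).const_mul c, fun e => ?_,
      ⟨c • vf, fun e => ?_, fun v hv => ?_, fun v hv => ?_⟩, fun e => ?_⟩
    · rw [hD]; exact (hf3 e).const_mul c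
    · simp [(hfc e).1, (hfc e).2]
    · simp [hfd v hv]
    · rw [hD]
      simp only [← Finset.mul_sum, Pi.smul_apply, smul_eq_mul]
      linear_combination c * hfv v hv
    · filter_upwards [hf e] with x hx
      simp only [covDeriv, Pi.smul_apply, smul_eq_mul] at hx ⊢
      linear_combination c * hx

/-- `μ = λ_n(H^A)`, where the eigenvalues `λ_1 ≤ λ_2 ≤ …` are repeated according to their
multiplicities: fewer than `n` eigenvalues lie below `μ`, and at least `n` are at most `μ`. -/
def IsNthEigenvalue {G : QuantumGraph V E} (A : G.MagneticPotential) (n : ℕ) (μ : ℝ) : Prop :=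
  Module.rank ℂ ↥(⨆ ν ∈ Set.Iio μ, eigenspace A ν) < n ∧
    n ≤ Module.rank ℂ ↥(⨆ ν ∈ Set.Iic μ, eigenspace A ν)

/-- `Λ` is the `n`-th magnetic eigenvalue as a function of the fluxes modulo `2π` through the
closed walks `σ j`: whenever `α j ≡ ∮_{σ j} A (mod 2π)` for all `j`, then `Λ α = λ_n(H^A)`. -/
def IsMagneticEigenvalue (G : QuantumGraph V E) {k : ℕ} (σ : Fin k → FreeGroup E) (n : ℕ)
    (Λ : (Fin k → ℝ) → ℝ) : Prop :=
  ∀ (A : G.MagneticPotential) (α : Fin k → ℝ),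
    (∀ j, (α j : Real.Angle) = (flux A (σ j) : Real.Angle)) → IsNthEigenvalue A n (Λ α)

/-- The internal zeros of a function, given by the edge and the coordinate on it. -/
def internalZeros (G : QuantumGraph V E) (f : E → ℝ → ℂ) : Set (E × ℝ) :=
  {p | p.2 ∈ Set.Ioo 0 (G.length p.1) ∧ f p.1 p.2 = 0}

/-- `f` is non-zero at all vertices that do not carry the Dirichlet condition. -/
def NonzeroAtVertices (G : QuantumGraph V E) (f : E → ℝ → ℂ) : Prop :=
  ∀ e, (G.src e ∉ G.dirichlet → f e 0 ≠ 0) ∧ (G.tgt e ∉ G.dirichlet → f e (G.length e) ≠ 0)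

end QuantumGraph

/-! ### Critical points -/

/-- The Hessian of `f` at `x`, as a bilinear form. -/
noncomputable def hessianAt {k : ℕ} (f : (Fin k → ℝ) → ℝ) (x : Fin k → ℝ) :
    LinearMap.BilinForm ℝ (Fin k → ℝ) :=
  (fderiv ℝ (fderiv ℝ f) x).toBilinForm

/-- `f` is twice continuously differentiable near `x`, its first derivative vanishes at `x`, and
its Hessian at `x` is non-degenerate. -/
def IsNondegenerateCriticalPoint {k : ℕ} (f : (Fin k → ℝ) → ℝ) (x : Fin k → ℝ) : Prop :=
  ContDiffAt ℝ 2 f x ∧ fderiv ℝ f x = 0 ∧ (hessianAt f x).Nondegenerate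

/-- The Morse index: the largest dimension of a subspace on which the Hessian is negative
definite. -/
noncomputable def morseIndex {k : ℕ} (f : (Fin k → ℝ) → ℝ) (x : Fin k → ℝ) : ℕ :=
  sigNeg (LinearMap.BilinMap.toQuadraticMap (hessianAt f x))

/-! Cut every edge into equal pieces so short that `-d²/dx² + q - μ` with Dirichlet conditions is
positive on each piece for all `μ ≤ M`. A solution is then determined on a piece by its two end
values, and the eigenvalue problem becomes the kernel equation of a finite Hermitian matrix
`Discretization.op μ z` indexed by the division points. Gauging the potential away along each edge
leaves only one phase `z e` per edge, which is placed on the last piece (`rank_eigenspace`). The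
matrix form decreases strictly in `μ` and is nonnegative for very negative `μ`, so its index counts
the eigenvalues below `μ` (`IsSpectralFlow.rank_Iio_eq`, `isNthEigenvalue_iff`). Phases with the
same fluxes are related by a gauge transformation at the vertices (`exists_gauge`); therefore `λ_n`
is a function of the fluxes.

At `λ` the number of pieces is chosen so that `ψ`, which may be taken real, vanishes at no node.
Writing a function as `ψ · x` turns the form into a magnetic Laplacian `∑ w_p |x(t) - exp(iθ_p)
x(s)|²` with `w_p = b_p ψ(s) ψ(t)` and `b_p > 0` (`form_mulReal`). A piece contains at most one zero
of `ψ`, and it contains one exactly when the signs at its ends differ. Hence the number of negative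
weights is the number of internal zeros (`ncard_zeros`). Because `λ` is simple, the kernel at zero
flux consists of the constants.

The implicit function theorem yields a `C²` branch of eigenvalues through `λ` (`exists_branch`);
lower semicontinuity of index and coindex identifies it with `λ_n` (`eventually_isNthEigenvalue`).
First-order perturbation theory gives a zero gradient. Second-order perturbation theory gives the
Hessian at a flux vector `α` as `(2 / c₀) ∑ w_p c_p²`, where `c` is the cochain with flux `α` that
is orthogonal to all coboundaries for the diagonal form of the weights, and `-c₀ < 0` is the
derivative in `μ` of the form at `ψ` (`hessian_eq`).

The conclusion is linear algebra (`index_cokernel`). Simplicity of `λ` makes the diagonal form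
nondegenerate on coboundaries, so the cochains split orthogonally into coboundaries and their
orthogonal complement, and the complement is isomorphic to the flux space. The index of the whole
diagonal form is the number of zeros; on coboundaries it is the index of the discretized form, which
is `n - 1` (`sigNeg_quad_eq`); on the complement it is the Morse index. No weight vanishes, so the
Hessian is nondegenerate, and comparing indices gives the nodal surplus. -/

/-! ### Absolutely continuous functions given by their derivative -/

/-- `f` is absolutely continuous on `[0, L]` with integrable derivative `g`. -/
def HasIntegralDeriv {F : Type*} [NormedAddCommGroup F] [NormedSpace ℝ F]
    (L : ℝ) (f g : ℝ → F) : Prop :=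
  IntervalIntegrable g volume 0 L ∧ ∀ x ∈ Set.Icc 0 L, f x = f 0 + ∫ t in (0 : ℝ)..x, g t

theorem HasH1Deriv.hasIntegralDeriv {F : Type*} [NormedAddCommGroup F] [NormedSpace ℝ F]
    {L : ℝ} {f g : ℝ → F} (hL : 0 ≤ L) (h : HasH1Deriv L f g) : HasIntegralDeriv L f g :=
  ⟨h.intervalIntegrable ⟨hL, le_rfl⟩, h.2⟩

namespace HasIntegralDeriv

variable {F : Type*} [NormedAddCommGroup F] [NormedSpace ℝ F] {L : ℝ} {f g f₁ g₁ : ℝ → F}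

theorem intervalIntegrable_of_mem (h : HasIntegralDeriv L f g) {p r : ℝ}
    (hp : p ∈ Set.Icc 0 L) (hr : r ∈ Set.Icc 0 L) : IntervalIntegrable g volume p r := by
  refine h.1.mono_set ?_
  rw [Set.uIcc_of_le (hp.1.trans hp.2)]
  exact Set.uIcc_subset_Icc hp hr

theorem eq_add_integral (h : HasIntegralDeriv L f g) {p r : ℝ}
    (hp : p ∈ Set.Icc 0 L) (hr : r ∈ Set.Icc 0 L) : f r = f p + ∫ t in p..r, g t := by
  have h0 : (0 : ℝ) ∈ Set.Icc 0 L := ⟨le_rfl, hp.1.trans hp.2⟩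
  rw [h.2 p hp, h.2 r hr, add_assoc, intervalIntegral.integral_add_adjacent_intervals
    (h.intervalIntegrable_of_mem h0 hp) (h.intervalIntegrable_of_mem hp hr)]

theorem continuousOn (h : HasIntegralDeriv L f g) : ContinuousOn f (Set.Icc 0 L) := by
  rcases lt_or_ge L 0 with hL | hL
  · rw [Set.Icc_eq_empty (not_le.2 hL)]; exact continuousOn_empty _
  have h1 : ContinuousOn (fun x => f 0 + ∫ t in (0 : ℝ)..x, g t) (Set.Icc 0 L) := by
    refine continuousOn_const.add ?_
    have := intervalIntegral.continuousOn_primitive_interval' h.1 (a := 0) (by simp)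
    rwa [Set.uIcc_of_le hL] at this
  exact h1.congr fun x hx => h.2 x hx

theorem add (h : HasIntegralDeriv L f g) (h₁ : HasIntegralDeriv L f₁ g₁) :
    HasIntegralDeriv L (fun x => f x + f₁ x) (fun x => g x + g₁ x) := by
  refine ⟨h.1.add h₁.1, fun x hx => ?_⟩
  have h0 : (0 : ℝ) ∈ Set.Icc 0 L := ⟨le_rfl, hx.1.trans hx.2⟩
  simp only
  rw [h.2 x hx, h₁.2 x hx, intervalIntegral.integral_add (h.intervalIntegrable_of_mem h0 hx)
    (h₁.intervalIntegrable_of_mem h0 hx)]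
  abel

theorem congr_deriv (hL : 0 ≤ L) (h : HasIntegralDeriv L f g)
    (hg : ∀ᵐ x ∂volume.restrict (Set.Icc 0 L), g x = g₁ x) : HasIntegralDeriv L f g₁ := by
  rw [ae_restrict_iff' measurableSet_Icc] at hg
  refine ⟨h.1.congr_ae ?_, fun x hx => ?_⟩
  · rw [Set.uIoc_of_le hL, Filter.EventuallyEq, ae_restrict_iff' measurableSet_Ioc]
    filter_upwards [hg] with x hx hx1 using hx ⟨hx1.1.le, hx1.2⟩
  · rw [h.2 x hx]
    congr 1
    refine intervalIntegral.integral_congr_ae ?_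
    filter_upwards [hg] with t ht ht1
    rw [Set.uIoc_of_le hx.1] at ht1
    exact ht ⟨ht1.1.le, ht1.2.trans hx.2⟩

end HasIntegralDeriv

theorem HasIntegralDeriv.const_mul {L : ℝ} {𝕜 : Type*} [RCLike 𝕜] {f g : ℝ → 𝕜}
    (h : HasIntegralDeriv L f g) (c : 𝕜) :
    HasIntegralDeriv L (fun x => c * f x) (fun x => c * g x) := by
  refine ⟨h.1.const_mul c, fun x hx => ?_⟩
  simp only
  rw [h.2 x hx, intervalIntegral.integral_const_mul]
  ring

/-- The product of the primitives minus the primitive of the Leibniz expression is absolutely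
continuous with derivative zero almost everywhere, hence constant. -/
theorem HasIntegralDeriv.mul {L : ℝ} (hL : 0 ≤ L) {f g f₁ g₁ : ℝ → ℝ}
    (h : HasIntegralDeriv L f g)
    (h₁ : HasIntegralDeriv L f₁ g₁) :
    HasIntegralDeriv L (fun x => f x * f₁ x) (fun x => g x * f₁ x + f x * g₁ x) := by
  have hI : Set.uIcc 0 L = Set.Icc 0 L := Set.uIcc_of_le hL
  have hgi : IntervalIntegrable (fun x => g x * f₁ x + f x * g₁ x) volume 0 L :=
    (h.1.mul_continuousOn (hI ▸ h₁.continuousOn)).add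
      (h₁.1.continuousOn_mul (hI ▸ h.continuousOn))
  refine ⟨hgi, ?_⟩
  have z : (0 : ℝ) ∈ Set.uIcc 0 L := by simp
  -- `f` and `f₁` are controlled only on `[0, L]`; these primitives coincide with them there and
  -- have the two-sided derivatives required below.
  set F : ℝ → ℝ := fun x => f 0 + ∫ t in (0 : ℝ)..x, g t
  set F₁ : ℝ → ℝ := fun x => f₁ 0 + ∫ t in (0 : ℝ)..x, g₁ t
  have cAC : ∀ c : ℝ, AbsolutelyContinuousOnInterval (fun _ => c) 0 L := fun c =>
    (LipschitzWith.const c).lipschitzOnWith.absolutelyContinuousOnInterval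
  have hF : AbsolutelyContinuousOnInterval F 0 L :=
    (cAC _).add (h.1.absolutelyContinuousOnInterval_intervalIntegral z)
  have hF₁ : AbsolutelyContinuousOnInterval F₁ 0 L :=
    (cAC _).add (h₁.1.absolutelyContinuousOnInterval_intervalIntegral z)
  have hG := (hF.fun_mul hF₁).sub (hgi.absolutelyContinuousOnInterval_intervalIntegral z)
  obtain ⟨C, hC⟩ := hG.const_of_ae_hasDerivAt_zero (by
    filter_upwards [h.1.ae_hasDerivAt_integral, h₁.1.ae_hasDerivAt_integral,
      hgi.ae_hasDerivAt_integral] with x h1 h2 h3 hx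
    have e1 : F x = f x := (h.2 x (hI ▸ hx)).symm
    have e2 : F₁ x = f₁ x := (h₁.2 x (hI ▸ hx)).symm
    have d1 : HasDerivAt F (g x) x := (h1 hx 0 z).const_add _
    have d2 : HasDerivAt F₁ (g₁ x) x := (h2 hx 0 z).const_add _
    convert! (d1.mul d2).sub (h3 hx 0 z) using 1
    rw [e1, e2]; ring)
  intro x hx
  have h1 := hC x (hI.symm ▸ hx)
  have h0 := hC 0 z
  simp only [Pi.sub_apply, F, F₁, intervalIntegral.integral_same, add_zero, sub_zero] at h1 h0
  rw [← h.2 x hx, ← h₁.2 x hx] at h1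
  simp only
  linarith

theorem hasIntegralDeriv_complex_iff {L : ℝ} {f g : ℝ → ℂ} :
    HasIntegralDeriv L f g ↔ HasIntegralDeriv L (fun x => (f x).re) (fun x => (g x).re) ∧
      HasIntegralDeriv L (fun x => (f x).im) (fun x => (g x).im) := by
  constructor
  · rintro ⟨h, h1⟩
    have hgi : ∀ x ∈ Set.Icc 0 L, IntervalIntegrable g volume 0 x := fun x hx =>
      h.mono_set (by rw [Set.uIcc_of_le hx.1, Set.uIcc_of_le (hx.1.trans hx.2)]
                     exact Set.Icc_subset_Icc_right hx.2)
    refine ⟨⟨⟨h.1.re, h.2.re⟩, fun x hx => ?_⟩, ⟨⟨h.1.im, h.2.im⟩, fun x hx => ?_⟩⟩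
    · have := Complex.reCLM.intervalIntegral_comp_comm (hgi x hx)
      simp only [Complex.reCLM_apply] at this
      simp only
      rw [this, h1 x hx, Complex.add_re]
    · have := Complex.imCLM.intervalIntegral_comp_comm (hgi x hx)
      simp only [Complex.imCLM_apply] at this
      simp only
      rw [this, h1 x hx, Complex.add_im]
  · rintro ⟨⟨h, h1⟩, ⟨h', h1'⟩⟩
    have hg : IntervalIntegrable g volume 0 L := by
      have a1 : IntervalIntegrable (fun x => ((g x).re : ℂ)) volume 0 L :=
        ⟨h.1.ofReal, h.2.ofReal⟩
      have a2 : IntervalIntegrable (fun x => ((g x).im : ℂ)) volume 0 L :=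
        ⟨h'.1.ofReal, h'.2.ofReal⟩
      have := a1.add (a2.mul_const Complex.I)
      refine this.congr_ae (Eventually.of_forall fun x => ?_)
      exact Complex.re_add_im (g x)
    refine ⟨hg, fun x hx => ?_⟩
    have hgi : IntervalIntegrable g volume 0 x :=
      hg.mono_set (by rw [Set.uIcc_of_le hx.1, Set.uIcc_of_le (hx.1.trans hx.2)]
                      exact Set.Icc_subset_Icc_right hx.2)
    have r1 := Complex.reCLM.intervalIntegral_comp_comm hgi
    have r2 := Complex.imCLM.intervalIntegral_comp_comm hgi
    simp only [Complex.reCLM_apply, Complex.imCLM_apply] at r1 r2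
    refine Complex.ext ?_ ?_
    · rw [Complex.add_re, ← r1, ← h1 x hx]
    · rw [Complex.add_im, ← r2, ← h1' x hx]

theorem HasIntegralDeriv.mul_complex {L : ℝ} (hL : 0 ≤ L) {f g f₁ g₁ : ℝ → ℂ}
    (h : HasIntegralDeriv L f g)
    (h₁ : HasIntegralDeriv L f₁ g₁) :
    HasIntegralDeriv L (fun x => f x * f₁ x) (fun x => g x * f₁ x + f x * g₁ x) := by
  obtain ⟨a, b⟩ := hasIntegralDeriv_complex_iff.1 h
  obtain ⟨a₁, b₁⟩ := hasIntegralDeriv_complex_iff.1 h₁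
  refine hasIntegralDeriv_complex_iff.2 ⟨?_, ?_⟩
  · convert! (a.mul hL a₁).add ((b.mul hL b₁).const_mul (-1)) using 1 <;> funext x <;>
      simp <;> ring
  · convert! (a.mul hL b₁).add (b.mul hL a₁) using 1 <;> funext x <;> simp <;> ring

/-! ### Piecewise continuous potentials -/

/-- Near each point the one-sided limits bound `q` on both sides and the value at the point bounds
the rest; compactness makes the bound global. -/
theorem PiecewiseContinuous.exists_bound {L : ℝ} {q : ℝ → ℝ} (h : PiecewiseContinuous L q) :
    ∃ Q : ℝ, 0 ≤ Q ∧ ∀ x ∈ Set.Icc 0 L, |q x| ≤ Q := by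
  suffices ∃ Q : ℝ, ∀ x ∈ Set.Icc 0 L, |q x| ≤ Q by
    obtain ⟨Q, hQ⟩ := this
    exact ⟨max Q 0, le_max_right _ _, fun x hx => (hQ x hx).trans (le_max_left _ _)⟩
  have bdd : ∀ {l : Filter ℝ} {c : ℝ}, Tendsto q l (𝓝 c) → ∀ᶠ y in l, |q y| ≤ |c| + 1 := by
    intro l c hc
    exact (hc.abs.eventually (gt_mem_nhds (lt_add_one |c|))).mono fun y hy => hy.le
  refine isCompact_Icc.induction_on (p := fun s => ∃ Q : ℝ, ∀ x ∈ s, |q x| ≤ Q) ⟨0, by simp⟩ ?_ ?_ ?_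
  · rintro s t hst ⟨Q, hQ⟩
    exact ⟨Q, fun x hx => hQ x (hst hx)⟩
  · rintro s t ⟨Q, hQ⟩ ⟨Q', hQ'⟩
    exact ⟨max Q Q', fun x hx => hx.elim (fun hx => (hQ x hx).trans (le_max_left _ _))
      fun hx => (hQ' x hx).trans (le_max_right _ _)⟩
  · intro x hx
    obtain ⟨c₁, h₁⟩ : ∃ c, ∀ᶠ y in 𝓝[>] x, y ≤ L → |q y| ≤ c := by
      rcases hx.2.lt_or_eq with hlt | heq
      · obtain ⟨l, hl⟩ := h.2.1 x ⟨hx.1, hlt⟩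
        exact ⟨_, (bdd hl).mono fun y hy _ => hy⟩
      · refine ⟨0, ?_⟩
        filter_upwards [self_mem_nhdsWithin] with y hy hyL
        exact absurd hyL (not_le.2 (heq ▸ hy))
    obtain ⟨c₂, h₂⟩ : ∃ c, ∀ᶠ y in 𝓝[<] x, 0 ≤ y → |q y| ≤ c := by
      rcases hx.1.lt_or_eq with hlt | heq
      · obtain ⟨l, hl⟩ := h.2.2 x ⟨hlt, hx.2⟩
        exact ⟨_, (bdd hl).mono fun y hy _ => hy⟩
      · refine ⟨0, ?_⟩
        filter_upwards [self_mem_nhdsWithin] with y hy hyL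
        exact absurd hyL (not_le.2 (heq ▸ hy))
    refine ⟨{y | y ∈ Set.Icc 0 L → |q y| ≤ max (max c₁ c₂) |q x|} ∩ Set.Icc 0 L, ?_,
      max (max c₁ c₂) |q x|, fun y hy => hy.1 hy.2⟩
    refine inter_mem (mem_nhdsWithin_of_mem_nhds ?_) self_mem_nhdsWithin
    rw [← nhdsNE_sup_pure, ← nhdsLT_sup_nhdsGT]
    refine mem_sup.2 ⟨mem_sup.2 ⟨?_, ?_⟩, ?_⟩
    · filter_upwards [h₂] with y hy hyL
      exact (hy hyL.1).trans ((le_max_right _ _).trans (le_max_left _ _))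
    · filter_upwards [h₁] with y hy hyL
      exact (hy hyL.2).trans ((le_max_left _ _).trans (le_max_left _ _))
    · exact fun _ => le_max_right _ _

theorem PiecewiseContinuous.intervalIntegrable {L : ℝ} (hL : 0 ≤ L) {q : ℝ → ℝ}
    (h : PiecewiseContinuous L q) : IntervalIntegrable q volume 0 L := by
  obtain ⟨Q, -, hQ⟩ := h.exists_bound
  obtain ⟨S, hS, hc⟩ := h.1
  rw [intervalIntegrable_iff_integrableOn_Icc_of_le hL]
  have hae : (Set.Icc 0 L \ S : Set ℝ) =ᵐ[volume] Set.Icc 0 L :=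
    sdiff_null_ae_eq_self (hS.measure_zero volume)
  have hm : AEStronglyMeasurable q (volume.restrict (Set.Icc 0 L)) := by
    rw [← Measure.restrict_congr_set hae]
    refine ContinuousOn.aestronglyMeasurable (fun x hx => (hc x hx).mono Set.sdiff_subset) ?_
    exact measurableSet_Icc.diff hS.measurableSet
  refine IntegrableOn.of_bound (C := Q) (by simp) hm ?_
  filter_upwards [ae_restrict_mem measurableSet_Icc] with x hx using hQ x hx

/-! ### Volterra operators -/

/-- A bounded potential on `[0, L]`. -/
structure IsPotential (L Q : ℝ) (q : ℝ → ℝ) : Prop where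
  pos : 0 < L
  nonneg : 0 ≤ Q
  bound : ∀ x ∈ Set.Icc 0 L, |q x| ≤ Q
  integrable : IntervalIntegrable q volume 0 L

theorem PiecewiseContinuous.exists_isPotential {L : ℝ} (hL : 0 < L) {q : ℝ → ℝ}
    (h : PiecewiseContinuous L q) : ∃ Q, IsPotential L Q q := by
  obtain ⟨Q, h0, hQ⟩ := h.exists_bound
  exact ⟨Q, hL, h0, hQ, h.intervalIntegrable hL.le⟩

section Volterra

variable {L : ℝ} (hL : 0 ≤ L)

theorem intervalIntegrable_mul_IccExtend {w : ℝ → ℝ} (hw : IntervalIntegrable w volume 0 L)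
    (f : C(Set.Icc 0 L, ℝ)) :
    IntervalIntegrable (fun t => w t * Set.IccExtend hL f t) volume 0 L :=
  hw.mul_continuousOn (f.continuous.Icc_extend' (h := hL)).continuousOn

theorem abs_integral_mul_IccExtend_le {w : ℝ → ℝ} (hw : IntervalIntegrable w volume 0 L)
    (f : C(Set.Icc 0 L, ℝ)) {x : ℝ} (hx : x ∈ Set.Icc 0 L) :
    |∫ t in (0 : ℝ)..x, w t * Set.IccExtend hL f t| ≤ (∫ t in (0 : ℝ)..L, |w t|) * ‖f‖ := by
  have hw0 : IntervalIntegrable (fun t => |w t|) volume 0 L := hw.abs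
  have hwx : IntervalIntegrable (fun t => |w t|) volume 0 x :=
    hw0.mono_set (by rw [Set.uIcc_of_le hx.1, Set.uIcc_of_le hL]
                     exact Set.Icc_subset_Icc_right hx.2)
  calc |∫ t in (0 : ℝ)..x, w t * Set.IccExtend hL f t|
      ≤ ∫ t in (0 : ℝ)..x, |w t| * ‖f‖ := by
        rw [← Real.norm_eq_abs]
        refine intervalIntegral.norm_integral_le_of_norm_le hx.1
          (Eventually.of_forall fun t _ => ?_) (hwx.mul_const ‖f‖)
        rw [norm_mul]
        exact mul_le_mul_of_nonneg_left (f.norm_coe_le_norm _) (abs_nonneg _)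
    _ = (∫ t in (0 : ℝ)..x, |w t|) * ‖f‖ := by rw [intervalIntegral.integral_mul_const]
    _ ≤ _ := by
        refine mul_le_mul_of_nonneg_right ?_ (norm_nonneg _)
        refine intervalIntegral.integral_mono_interval le_rfl hx.1 hx.2 ?_ hw0
        exact Eventually.of_forall fun t => abs_nonneg _

theorem continuous_integral_mul_IccExtend {w : ℝ → ℝ} (hw : IntervalIntegrable w volume 0 L)
    (f : C(Set.Icc 0 L, ℝ)) :
    Continuous fun x : Set.Icc 0 L => ∫ t in (0 : ℝ)..x, w t * Set.IccExtend hL f t := by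
  have := intervalIntegral.continuousOn_primitive_interval'
    (intervalIntegrable_mul_IccExtend hL hw f) (a := 0) (by simp)
  rw [Set.uIcc_of_le hL] at this
  exact this.domRestrict

theorem integral_add_mul_IccExtend {w : ℝ → ℝ} (hw : IntervalIntegrable w volume 0 L)
    (f g : C(Set.Icc 0 L, ℝ)) (x : Set.Icc 0 L) :
    ∫ t in (0 : ℝ)..x, w t * Set.IccExtend hL (f + g : C(Set.Icc 0 L, ℝ)) t =
      (∫ t in (0 : ℝ)..x, w t * Set.IccExtend hL f t) +
        ∫ t in (0 : ℝ)..x, w t * Set.IccExtend hL g t := by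
  have hm : ∀ f : C(Set.Icc 0 L, ℝ),
      IntervalIntegrable (fun t => w t * Set.IccExtend hL f t) volume 0 x := fun f =>
    (intervalIntegrable_mul_IccExtend hL hw f).mono_set
      (by rw [Set.uIcc_of_le x.2.1, Set.uIcc_of_le hL]
          exact Set.Icc_subset_Icc_right x.2.2)
  rw [← intervalIntegral.integral_add (hm f) (hm g)]
  simp only [Set.IccExtend, Function.comp, ContinuousMap.add_apply, mul_add]

theorem integral_smul_mul_IccExtend {w : ℝ → ℝ} (c : ℝ)
    (f : C(Set.Icc 0 L, ℝ)) (x : Set.Icc 0 L) :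
    ∫ t in (0 : ℝ)..x, w t * Set.IccExtend hL (c • f : C(Set.Icc 0 L, ℝ)) t =
      c * ∫ t in (0 : ℝ)..x, w t * Set.IccExtend hL f t := by
  rw [← intervalIntegral.integral_const_mul]
  simp only [Set.IccExtend, Function.comp, ContinuousMap.smul_apply, smul_eq_mul]
  congr 1
  funext t
  ring

/-- The operator `f ↦ ∫₀ˣ w f` on the continuous functions on `[0, L]`. -/
noncomputable def volterra {w : ℝ → ℝ} (hw : IntervalIntegrable w volume 0 L) :
    C(Set.Icc 0 L, ℝ) →L[ℝ] C(Set.Icc 0 L, ℝ) :=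
  LinearMap.mkContinuous
    { toFun := fun f => ⟨_, continuous_integral_mul_IccExtend hL hw f⟩
      map_add' := fun f g => ContinuousMap.ext (integral_add_mul_IccExtend hL hw f g)
      map_smul' := fun c f => ContinuousMap.ext (integral_smul_mul_IccExtend hL c f) }
    (∫ t in (0 : ℝ)..L, |w t|) fun f => by
      rw [ContinuousMap.norm_le _ (mul_nonneg (intervalIntegral.integral_nonneg hL
        fun _ _ => abs_nonneg _) (norm_nonneg _))]
      exact fun x => abs_integral_mul_IccExtend_le hL hw f x.2

theorem volterra_apply {w : ℝ → ℝ} (hw : IntervalIntegrable w volume 0 L)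
    (f : C(Set.Icc 0 L, ℝ)) (x : Set.Icc 0 L) :
    volterra hL hw f x = ∫ t in (0 : ℝ)..x, w t * Set.IccExtend hL f t := rfl

/-- Each integration gains a power of `x` and a factor `1 / (n + 1)`; iterating this makes powers of
the Volterra kernel factorially small. -/
theorem abs_volterra_apply_le {w : ℝ → ℝ} (hw : IntervalIntegrable w volume 0 L) {B c : ℝ}
    (hB : 0 ≤ B) (hwB : ∀ x ∈ Set.Icc 0 L, |w x| ≤ B) {n : ℕ} {f : C(Set.Icc 0 L, ℝ)}
    (hf : ∀ x, |f x| ≤ c * x.1 ^ n) (x : Set.Icc 0 L) :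
    |volterra hL hw f x| ≤ B * c / (n + 1) * x.1 ^ (n + 1) := by
  rw [volterra_apply]
  calc |∫ t in (0 : ℝ)..x, w t * Set.IccExtend hL f t|
      ≤ ∫ t in (0 : ℝ)..x, B * c * t ^ n := by
        rw [← Real.norm_eq_abs]
        refine intervalIntegral.norm_integral_le_of_norm_le (g := fun t => B * c * t ^ n) x.2.1
          (Eventually.of_forall fun t ht => ?_) (Continuous.intervalIntegrable (by fun_prop) _ _)
        have ht' : t ∈ Set.Icc 0 L := ⟨ht.1.le, ht.2.trans x.2.2⟩
        rw [norm_mul, Set.IccExtend_of_mem hL f ht', mul_assoc]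
        exact mul_le_mul (hwB t ht') (hf ⟨t, ht'⟩) (norm_nonneg _) hB
    _ = _ := by
        rw [intervalIntegral.integral_const_mul, integral_pow]
        simp
        ring

end Volterra

/-! ### Solutions of the Schrödinger equation on an edge -/

/-- `u` solves `-u'' + q u = μ u` on `[0, L]`, and `v` is its derivative. -/
structure IsSolution (L : ℝ) (q : ℝ → ℝ) (μ : ℝ) (u v : ℝ → ℝ) : Prop where
  left : HasIntegralDeriv L u v
  right : HasIntegralDeriv L v (fun t => (q t - μ) * u t)

namespace IsSolution

variable {L : ℝ} {q : ℝ → ℝ} {μ : ℝ} {u v u₁ v₁ : ℝ → ℝ}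

theorem add (h : IsSolution L q μ u v) (h₁ : IsSolution L q μ u₁ v₁) :
    IsSolution L q μ (fun x => u x + u₁ x) (fun x => v x + v₁ x) := by
  refine ⟨h.left.add h₁.left, ?_⟩
  convert! h.right.add h₁.right using 2
  ring

theorem const_mul (h : IsSolution L q μ u v) (c : ℝ) :
    IsSolution L q μ (fun x => c * u x) (fun x => c * v x) := by
  refine ⟨h.left.const_mul c, ?_⟩
  convert! h.right.const_mul c using 2
  ring

/-- The Wronskian of two solutions is constant. -/
theorem wronskian_eq (hL : 0 ≤ L) (h : IsSolution L q μ u v) (h₁ : IsSolution L q μ u₁ v₁)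
    {x y : ℝ} (hx : x ∈ Set.Icc 0 L) (hy : y ∈ Set.Icc 0 L) :
    u x * v₁ x - v x * u₁ x = u y * v₁ y - v y * u₁ y := by
  have h1 := (h.left.mul hL h₁.right).add ((h.right.mul hL h₁.left).const_mul (-1))
  have h2 := h1.eq_add_integral hy hx
  have h3 : ∀ t : ℝ, v t * v₁ t + u t * ((q t - μ) * u₁ t) +
      -1 * ((q t - μ) * u t * u₁ t + v t * v₁ t) = 0 := fun t => by ring
  simp only [h3, intervalIntegral.integral_zero] at h2
  linarith

end IsSolution

section Fundamental

variable {L Q : ℝ} {q : ℝ → ℝ}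

theorem IsPotential.intervalIntegrable_sub (h : IsPotential L Q q) (μ : ℝ) :
    IntervalIntegrable (fun t => q t - μ) volume 0 L :=
  h.integrable.sub (by simp)

/-- The operator `f ↦ ∫₀ˣ ∫₀ᵗ (q - μ) f`. -/
noncomputable def IsPotential.kernel (h : IsPotential L Q q) (μ : ℝ) :
    C(Set.Icc 0 L, ℝ) →L[ℝ] C(Set.Icc 0 L, ℝ) :=
  volterra h.pos.le (w := fun _ => 1) (by simp) *
    (volterra h.pos.le h.integrable - μ • volterra h.pos.le (w := fun _ => 1) (by simp))

/-- `kernel` is written with the right-hand side so that it is visibly affine in `μ`; this identity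
returns it to the form used for estimates. -/
theorem IsPotential.volterra_sub (h : IsPotential L Q q) (μ : ℝ) :
    volterra h.pos.le (h.intervalIntegrable_sub μ) =
      volterra h.pos.le h.integrable - μ • volterra h.pos.le (w := fun _ => 1) (by simp) := by
  ext f x
  have h1 := intervalIntegrable_mul_IccExtend h.pos.le h.integrable f
  have h2 := intervalIntegrable_mul_IccExtend h.pos.le (w := fun _ => 1) (by simp) f
  have hs : Set.uIcc 0 x.1 ⊆ Set.uIcc 0 L := by
    rw [Set.uIcc_of_le x.2.1, Set.uIcc_of_le h.pos.le]
    exact Set.Icc_subset_Icc_right x.2.2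
  simp only [sub_apply, smul_apply,
    ContinuousMap.sub_apply, ContinuousMap.smul_apply, smul_eq_mul, volterra_apply]
  rw [← intervalIntegral.integral_const_mul, ← intervalIntegral.integral_sub (h1.mono_set hs)
    ((h2.mono_set hs).const_mul μ)]
  congr 1
  funext t
  ring

/-- Every application integrates twice. Only one of the two gains is kept; the other is wasted
through `x ≤ L`, which still leaves a factorial. -/
theorem IsPotential.abs_kernel_pow_apply_le (h : IsPotential L Q q) (μ : ℝ) (n : ℕ)
    (f : C(Set.Icc 0 L, ℝ)) (x : Set.Icc 0 L) :
    |(h.kernel μ ^ n) f x| ≤ (L * (Q + |μ|)) ^ n / n.factorial * ‖f‖ * x.1 ^ n := by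
  have hB : 0 ≤ Q + |μ| := add_nonneg h.nonneg (abs_nonneg _)
  induction n generalizing x with
  | zero => simpa using f.norm_coe_le_norm x
  | succ n ih =>
    set c := (L * (Q + |μ|)) ^ n / n.factorial * ‖f‖ with hc
    have hc0 : 0 ≤ c := by have := h.pos.le; positivity
    have h1 := abs_volterra_apply_le h.pos.le (h.intervalIntegrable_sub μ) hB
      (fun x hx => (abs_sub _ _).trans (add_le_add_left (h.bound x hx) _)) ih
    have h2 : |volterra h.pos.le (w := fun _ => 1) (by simp)
        (volterra h.pos.le (h.intervalIntegrable_sub μ) ((h.kernel μ ^ n) f)) x| ≤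
        1 * ((Q + |μ|) * c / (n + 1)) / ((n + 1 : ℕ) + 1) * x.1 ^ (n + 1 + 1) :=
      abs_volterra_apply_le h.pos.le _ zero_le_one (by simp) h1 x
    have h3 : (h.kernel μ ^ (n + 1)) f x = volterra h.pos.le (w := fun _ => 1) (by simp)
        (volterra h.pos.le (h.intervalIntegrable_sub μ) ((h.kernel μ ^ n) f)) x := by
      rw [pow_succ', h.volterra_sub μ]; rfl
    rw [h3]
    refine h2.trans ?_
    have hx0 := x.2.1
    have e1 : (L * (Q + |μ|)) ^ (n + 1) / (n + 1).factorial * ‖f‖ * x.1 ^ (n + 1) =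
        (Q + |μ|) * c / (n + 1) * x.1 ^ (n + 1) * L := by
      rw [hc, Nat.factorial_succ]
      push_cast
      field_simp
      ring
    rw [e1, one_mul, pow_succ x.1 (n + 1), ← mul_assoc]
    refine mul_le_mul ?_ x.2.2 hx0 (by positivity)
    refine mul_le_mul_of_nonneg_right ?_ (by positivity)
    refine div_le_self (by positivity) ?_
    push_cast
    linarith [(Nat.cast_nonneg n : (0 : ℝ) ≤ n)]

/-- Some power of the kernel `K` has norm below one, so `1 - K ^ n` is invertible, and `1 - K` is a
commuting factor of it by the geometric sum. -/
theorem IsPotential.isUnit_one_sub_kernel (h : IsPotential L Q q) (μ : ℝ) :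
    IsUnit (1 - h.kernel μ) := by
  have ht := FloorSemiring.tendsto_pow_div_factorial_atTop (L * (Q + |μ|) * L)
  obtain ⟨n, hn⟩ := (ht.eventually (gt_mem_nhds (zero_lt_one))).exists
  have hB : 0 ≤ Q + |μ| := add_nonneg h.nonneg (abs_nonneg _)
  have hL := h.pos.le
  have hnorm : ‖h.kernel μ ^ n‖ < 1 := by
    refine lt_of_le_of_lt ?_ hn
    refine ContinuousLinearMap.opNorm_le_bound _ (by positivity) fun f => ?_
    rw [ContinuousMap.norm_le _ (by positivity)]
    intro x
    refine (h.abs_kernel_pow_apply_le μ n f x).trans ?_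
    have h2 : x.1 ^ n ≤ L ^ n := pow_le_pow_left₀ x.2.1 x.2.2 n
    calc (L * (Q + |μ|)) ^ n / n.factorial * ‖f‖ * x.1 ^ n
        ≤ (L * (Q + |μ|)) ^ n / n.factorial * ‖f‖ * L ^ n := by gcongr
      _ = _ := by rw [mul_pow _ L]; ring
  have h1 : IsUnit ((1 - h.kernel μ) * ∑ i ∈ Finset.range n, h.kernel μ ^ i) := by
    rw [mul_neg_geom_sum]
    exact isUnit_one_sub_of_norm_lt_one
      (R := C(Set.Icc 0 L, ℝ) →L[ℝ] C(Set.Icc 0 L, ℝ)) hnorm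
  refine ((Commute.isUnit_mul_iff ?_).1 h1).1
  rw [commute_iff_eq, mul_neg_geom_sum, geom_sum_mul_neg]

/-- The solution operator of the integral equation `u = f + ∫₀ˣ ∫₀ᵗ (q - μ) u`. -/
noncomputable def IsPotential.resolve (h : IsPotential L Q q) (μ : ℝ) :
    C(Set.Icc 0 L, ℝ) →L[ℝ] C(Set.Icc 0 L, ℝ) := Ring.inverse (1 - h.kernel μ)

theorem IsPotential.contDiff_kernel (h : IsPotential L Q q) : ContDiff ℝ 2 h.kernel := by
  unfold IsPotential.kernel
  exact contDiff_const.clm_comp (contDiff_const.sub (contDiff_id.smul contDiff_const))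

theorem IsPotential.contDiff_resolve (h : IsPotential L Q q) : ContDiff ℝ 2 h.resolve := by
  rw [contDiff_iff_contDiffAt]
  intro μ
  obtain ⟨x, hx⟩ := h.isUnit_one_sub_kernel μ
  have h1 := contDiffAt_ringInverse ℝ (n := 2)
    (R := C(Set.Icc 0 L, ℝ) →L[ℝ] C(Set.Icc 0 L, ℝ)) x
  rw [hx] at h1
  exact h1.comp μ (contDiff_const.sub h.contDiff_kernel).contDiffAt

theorem IsPotential.resolve_eq_iff (h : IsPotential L Q q) (μ : ℝ) (f g : C(Set.Icc 0 L, ℝ)) :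
    g = h.resolve μ f ↔ g = f + h.kernel μ g := by
  have hu := h.isUnit_one_sub_kernel μ
  constructor
  · rintro rfl
    have h1 : (1 - h.kernel μ) (h.resolve μ f) = f := by
      have := Ring.mul_inverse_cancel _ hu
      exact congrArg (fun T : C(Set.Icc 0 L, ℝ) →L[ℝ] C(Set.Icc 0 L, ℝ) => T f) this
    have h2 : h.resolve μ f - h.kernel μ (h.resolve μ f) = f := h1
    rw [← sub_eq_iff_eq_add]; exact h2
  · intro hg
    have h1 : (1 - h.kernel μ) g = f := by
      rw [← sub_eq_iff_eq_add] at hg; exact hg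
    have := Ring.inverse_mul_cancel _ hu
    have h2 := congrArg (fun T : C(Set.Icc 0 L, ℝ) →L[ℝ] C(Set.Icc 0 L, ℝ) => T g) this
    have h3 : h.resolve μ ((1 - h.kernel μ) g) = g := h2
    rw [h1] at h3
    exact h3.symm

/-- The initial value problem is the integral equation `u = a + b x + K u`, so existence, uniqueness
and `C²` dependence on `μ` are all properties of `resolve`. -/
theorem IsPotential.exists_solution (h : IsPotential L Q q) (a b : ℝ) :
    ∃ u v : ℝ → ℝ → ℝ, (∀ μ, IsSolution L q μ (u μ) (v μ) ∧ u μ 0 = a ∧ v μ 0 = b) ∧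
      (∀ x ∈ Set.Icc 0 L, ContDiff ℝ 2 (fun μ => u μ x) ∧ ContDiff ℝ 2 (fun μ => v μ x)) ∧
      ∀ μ u₁ v₁, IsSolution L q μ u₁ v₁ → u₁ 0 = a → v₁ 0 = b →
        ∀ x ∈ Set.Icc 0 L, u₁ x = u μ x ∧ v₁ x = v μ x := by
  have hL := h.pos.le
  set f : C(Set.Icc 0 L, ℝ) := ⟨fun x => a + b * x.1, by fun_prop⟩ with hf
  set U : ℝ → C(Set.Icc 0 L, ℝ) := fun μ => h.resolve μ f with hU
  set Vf : ℝ → C(Set.Icc 0 L, ℝ) := fun μ =>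
    volterra hL (h.intervalIntegrable_sub μ) (U μ) with hV
  have hU0 : ∀ μ, U μ = f + h.kernel μ (U μ) := fun μ => (h.resolve_eq_iff μ f _).1 rfl
  have hker : ∀ μ (g : C(Set.Icc 0 L, ℝ)), h.kernel μ g = volterra hL (w := fun _ => 1) (by simp)
      (volterra hL (h.intervalIntegrable_sub μ) g) := fun μ g => by
    rw [h.volterra_sub μ]; rfl
  have z : (0 : ℝ) ∈ Set.Icc 0 L := ⟨le_rfl, hL⟩
  have hsol : ∀ μ, IsSolution L q μ (Set.IccExtend hL (U μ))
      (fun x => b + Set.IccExtend hL (Vf μ) x) ∧ Set.IccExtend hL (U μ) 0 = a ∧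
      b + Set.IccExtend hL (Vf μ) 0 = b := by
    intro μ
    have e0 : Set.IccExtend hL (Vf μ) 0 = 0 := by
      rw [Set.IccExtend_of_mem hL _ z]
      simp [hV, volterra_apply]
    have e1 : Set.IccExtend hL (U μ) 0 = a := by
      rw [Set.IccExtend_of_mem hL _ z, hU0 μ, hker]
      simp [hf, volterra_apply]
    refine ⟨⟨⟨?_, fun x hx => ?_⟩, ⟨?_, fun x hx => ?_⟩⟩, e1, by rw [e0, add_zero]⟩
    · exact Continuous.intervalIntegrable (by
        exact continuous_const.add ((Vf μ).continuous.Icc_extend' (h := hL))) _ _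
    · rw [e1, Set.IccExtend_of_mem hL _ hx, hU0 μ, hker, ContinuousMap.add_apply, volterra_apply,
        intervalIntegral.integral_add (by simp) (Continuous.intervalIntegrable
          ((Vf μ).continuous.Icc_extend' (h := hL)) _ _)]
      simp [hf, hV]
      ring
    · exact intervalIntegrable_mul_IccExtend hL (h.intervalIntegrable_sub μ) (U μ)
    · simp only
      rw [e0, Set.IccExtend_of_mem hL _ hx, hV, volterra_apply, add_zero]
  refine ⟨fun μ => Set.IccExtend hL (U μ), fun μ x => b + Set.IccExtend hL (Vf μ) x, hsol,
    fun x hx => ⟨?_, ?_⟩, ?_⟩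
  · simp only [Set.IccExtend_of_mem hL _ hx]
    have h1 : ContDiff ℝ 2 U := h.contDiff_resolve.clm_apply contDiff_const
    exact (ContinuousMap.evalCLM ℝ (⟨x, hx⟩ : Set.Icc 0 L)).contDiff.comp h1
  · simp only [Set.IccExtend_of_mem hL _ hx]
    have h1 : ContDiff ℝ 2 U := h.contDiff_resolve.clm_apply contDiff_const
    have h2 : ContDiff ℝ 2 Vf := by
      simp only [hV, h.volterra_sub]
      exact (contDiff_const.sub (contDiff_id.smul contDiff_const)).clm_apply h1
    have h3 := (ContinuousMap.evalCLM ℝ (⟨x, hx⟩ : Set.Icc 0 L)).contDiff.comp h2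
    exact contDiff_const.add h3
  · intro μ u₁ v₁ hs ha hb
    set g : C(Set.Icc 0 L, ℝ) := ⟨fun x => u₁ x, hs.left.continuousOn.domRestrict⟩ with hg
    have hv : ∀ x (hx : x ∈ Set.Icc 0 L),
        v₁ x = b + volterra hL (h.intervalIntegrable_sub μ) g ⟨x, hx⟩ := by
      intro x hx
      rw [hs.right.2 x hx, hb, volterra_apply]
      congr 1
      refine intervalIntegral.integral_congr fun t ht => ?_
      rw [Set.uIcc_of_le hx.1] at ht
      rw [Set.IccExtend_of_mem hL _ ⟨ht.1, ht.2.trans hx.2⟩, hg]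
      rfl
    have hgU : g = U μ := by
      refine (h.resolve_eq_iff μ f g).2 ?_
      ext x
      rw [ContinuousMap.add_apply, hker, volterra_apply]
      have : u₁ x = a + ∫ t in (0 : ℝ)..x, v₁ t := by rw [hs.left.2 x x.2, ha]
      change u₁ x = _
      rw [this, intervalIntegral.integral_congr (g := fun t => b + 1 * Set.IccExtend hL
        (volterra hL (h.intervalIntegrable_sub μ) g) t), intervalIntegral.integral_add (by simp)]
      · simp [hf]
        ring
      · exact Continuous.intervalIntegrable (by
          exact continuous_const.mul ((ContinuousMap.continuous _).Icc_extend' (h := hL))) _ _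
      · intro t ht
        rw [Set.uIcc_of_le x.2.1] at ht
        have ht' : t ∈ Set.Icc 0 L := ⟨ht.1, ht.2.trans x.2.2⟩
        simp only
        rw [Set.IccExtend_of_mem hL _ ht', hv t ht', one_mul]
    intro x hx
    refine ⟨?_, ?_⟩
    · simp only [Set.IccExtend_of_mem hL _ hx, ← hgU]
      rfl
    · simp only [Set.IccExtend_of_mem hL _ hx]
      rw [hv x hx, hgU]

/-- The solutions `c`, `s` of the Schrödinger equation with the initial values `(1, 0)` and
`(0, 1)`, with derivatives `c'`, `s'`; the first argument is the spectral parameter. -/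
structure FundamentalSystem (L : ℝ) (q : ℝ → ℝ) where
  c : ℝ → ℝ → ℝ
  c' : ℝ → ℝ → ℝ
  s : ℝ → ℝ → ℝ
  s' : ℝ → ℝ → ℝ
  isSolution_c : ∀ μ, IsSolution L q μ (c μ) (c' μ)
  isSolution_s : ∀ μ, IsSolution L q μ (s μ) (s' μ)
  c_zero : ∀ μ, c μ 0 = 1
  c'_zero : ∀ μ, c' μ 0 = 0
  s_zero : ∀ μ, s μ 0 = 0
  s'_zero : ∀ μ, s' μ 0 = 1
  contDiff_c : ∀ x ∈ Set.Icc 0 L, ContDiff ℝ 2 fun μ => c μ x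
  contDiff_c' : ∀ x ∈ Set.Icc 0 L, ContDiff ℝ 2 fun μ => c' μ x
  contDiff_s : ∀ x ∈ Set.Icc 0 L, ContDiff ℝ 2 fun μ => s μ x
  contDiff_s' : ∀ x ∈ Set.Icc 0 L, ContDiff ℝ 2 fun μ => s' μ x
  eq_of_isSolution : ∀ {μ u v}, IsSolution L q μ u v → ∀ x ∈ Set.Icc 0 L,
    u x = u 0 * c μ x + v 0 * s μ x ∧ v x = u 0 * c' μ x + v 0 * s' μ x

theorem IsPotential.nonempty_fundamentalSystem (h : IsPotential L Q q) :
    Nonempty (FundamentalSystem L q) := by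
  obtain ⟨c, c', hc, hcd, -⟩ := h.exists_solution 1 0
  obtain ⟨s, s', hs, hsd, -⟩ := h.exists_solution 0 1
  refine ⟨⟨c, c', s, s', fun μ => (hc μ).1, fun μ => (hs μ).1, fun μ => (hc μ).2.1,
    fun μ => (hc μ).2.2, fun μ => (hs μ).2.1, fun μ => (hs μ).2.2, fun x hx => (hcd x hx).1,
    fun x hx => (hcd x hx).2, fun x hx => (hsd x hx).1, fun x hx => (hsd x hx).2, ?_⟩⟩
  intro μ u v huv x hx
  obtain ⟨w, w', -, -, hu⟩ := h.exists_solution (u 0) (v 0)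
  have h1 := hu μ u v huv rfl rfl x hx
  have h2 := hu μ _ _ (((hc μ).1.const_mul (u 0)).add ((hs μ).1.const_mul (v 0)))
    (by simp [(hc μ).2.1, (hs μ).2.1]) (by simp [(hc μ).2.2, (hs μ).2.2]) x hx
  exact ⟨h1.1.trans h2.1.symm, h1.2.trans h2.2.symm⟩

end Fundamental

/-! ### The Dirichlet form on a short interval -/

/-- Nonnegativity of the variance of `f`, that is, of `∫ (f - k)²` with `k` the mean. -/
theorem sq_integral_le {a b : ℝ} (hab : a ≤ b) {f : ℝ → ℝ} (hf : ContinuousOn f (Set.Icc a b)) :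
    (∫ t in a..b, f t) ^ 2 ≤ (b - a) * ∫ t in a..b, f t ^ 2 := by
  rcases hab.eq_or_lt with rfl | hlt
  · simp
  have hf' : ContinuousOn f (Set.uIcc a b) := by rwa [Set.uIcc_of_le hab]
  have i1 : IntervalIntegrable f volume a b := hf'.intervalIntegrable
  have i2 : IntervalIntegrable (fun t => f t ^ 2) volume a b := (hf'.pow 2).intervalIntegrable
  set k := (∫ t in a..b, f t) / (b - a) with hk
  have h0 : 0 ≤ ∫ t in a..b, (f t - k) ^ 2 :=
    intervalIntegral.integral_nonneg hab fun _ _ => sq_nonneg _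
  have h1 : ∫ t in a..b, (f t - k) ^ 2 =
      (∫ t in a..b, f t ^ 2) - 2 * k * (∫ t in a..b, f t) + k ^ 2 * (b - a) := by
    have : ∀ t, (f t - k) ^ 2 = f t ^ 2 - 2 * k * f t + k ^ 2 := fun t => by ring
    simp only [this]
    rw [intervalIntegral.integral_add (i2.sub (i1.const_mul _)) (by simp),
      intervalIntegral.integral_sub i2 (i1.const_mul _), intervalIntegral.integral_const_mul,
      intervalIntegral.integral_const, smul_eq_mul]
    ring
  have hb : 0 < b - a := sub_pos.2 hlt
  have h2 : k * (b - a) = ∫ t in a..b, f t := by rw [hk]; field_simp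
  rw [h1, ← h2] at h0
  rw [← h2]
  nlinarith

/-- `w` is continuously differentiable on `[0, L]`, with derivative `w'`. -/
structure HasContDeriv (L : ℝ) (w w' : ℝ → ℝ) : Prop where
  hasDeriv : HasIntegralDeriv L w w'
  cont : ContinuousOn w' (Set.Icc 0 L)

theorem IsSolution.hasContDeriv {L μ : ℝ} {q u v : ℝ → ℝ} (h : IsSolution L q μ u v) :
    HasContDeriv L u v :=
  ⟨h.left, h.right.continuousOn⟩

theorem HasContDeriv.add {L : ℝ} {w w' z z' : ℝ → ℝ} (h : HasContDeriv L w w')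
    (h₁ : HasContDeriv L z z') : HasContDeriv L (fun x => w x + z x) (fun x => w' x + z' x) :=
  ⟨h.hasDeriv.add h₁.hasDeriv, h.cont.add h₁.cont⟩

theorem HasContDeriv.const_mul {L : ℝ} {w w' : ℝ → ℝ} (h : HasContDeriv L w w') (c : ℝ) :
    HasContDeriv L (fun x => c * w x) (fun x => c * w' x) :=
  ⟨h.hasDeriv.const_mul c, continuousOn_const.mul h.cont⟩

theorem hasContDeriv_affine (L a b : ℝ) : HasContDeriv L (fun x => a + b * x) (fun _ => b) :=
  ⟨⟨by simp, fun x _ => by simp [mul_comm]⟩, continuousOn_const⟩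

section Interval

variable {L Q μ p r : ℝ} {q : ℝ → ℝ}

/-- The interval `[p, r]` is contained in `[0, L]`, and it is short enough for the Dirichlet
realization of `-d²/dx² + q - μ` to be positive when `|q| ≤ Q`. -/
structure IsShort (L Q μ p r : ℝ) : Prop where
  nonneg : 0 ≤ p
  lt : p < r
  le : r ≤ L
  short : (Q + μ) * (r - p) ^ 2 < 8

theorem IsShort.left_mem (h : IsShort L Q μ p r) : p ∈ Set.Icc 0 L :=
  ⟨h.nonneg, h.lt.le.trans h.le⟩

theorem IsShort.right_mem (h : IsShort L Q μ p r) : r ∈ Set.Icc 0 L :=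
  ⟨h.nonneg.trans h.lt.le, h.le⟩

theorem IsShort.Icc_subset (h : IsShort L Q μ p r) : Set.Icc p r ⊆ Set.Icc 0 L :=
  Set.Icc_subset_Icc h.nonneg h.le

theorem IsShort.mono (h : IsShort L Q μ p r) {ν p' r' : ℝ} (hν : ν ≤ μ) (hp : p ≤ p')
    (hr : r' ≤ r) (hlt : p' < r') : IsShort L Q ν p' r' := by
  refine ⟨h.nonneg.trans hp, hlt, hr.trans h.le, ?_⟩
  have h1 : (r' - p') ^ 2 ≤ (r - p) ^ 2 := pow_le_pow_left₀ (by linarith) (by linarith) 2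
  rcases le_or_gt (Q + ν) 0 with h0 | h0
  · nlinarith [sq_nonneg (r' - p')]
  · have := h.short
    nlinarith [sq_nonneg (r' - p'), sq_nonneg (r - p)]

/-- The quadratic form of `-d²/dx² + q - μ` on the interval `[p, r]`. -/
noncomputable def energy (q : ℝ → ℝ) (μ p r : ℝ) (w w' : ℝ → ℝ) : ℝ :=
  ∫ t in p..r, (w' t ^ 2 + (q t - μ) * w t ^ 2)

theorem HasContDeriv.continuousOn_sub {w w' : ℝ → ℝ} (hw : HasContDeriv L w w')
    (hp : 0 ≤ p) (hpr : p ≤ r) (hr : r ≤ L) :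
    ContinuousOn w (Set.uIcc p r) ∧ ContinuousOn w' (Set.uIcc p r) := by
  rw [Set.uIcc_of_le hpr]
  exact ⟨hw.hasDeriv.continuousOn.mono (Set.Icc_subset_Icc hp hr),
    hw.cont.mono (Set.Icc_subset_Icc hp hr)⟩

theorem IsPotential.intervalIntegrable_mul (h : IsPotential L Q q) (μ : ℝ) (hp : 0 ≤ p)
    (hpr : p ≤ r) (hr : r ≤ L) {f : ℝ → ℝ} (hf : ContinuousOn f (Set.uIcc p r)) :
    IntervalIntegrable (fun t => (q t - μ) * f t) volume p r := by
  refine IntervalIntegrable.mul_continuousOn ((h.intervalIntegrable_sub μ).mono_set ?_) hf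
  rw [Set.uIcc_of_le hpr, Set.uIcc_of_le h.pos.le]
  exact Set.Icc_subset_Icc hp hr

theorem IsPotential.energy_eq (h : IsPotential L Q q) (μ : ℝ) {w w' : ℝ → ℝ}
    (hw : HasContDeriv L w w') (hp : 0 ≤ p) (hpr : p ≤ r) (hr : r ≤ L) :
    energy q μ p r w w' = (∫ t in p..r, w' t ^ 2) + ∫ t in p..r, (q t - μ) * w t ^ 2 := by
  obtain ⟨c1, c2⟩ := hw.continuousOn_sub hp hpr hr
  exact intervalIntegral.integral_add (c2.pow 2).intervalIntegrable
    (h.intervalIntegrable_mul μ hp hpr hr (c1.pow 2))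

theorem IsPotential.le_energy (h : IsPotential L Q q) (μ : ℝ) {w w' : ℝ → ℝ}
    (hw : HasContDeriv L w w') (hp : 0 ≤ p) (hpr : p ≤ r) (hr : r ≤ L) :
    (∫ t in p..r, w' t ^ 2) - (Q + μ) * (∫ t in p..r, w t ^ 2) ≤ energy q μ p r w w' := by
  obtain ⟨c1, c2⟩ := hw.continuousOn_sub hp hpr hr
  rw [h.energy_eq μ hw hp hpr hr, sub_eq_add_neg, ← neg_mul, ← intervalIntegral.integral_const_mul]
  refine add_le_add_right (intervalIntegral.integral_mono_on hpr
    ((c1.pow 2).intervalIntegrable.const_mul _)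
    (h.intervalIntegrable_mul μ hp hpr hr (c1.pow 2)) fun t ht => ?_) _
  have := (abs_le.1 (h.bound t ⟨hp.trans ht.1, ht.2.trans hr⟩)).1
  exact mul_le_mul_of_nonneg_right (by linarith) (sq_nonneg _)

theorem IsPotential.energy_le (h : IsPotential L Q q) (μ : ℝ) {w w' : ℝ → ℝ}
    (hw : HasContDeriv L w w') (hp : 0 ≤ p) (hpr : p ≤ r) (hr : r ≤ L) :
    energy q μ p r w w' ≤ (∫ t in p..r, w' t ^ 2) + (Q - μ) * (∫ t in p..r, w t ^ 2) := by
  obtain ⟨c1, c2⟩ := hw.continuousOn_sub hp hpr hr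
  rw [h.energy_eq μ hw hp hpr hr, ← intervalIntegral.integral_const_mul]
  refine add_le_add_right (intervalIntegral.integral_mono_on hpr
    (h.intervalIntegrable_mul μ hp hpr hr (c1.pow 2))
    ((c1.pow 2).intervalIntegrable.const_mul _) fun t ht => ?_) _
  have := (abs_le.1 (h.bound t ⟨hp.trans ht.1, ht.2.trans hr⟩)).2
  exact mul_le_mul_of_nonneg_right (by linarith) (sq_nonneg _)

theorem HasContDeriv.sq_sub_le {w w' : ℝ → ℝ} (hw : HasContDeriv L w w') (hp : 0 ≤ p)
    (hpr : p ≤ r) (hr : r ≤ L) : (w r - w p) ^ 2 ≤ (r - p) * ∫ t in p..r, w' t ^ 2 := by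
  have h1 := hw.hasDeriv.eq_add_integral ⟨hp, hpr.trans hr⟩ ⟨hp.trans hpr, hr⟩
  rw [h1, add_sub_cancel_left]
  exact sq_integral_le hpr (hw.cont.mono (Set.Icc_subset_Icc hp hr))

theorem HasContDeriv.integral_sq_mono {w w' : ℝ → ℝ} (hw : HasContDeriv L w w') (hp : 0 ≤ p)
    (hr : r ≤ L) {p' r' : ℝ} (hpp : p ≤ p') (hrr : r' ≤ r) (h : p' ≤ r') :
    (∫ t in p'..r', w' t ^ 2) ≤ ∫ t in p..r, w' t ^ 2 :=
  intervalIntegral.integral_mono_interval hpp h hrr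
    (Eventually.of_forall fun t => sq_nonneg (w' t))
    ((hw.continuousOn_sub hp (hpp.trans (h.trans hrr)) hr).2.pow 2).intervalIntegrable

/-- The Poincaré inequality. -/
theorem HasContDeriv.poincare {w w' : ℝ → ℝ} (hw : HasContDeriv L w w') (hp : 0 ≤ p)
    (hpr : p ≤ r) (hr : r ≤ L) (hwp : w p = 0) (hwr : w r = 0) :
    8 * (∫ t in p..r, w t ^ 2) ≤ (r - p) ^ 2 * ∫ t in p..r, w' t ^ 2 := by
  -- Each half uses only its own Dirichlet end: `w² ≤ (distance to the end) · ∫ w'²`, which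
  -- integrates to `(r - p)² / 8` times the energy of that half. This is the origin of the `8` in
  -- `IsShort`.
  set m := (p + r) / 2 with hm
  have hpm : p ≤ m := by rw [hm]; linarith
  have hmr : m ≤ r := by rw [hm]; linarith
  obtain ⟨c1, c1'⟩ := hw.continuousOn_sub hp hpm (hmr.trans hr)
  obtain ⟨c2, c2'⟩ := hw.continuousOn_sub (hp.trans hpm) hmr hr
  set I₁ := ∫ t in p..m, w' t ^ 2
  set I₂ := ∫ t in m..r, w' t ^ 2
  have e1 : ∫ t in p..m, w t ^ 2 ≤ (m - p) ^ 2 / 2 * I₁ := by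
    calc ∫ t in p..m, w t ^ 2 ≤ ∫ t in p..m, (t - p) * I₁ := by
          refine intervalIntegral.integral_mono_on hpm (c1.pow 2).intervalIntegrable
            (Continuous.intervalIntegrable (by fun_prop) _ _) fun t ht => ?_
          have h1 := hw.sq_sub_le hp ht.1 (ht.2.trans (hmr.trans hr))
          rw [hwp, sub_zero] at h1
          exact h1.trans (mul_le_mul_of_nonneg_left
            (hw.integral_sq_mono hp (hmr.trans hr) le_rfl ht.2 ht.1) (by linarith [ht.1]))
      _ = _ := by
          rw [intervalIntegral.integral_mul_const,
            intervalIntegral.integral_sub (by simp) (by simp), integral_id,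
            intervalIntegral.integral_const, smul_eq_mul]
          ring
  have e2 : ∫ t in m..r, w t ^ 2 ≤ (r - m) ^ 2 / 2 * I₂ := by
    calc ∫ t in m..r, w t ^ 2 ≤ ∫ t in m..r, (r - t) * I₂ := by
          refine intervalIntegral.integral_mono_on hmr (c2.pow 2).intervalIntegrable
            (Continuous.intervalIntegrable (by fun_prop) _ _) fun t ht => ?_
          have h1 := hw.sq_sub_le (hp.trans (hpm.trans ht.1)) ht.2 hr
          rw [hwr, zero_sub, neg_sq] at h1
          exact h1.trans (mul_le_mul_of_nonneg_left
            (hw.integral_sq_mono (hp.trans hpm) hr ht.1 le_rfl ht.2) (by linarith [ht.2]))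
      _ = _ := by
          rw [intervalIntegral.integral_mul_const,
            intervalIntegral.integral_sub (by simp) (by simp), integral_id,
            intervalIntegral.integral_const, smul_eq_mul]
          ring
  rw [← intervalIntegral.integral_add_adjacent_intervals (f := fun t => w t ^ 2)
    (c1.pow 2).intervalIntegrable (c2.pow 2).intervalIntegrable,
    ← intervalIntegral.integral_add_adjacent_intervals (f := fun t => w' t ^ 2)
    (c1'.pow 2).intervalIntegrable (c2'.pow 2).intervalIntegrable]
  have h3 : m - p = (r - p) / 2 := by rw [hm]; ring
  have h4 : r - m = (r - p) / 2 := by rw [hm]; ring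
  rw [h3] at e1
  rw [h4] at e2
  linarith

theorem HasContDeriv.integral_sq_nonneg {w : ℝ → ℝ} (hpr : p ≤ r) :
    0 ≤ ∫ t in p..r, w t ^ 2 :=
  intervalIntegral.integral_nonneg hpr fun _ _ => sq_nonneg _

/-- The Poincaré inequality beats the lower bound `-(Q + μ)` of the potential term, with the margin
`κ = 8 / (r - p)² - (Q + μ)`. -/
theorem IsShort.exists_coercive (hs : IsShort L Q μ p r) (h : IsPotential L Q q) :
    ∃ κ > 0, ∀ w w', HasContDeriv L w w' → w p = 0 → w r = 0 →
      κ * (∫ t in p..r, w t ^ 2) ≤ energy q μ p r w w' := by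
  have hl : 0 < (r - p) ^ 2 := pow_pos (sub_pos.2 hs.lt) 2
  refine ⟨8 / (r - p) ^ 2 - (Q + μ), ?_, fun w w' hw h1 h2 => ?_⟩
  · rw [gt_iff_lt, sub_pos, lt_div_iff₀ hl]; exact hs.short
  · have h3 := hw.poincare hs.nonneg hs.lt.le hs.le h1 h2
    have h4 := h.le_energy μ hw hs.nonneg hs.lt.le hs.le
    have h5 : 8 / (r - p) ^ 2 * (∫ t in p..r, w t ^ 2) ≤ ∫ t in p..r, w' t ^ 2 := by
      rw [div_mul_eq_mul_div, div_le_iff₀ hl]; linarith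
    linarith

theorem IsSolution.green {u v w w' : ℝ → ℝ} (hL : 0 ≤ L) (hu : IsSolution L q μ u v)
    (hw : HasContDeriv L w w') (hp : p ∈ Set.Icc 0 L) (hr : r ∈ Set.Icc 0 L) :
    ∫ t in p..r, (v t * w' t + (q t - μ) * (u t * w t)) = v r * w r - v p * w p := by
  have h1 := (hu.right.mul hL hw.hasDeriv).eq_add_integral hp hr
  rw [eq_sub_iff_add_eq', h1]
  congr 1
  refine intervalIntegral.integral_congr fun t _ => ?_
  ring

theorem IsSolution.energy_eq {u v : ℝ → ℝ} (hL : 0 ≤ L) (hu : IsSolution L q μ u v)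
    (hp : p ∈ Set.Icc 0 L) (hr : r ∈ Set.Icc 0 L) :
    energy q μ p r u v = v r * u r - v p * u p := by
  rw [← hu.green hL hu.hasContDeriv hp hr, energy]
  refine intervalIntegral.integral_congr fun t _ => ?_
  ring

theorem HasContDeriv.eq_zero_of_integral_sq {w w' : ℝ → ℝ} (hw : HasContDeriv L w w')
    (hp : 0 ≤ p) (hpr : p < r) (hr : r ≤ L) (h0 : ∫ t in p..r, w t ^ 2 ≤ 0) :
    ∀ x ∈ Set.Icc p r, w x = 0 := by
  intro x hx
  by_contra hne
  have hc : ContinuousOn (fun t => w t ^ 2) (Set.Icc p r) := by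
    have := (hw.continuousOn_sub hp hpr.le hr).1.pow 2
    rwa [Set.uIcc_of_le hpr.le] at this
  have := intervalIntegral.integral_pos hpr hc (fun t _ => sq_nonneg _)
    ⟨x, hx, by positivity⟩
  linarith

theorem FundamentalSystem.wronskian (F : FundamentalSystem L q) (hL : 0 ≤ L) (μ : ℝ) {x : ℝ}
    (hx : x ∈ Set.Icc 0 L) : F.c μ x * F.s' μ x - F.c' μ x * F.s μ x = 1 := by
  rw [(F.isSolution_c μ).wronskian_eq hL (F.isSolution_s μ) hx ⟨le_rfl, hL⟩]
  simp [F.c_zero, F.s_zero, F.s'_zero]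

/-- Constancy of the Wronskians with `c` and `s` carries zero Cauchy data from `x` back to `0`,
where the fundamental system applies. -/
theorem FundamentalSystem.eq_zero (F : FundamentalSystem L q) (hL : 0 ≤ L) {u v : ℝ → ℝ}
    (hu : IsSolution L q μ u v) {x : ℝ} (hx : x ∈ Set.Icc 0 L) (h0 : u x = 0) (h1 : v x = 0) :
    ∀ y ∈ Set.Icc 0 L, u y = 0 ∧ v y = 0 := by
  have z : (0 : ℝ) ∈ Set.Icc 0 L := ⟨le_rfl, hL⟩
  have e1 := hu.wronskian_eq hL (F.isSolution_c μ) hx z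
  have e2 := hu.wronskian_eq hL (F.isSolution_s μ) hx z
  rw [h0, h1, F.c_zero, F.c'_zero] at e1
  rw [h0, h1, F.s_zero, F.s'_zero] at e2
  have e3 : v 0 = 0 := by linarith
  have e4 : u 0 = 0 := by linarith
  intro y hy
  have := F.eq_of_isSolution hu y hy
  rwa [e3, e4, zero_mul, zero_mul, zero_mul, zero_mul, add_zero] at this

/-- The energy of a solution is a boundary term, here zero, so coercivity forces `u = 0` on `[p,
r]`. Then `v` is constant there with integral zero, and unique continuation does the rest. -/
theorem IsShort.eq_zero_of_dirichlet (hs : IsShort L Q μ p r) (h : IsPotential L Q q)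
    {u v : ℝ → ℝ} (hu : IsSolution L q μ u v) (hp : u p = 0) (hr : u r = 0) :
    ∀ y ∈ Set.Icc 0 L, u y = 0 ∧ v y = 0 := by
  obtain ⟨F⟩ := h.nonempty_fundamentalSystem
  obtain ⟨κ, hκ, hc⟩ := hs.exists_coercive h
  have h1 := hc u v hu.hasContDeriv hp hr
  rw [hu.energy_eq h.pos.le hs.left_mem hs.right_mem, hp, hr, mul_zero, mul_zero, sub_zero] at h1
  have h2 := hu.hasContDeriv.eq_zero_of_integral_sq hs.nonneg hs.lt hs.le (by nlinarith)
  have h3 : ∀ x ∈ Set.Icc p r, v x = v p := by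
    intro x hx
    rw [hu.right.eq_add_integral hs.left_mem (hs.Icc_subset hx), add_eq_left]
    rw [intervalIntegral.integral_congr (g := fun _ => 0), intervalIntegral.integral_zero]
    intro t ht
    rw [Set.uIcc_of_le hx.1] at ht
    simp [h2 t ⟨ht.1, ht.2.trans hx.2⟩]
  have h4 := hu.left.eq_add_integral hs.left_mem hs.right_mem
  rw [hp, hr, intervalIntegral.integral_congr (g := fun _ => v p)] at h4
  · rw [intervalIntegral.integral_const, smul_eq_mul, zero_add, eq_comm, mul_eq_zero] at h4
    exact F.eq_zero h.pos.le hu hs.left_mem hp (h4.resolve_left (sub_pos.2 hs.lt).ne')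
  · intro t ht
    rw [Set.uIcc_of_le hs.lt.le] at ht
    exact h3 t ht

end Interval

/-! ### The Dirichlet-to-Neumann form of a short interval -/

namespace FundamentalSystem

variable {L Q μ p r : ℝ} {q : ℝ → ℝ} (F : FundamentalSystem L q)

/-- The value at `x` of the solution with the initial values `(0, 1)` at `p`. -/
def sine (μ p x : ℝ) : ℝ := F.c μ p * F.s μ x - F.s μ p * F.c μ x

/-- The derivative at `x` of the solution with the initial values `(0, 1)` at `p`. -/
def sine' (μ p x : ℝ) : ℝ := F.c μ p * F.s' μ x - F.s μ p * F.c' μ x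

/-- The value at `x` of the solution with the initial values `(1, 0)` at `p`. -/
def cosine (μ p x : ℝ) : ℝ := F.s' μ p * F.c μ x - F.c' μ p * F.s μ x

/-- The derivative at `x` of the solution with the initial values `(1, 0)` at `p`. -/
def cosine' (μ p x : ℝ) : ℝ := F.s' μ p * F.c' μ x - F.c' μ p * F.s' μ x

theorem isSolution_sine (μ p : ℝ) : IsSolution L q μ (F.sine μ p) (F.sine' μ p) := by
  have := ((F.isSolution_s μ).const_mul (F.c μ p)).add
    ((F.isSolution_c μ).const_mul (-F.s μ p))
  convert! this using 1 <;> funext x <;> simp only [sine, sine'] <;> ring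

theorem isSolution_cosine (μ p : ℝ) : IsSolution L q μ (F.cosine μ p) (F.cosine' μ p) := by
  have := ((F.isSolution_c μ).const_mul (F.s' μ p)).add
    ((F.isSolution_s μ).const_mul (-F.c' μ p))
  convert! this using 1 <;> funext x <;> simp only [cosine, cosine'] <;> ring

theorem sine_self (μ p : ℝ) : F.sine μ p p = 0 := by simp only [sine]; ring

theorem sine'_self (hL : 0 ≤ L) (μ : ℝ) (hp : p ∈ Set.Icc 0 L) : F.sine' μ p p = 1 := by
  have := F.wronskian hL μ hp
  simp only [sine']; linarith

theorem cosine_self (hL : 0 ≤ L) (μ : ℝ) (hp : p ∈ Set.Icc 0 L) : F.cosine μ p p = 1 := by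
  have := F.wronskian hL μ hp
  simp only [cosine]; linarith

theorem cosine'_self (μ p : ℝ) : F.cosine' μ p p = 0 := by simp only [cosine']; ring

theorem eq_sine_cosine (hL : 0 ≤ L) {u v : ℝ → ℝ} (hu : IsSolution L q μ u v)
    (hp : p ∈ Set.Icc 0 L) (hr : r ∈ Set.Icc 0 L) :
    u r = u p * F.cosine μ p r + v p * F.sine μ p r ∧
      v r = u p * F.cosine' μ p r + v p * F.sine' μ p r := by
  have h1 := F.eq_of_isSolution hu p hp
  have h2 := F.eq_of_isSolution hu r hr
  have h3 := F.wronskian hL μ hp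
  simp only [cosine, sine, cosine', sine']
  rw [h1.1, h1.2, h2.1, h2.2]
  constructor
  · linear_combination (-(u 0 * F.c μ r) - v 0 * F.s μ r) * h3
  · linear_combination (-(u 0 * F.c' μ r) - v 0 * F.s' μ r) * h3

theorem sine_ne_zero (hs : IsShort L Q μ p r) (h : IsPotential L Q q) : F.sine μ p r ≠ 0 := by
  intro h0
  have h1 := hs.eq_zero_of_dirichlet h (F.isSolution_sine μ p) (F.sine_self μ p) h0 p hs.left_mem
  rw [F.sine'_self h.pos.le μ hs.left_mem] at h1
  exact one_ne_zero h1.2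

/-- The function starts with slope one, so it is positive just to the right of `p`. A later zero `y`
would contradict `sine_ne_zero` on the shorter interval `[p, y]`. -/
theorem sine_pos (hs : IsShort L Q μ p r) (h : IsPotential L Q q) : 0 < F.sine μ p r := by
  have hsol := F.isSolution_sine μ p
  have hc : ContinuousWithinAt (F.sine' μ p) (Set.Icc 0 L) p :=
    hsol.right.continuousOn p hs.left_mem
  have h1 : ∀ᶠ x in 𝓝[Set.Icc 0 L] p, 0 < F.sine' μ p x :=
    hc.eventually (lt_mem_nhds (by rw [F.sine'_self h.pos.le μ hs.left_mem]; exact one_pos))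
  obtain ⟨δ, hδ, hδ'⟩ := Metric.mem_nhdsWithin_iff.1 h1
  set x := min r (p + δ / 2) with hx
  have hpx : p < x := lt_min hs.lt (by linarith)
  have hxr : x ≤ r := min_le_left _ _
  have hxL : x ∈ Set.Icc 0 L := ⟨hs.nonneg.trans hpx.le, hxr.trans hs.le⟩
  have hpos : 0 < F.sine μ p x := by
    rw [hsol.left.eq_add_integral hs.left_mem hxL, F.sine_self, zero_add]
    have hsub : Set.Icc p x ⊆ Set.Icc 0 L := Set.Icc_subset_Icc hs.nonneg hxL.2
    refine intervalIntegral.intervalIntegral_pos_of_pos_on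
      (ContinuousOn.intervalIntegrable ?_) (fun t ht => ?_) hpx
    · rw [Set.uIcc_of_le hpx.le]
      exact hsol.right.continuousOn.mono hsub
    · refine hδ' ⟨?_, hsub ⟨ht.1.le, ht.2.le⟩⟩
      rw [Metric.mem_ball, Real.dist_eq, abs_of_pos (by linarith [ht.1])]
      linarith [ht.2, min_le_right r (p + δ / 2)]
  by_contra hneg
  have hsub : Set.Icc x r ⊆ Set.Icc 0 L := Set.Icc_subset_Icc hxL.1 hs.le
  obtain ⟨y, hy, hy0⟩ := intermediate_value_Icc' hxr (hsol.left.continuousOn.mono hsub)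
    ⟨not_lt.1 hneg, hpos.le⟩
  exact F.sine_ne_zero (hs.mono le_rfl le_rfl hy.2 (hpx.trans_le hy.1)) h hy0

/-- The coefficient of `u p` in `-u' p`, where `u` solves the equation. -/
noncomputable def coefLeft (μ p r : ℝ) : ℝ := F.cosine μ p r / F.sine μ p r

/-- The coefficient of `u r` in `u' r`, where `u` solves the equation. -/
noncomputable def coefRight (μ p r : ℝ) : ℝ := F.sine' μ p r / F.sine μ p r

/-- The coefficient of `u r` in `u' p`, where `u` solves the equation. -/
noncomputable def coefMix (μ p r : ℝ) : ℝ := 1 / F.sine μ p r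

theorem coefMix_pos (hs : IsShort L Q μ p r) (h : IsPotential L Q q) : 0 < F.coefMix μ p r :=
  one_div_pos.2 (F.sine_pos hs h)

theorem deriv_left (hs : IsShort L Q μ p r) (h : IsPotential L Q q) {u v : ℝ → ℝ}
    (hu : IsSolution L q μ u v) : v p = F.coefMix μ p r * u r - F.coefLeft μ p r * u p := by
  have h0 := F.sine_ne_zero hs h
  rw [(F.eq_sine_cosine h.pos.le hu hs.left_mem hs.right_mem).1, coefMix, coefLeft]
  field_simp
  ring

/-- The Wronskian of `cosine` and `sine` is one, which is why the same mixed coefficient appears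
here as in `deriv_left`: the Dirichlet-to-Neumann matrix is symmetric. -/
theorem deriv_right (hs : IsShort L Q μ p r) (h : IsPotential L Q q) {u v : ℝ → ℝ}
    (hu : IsSolution L q μ u v) : v r = F.coefRight μ p r * u r - F.coefMix μ p r * u p := by
  have h0 := F.sine_ne_zero hs h
  have h1 := F.eq_sine_cosine h.pos.le hu hs.left_mem hs.right_mem
  have h2 := (F.isSolution_cosine μ p).wronskian_eq h.pos.le (F.isSolution_sine μ p)
    hs.right_mem hs.left_mem
  rw [F.cosine_self h.pos.le μ hs.left_mem, F.sine'_self h.pos.le μ hs.left_mem,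
    F.cosine'_self, F.sine_self] at h2
  rw [h1.2, h1.1, coefMix, coefRight]
  field_simp
  linear_combination (-u p) * h2

/-- The energy of the solution with the boundary values `x`, `y`. -/
noncomputable def pieceForm (μ p r x y : ℝ) : ℝ :=
  F.coefLeft μ p r * x ^ 2 + F.coefRight μ p r * y ^ 2 - 2 * F.coefMix μ p r * x * y

theorem energy_eq_pieceForm (hs : IsShort L Q μ p r) (h : IsPotential L Q q) {u v : ℝ → ℝ}
    (hu : IsSolution L q μ u v) : energy q μ p r u v = F.pieceForm μ p r (u p) (u r) := by
  rw [hu.energy_eq h.pos.le hs.left_mem hs.right_mem, F.deriv_left hs h hu, F.deriv_right hs h hu,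
    pieceForm]
  ring

theorem exists_isSolution_boundary (hs : IsShort L Q μ p r) (h : IsPotential L Q q) (x y : ℝ) :
    ∃ u v, IsSolution L q μ u v ∧ u p = x ∧ u r = y := by
  obtain ⟨F⟩ := h.nonempty_fundamentalSystem
  have h0 := F.sine_ne_zero hs h
  refine ⟨_, _, ((F.isSolution_cosine μ p).const_mul x).add
    ((F.isSolution_sine μ p).const_mul (F.coefMix μ p r * y - F.coefLeft μ p r * x)), ?_, ?_⟩
  · simp [F.cosine_self h.pos.le μ hs.left_mem, F.sine_self]
  · simp only [coefMix, coefLeft]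
    field_simp
    ring

/-- Dirichlet principle: the difference from the solution with the same boundary values vanishes at
both ends, so the cross term is zero by Green's formula and its own energy is nonnegative by
coercivity. -/
theorem pieceForm_le_energy (hs : IsShort L Q μ p r) (h : IsPotential L Q q) {w w' : ℝ → ℝ}
    (hw : HasContDeriv L w w') : F.pieceForm μ p r (w p) (w r) ≤ energy q μ p r w w' := by
  obtain ⟨u, v, hu, hp, hr⟩ := exists_isSolution_boundary hs h (w p) (w r)
  obtain ⟨κ, hκ, hc⟩ := hs.exists_coercive h
  have hz := hw.add (hu.hasContDeriv.const_mul (-1))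
  have h1 := hc _ _ hz (by simp [hp]) (by simp [hr])
  have h2 : 0 ≤ κ * ∫ t in p..r, (w t + -1 * u t) ^ 2 :=
    mul_nonneg hκ.le (HasContDeriv.integral_sq_nonneg hs.lt.le)
  have h3 := hu.green h.pos.le hz hs.left_mem hs.right_mem
  simp only [hp, hr] at h3
  have e : energy q μ p r w w' = energy q μ p r u v +
      2 * (∫ t in p..r, (v t * (w' t + -1 * v t) + (q t - μ) * (u t * (w t + -1 * u t)))) +
      energy q μ p r (fun t => w t + -1 * u t) (fun t => w' t + -1 * v t) := by
    obtain ⟨c1, c2⟩ := hw.continuousOn_sub hs.nonneg hs.lt.le hs.le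
    obtain ⟨c3, c4⟩ := hu.hasContDeriv.continuousOn_sub hs.nonneg hs.lt.le hs.le
    have cz : ContinuousOn (fun t => w t + -1 * u t) (Set.uIcc p r) := by fun_prop
    have cz' : ContinuousOn (fun t => w' t + -1 * v t) (Set.uIcc p r) := by fun_prop
    have I := fun f hf => h.intervalIntegrable_mul μ hs.nonneg hs.lt.le hs.le (f := f) hf
    have i1 : IntervalIntegrable (fun t => v t ^ 2 + (q t - μ) * u t ^ 2) volume p r :=
      (c4.pow 2).intervalIntegrable.add (I (fun t => u t ^ 2) (c3.pow 2))
    have i2 : IntervalIntegrable (fun t => v t * (w' t + -1 * v t) +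
        (q t - μ) * (u t * (w t + -1 * u t))) volume p r :=
      (c4.mul cz').intervalIntegrable.add (I (fun t => u t * (w t + -1 * u t)) (c3.mul cz))
    have i3 : IntervalIntegrable (fun t => (w' t + -1 * v t) ^ 2 +
        (q t - μ) * (w t + -1 * u t) ^ 2) volume p r :=
      (cz'.pow 2).intervalIntegrable.add (I (fun t => (w t + -1 * u t) ^ 2) (cz.pow 2))
    simp only [energy]
    rw [← intervalIntegral.integral_const_mul, ← intervalIntegral.integral_add i1 (i2.const_mul 2),
      ← intervalIntegral.integral_add (i1.add (i2.const_mul 2)) i3]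
    refine intervalIntegral.integral_congr fun t _ => ?_
    ring
  rw [e, h3, F.energy_eq_pieceForm hs h hu, hp, hr]
  nlinarith

/-- The solution for `ν` is a trial function for `μ`, and its energy changes by exactly `-(μ - ν) ∫
u²`. The same `c` serves all `μ`, so it also bounds a derivative. -/
theorem exists_pieceForm_le_sub {ν x y : ℝ} (hs : IsShort L Q ν p r) (h : IsPotential L Q q)
    (hxy : x ≠ 0 ∨ y ≠ 0) : ∃ c > 0, ∀ μ, ν ≤ μ → IsShort L Q μ p r →
      F.pieceForm μ p r x y ≤ F.pieceForm ν p r x y - (μ - ν) * c := by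
  obtain ⟨u, v, hu, hp, hr⟩ := exists_isSolution_boundary hs h x y
  refine ⟨∫ t in p..r, u t ^ 2, ?_, fun μ hν hs' => ?_⟩
  · by_contra hn
    have := hu.hasContDeriv.eq_zero_of_integral_sq hs.nonneg hs.lt hs.le (not_lt.1 hn)
    rcases hxy with h0 | h0
    · exact h0 (hp ▸ this p ⟨le_rfl, hs.lt.le⟩)
    · exact h0 (hr ▸ this r ⟨hs.lt.le, le_rfl⟩)
  have h1 := F.pieceForm_le_energy hs' h hu.hasContDeriv
  have h2 := F.energy_eq_pieceForm hs h hu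
  rw [hp, hr] at h1 h2
  have h4 : energy q μ p r u v = energy q ν p r u v - (μ - ν) * ∫ t in p..r, u t ^ 2 := by
    obtain ⟨c3, c4⟩ := hu.hasContDeriv.continuousOn_sub hs.nonneg hs.lt.le hs.le
    have i1 : IntervalIntegrable (fun t => v t ^ 2 + (q t - ν) * u t ^ 2) volume p r :=
      (c4.pow 2).intervalIntegrable.add
        (h.intervalIntegrable_mul ν hs.nonneg hs.lt.le hs.le (f := fun t => u t ^ 2) (c3.pow 2))
    have i2 : IntervalIntegrable (fun t => u t ^ 2) volume p r := (c3.pow 2).intervalIntegrable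
    simp only [energy]
    rw [← intervalIntegral.integral_const_mul,
      ← intervalIntegral.integral_sub i1 (i2.const_mul _)]
    refine intervalIntegral.integral_congr fun t _ => ?_
    ring
  rwa [h4, h2] at h1

theorem pieceForm_strictAnti (hs : IsShort L Q μ p r) (h : IsPotential L Q q) {ν x y : ℝ}
    (hν : ν < μ) (hxy : x ≠ 0 ∨ y ≠ 0) : F.pieceForm μ p r x y < F.pieceForm ν p r x y := by
  obtain ⟨c, hc, h1⟩ := F.exists_pieceForm_le_sub (hs.mono hν.le le_rfl le_rfl hs.lt) h hxy
  have := h1 μ hν.le hs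
  nlinarith [mul_pos (sub_pos.2 hν) hc]

/-- Energy of the affine trial function with boundary values `1` and `0`. The bound is negative for
large admissible `μ`, which is used to produce many eigenvalues below `M`. -/
theorem coefLeft_le (hs : IsShort L Q μ p r) (h : IsPotential L Q q) :
    F.coefLeft μ p r ≤ 1 / (r - p) + (Q - μ) * ((r - p) / 3) := by
  have hl := sub_pos.2 hs.lt
  have hw := hasContDeriv_affine L (r / (r - p)) (-1 / (r - p))
  have h1 := (F.pieceForm_le_energy hs h hw).trans
    (h.energy_le μ hw hs.nonneg hs.lt.le hs.le)
  have e1 : r / (r - p) + -1 / (r - p) * p = 1 := by field_simp; ring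
  have e2 : r / (r - p) + -1 / (r - p) * r = 0 := by field_simp; ring
  have e3 : ∫ t in p..r, (r / (r - p) + -1 / (r - p) * t) ^ 2 = (r - p) / 3 := by
    have : ∀ t, (r / (r - p) + -1 / (r - p) * t) ^ 2 = (r - t) ^ 2 / (r - p) ^ 2 := fun t => by
      field_simp; ring
    simp only [this]
    rw [intervalIntegral.integral_div, intervalIntegral.integral_comp_sub_left (fun x => x ^ 2),
      integral_pow]
    field_simp
    norm_num
  rw [e1, e2, e3] at h1
  simp only [pieceForm, intervalIntegral.integral_const, smul_eq_mul] at h1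
  have e4 : (r - p) * (-1 / (r - p)) ^ 2 = 1 / (r - p) := by field_simp
  rw [e4] at h1
  linarith

theorem coefRight_le (hs : IsShort L Q μ p r) (h : IsPotential L Q q) :
    F.coefRight μ p r ≤ 1 / (r - p) + (Q - μ) * ((r - p) / 3) := by
  have hl := sub_pos.2 hs.lt
  have hw := hasContDeriv_affine L (-p / (r - p)) (1 / (r - p))
  have h1 := (F.pieceForm_le_energy hs h hw).trans
    (h.energy_le μ hw hs.nonneg hs.lt.le hs.le)
  have e1 : -p / (r - p) + 1 / (r - p) * p = 0 := by ring
  have e2 : -p / (r - p) + 1 / (r - p) * r = 1 := by field_simp; ring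
  have e3 : ∫ t in p..r, (-p / (r - p) + 1 / (r - p) * t) ^ 2 = (r - p) / 3 := by
    have : ∀ t, (-p / (r - p) + 1 / (r - p) * t) ^ 2 = (t - p) ^ 2 / (r - p) ^ 2 := fun t => by
      field_simp; ring
    simp only [this]
    rw [intervalIntegral.integral_div, intervalIntegral.integral_comp_sub_right (fun x => x ^ 2),
      integral_pow]
    field_simp
    norm_num
  rw [e1, e2, e3] at h1
  simp only [pieceForm, intervalIntegral.integral_const, smul_eq_mul] at h1
  have e4 : (r - p) * (1 / (r - p)) ^ 2 = 1 / (r - p) := by field_simp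
  rw [e4] at h1
  linarith

/-- A trace inequality: average `w(p)² ≤ 2 w(t)² + 2 (w(t) - w(p))²` over `[p, p + δ]`. -/
theorem sq_left_le {w w' : ℝ → ℝ} (hw : HasContDeriv L w w') {δ : ℝ} (hδ : 0 < δ)
    (hp : 0 ≤ p) (hpr : p + δ ≤ r) (hr : r ≤ L) :
    w p ^ 2 ≤ 2 / δ * (∫ t in p..r, w t ^ 2) + 2 * δ * ∫ t in p..r, w' t ^ 2 := by
  set J := ∫ t in p..r, w' t ^ 2
  have hpδ : p ≤ p + δ := by linarith
  obtain ⟨c1, -⟩ := hw.continuousOn_sub hp hpδ (hpr.trans hr)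
  obtain ⟨c2, -⟩ := hw.continuousOn_sub hp (hpδ.trans hpr) hr
  have h1 : ∫ _ in p..(p + δ), w p ^ 2 ≤ ∫ t in p..(p + δ), (2 * w t ^ 2 + 2 * δ * J) := by
    refine intervalIntegral.integral_mono_on hpδ (by simp)
      (((c1.pow 2).intervalIntegrable.const_mul 2).add (by simp)) fun t ht => ?_
    have e1 := hw.sq_sub_le hp ht.1 (ht.2.trans (hpr.trans hr))
    have e2 := hw.integral_sq_mono hp hr le_rfl (ht.2.trans hpr) ht.1
    have e3 : (t - p) * (∫ s in p..t, w' s ^ 2) ≤ δ * J :=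
      mul_le_mul (by linarith [ht.2]) e2 (HasContDeriv.integral_sq_nonneg ht.1) hδ.le
    nlinarith [sq_nonneg (2 * w t - w p)]
  have h2 : ∫ t in p..(p + δ), w t ^ 2 ≤ ∫ t in p..r, w t ^ 2 :=
    intervalIntegral.integral_mono_interval le_rfl hpδ hpr
      (Eventually.of_forall fun t => sq_nonneg (w t)) (c2.pow 2).intervalIntegrable
  rw [intervalIntegral.integral_add (f := fun t => 2 * w t ^ 2)
    ((c1.pow 2).intervalIntegrable.const_mul 2) (by simp),
    intervalIntegral.integral_const_mul, intervalIntegral.integral_const,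
    intervalIntegral.integral_const, smul_eq_mul, smul_eq_mul, add_sub_cancel_left] at h1
  have h3 : 2 / δ * (∫ t in p..r, w t ^ 2) + 2 * δ * J =
    (2 * (∫ t in p..r, w t ^ 2) + δ * (2 * δ * J)) / δ := by field_simp
  rw [h3, le_div_iff₀ hδ]
  linarith

theorem sq_right_le {w w' : ℝ → ℝ} (hw : HasContDeriv L w w') {δ : ℝ} (hδ : 0 < δ)
    (hp : 0 ≤ p) (hpr : p + δ ≤ r) (hr : r ≤ L) :
    w r ^ 2 ≤ 2 / δ * (∫ t in p..r, w t ^ 2) + 2 * δ * ∫ t in p..r, w' t ^ 2 := by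
  set J := ∫ t in p..r, w' t ^ 2
  have hrδ : r - δ ≤ r := by linarith
  have hpδ : p ≤ r - δ := by linarith
  obtain ⟨c1, -⟩ := hw.continuousOn_sub (hp.trans hpδ) hrδ hr
  obtain ⟨c2, -⟩ := hw.continuousOn_sub hp (hpδ.trans hrδ) hr
  have h1 : ∫ _ in (r - δ)..r, w r ^ 2 ≤ ∫ t in (r - δ)..r, (2 * w t ^ 2 + 2 * δ * J) := by
    refine intervalIntegral.integral_mono_on hrδ (by simp)
      (((c1.pow 2).intervalIntegrable.const_mul 2).add (by simp)) fun t ht => ?_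
    have e1 := hw.sq_sub_le (hp.trans (hpδ.trans ht.1)) ht.2 hr
    have e2 := hw.integral_sq_mono hp hr (hpδ.trans ht.1) le_rfl ht.2
    have e3 : (r - t) * (∫ s in t..r, w' s ^ 2) ≤ δ * J :=
      mul_le_mul (by linarith [ht.1]) e2 (HasContDeriv.integral_sq_nonneg ht.2) hδ.le
    nlinarith [sq_nonneg (2 * w t - w r)]
  have h2 : ∫ t in (r - δ)..r, w t ^ 2 ≤ ∫ t in p..r, w t ^ 2 :=
    intervalIntegral.integral_mono_interval hpδ hrδ le_rfl
      (Eventually.of_forall fun t => sq_nonneg (w t)) (c2.pow 2).intervalIntegrable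
  rw [intervalIntegral.integral_add (f := fun t => 2 * w t ^ 2)
    ((c1.pow 2).intervalIntegrable.const_mul 2) (by simp),
    intervalIntegral.integral_const_mul, intervalIntegral.integral_const,
    intervalIntegral.integral_const, smul_eq_mul, smul_eq_mul, sub_sub_cancel] at h1
  have h3 : 2 / δ * (∫ t in p..r, w t ^ 2) + 2 * δ * J =
    (2 * (∫ t in p..r, w t ^ 2) + δ * (2 * δ * J)) / δ := by field_simp
  rw [h3, le_div_iff₀ hδ]
  linarith

/-- For very negative spectral parameter, the energy dominates the boundary values. -/
theorem exists_le_pieceForm (h : IsPotential L Q q) (hp : 0 ≤ p) (hpr : p < r) (hr : r ≤ L)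
    {κ : ℝ} (hκ : 0 ≤ κ) :
    ∃ m, ∀ μ ≤ m, ∀ x y, κ * (x ^ 2 + y ^ 2) ≤ F.pieceForm μ p r x y := by
  -- The second bound ensures `4 δ κ ≤ 1`, so that the derivative part of the trace inequality is
  -- absorbed by the energy.
  set δ := min (r - p) (1 / (4 * κ + 1)) with hδ
  have hδ0 : 0 < δ := lt_min (sub_pos.2 hpr) (by positivity)
  have hδr : p + δ ≤ r := by linarith [min_le_left (r - p) (1 / (4 * κ + 1))]
  have hδκ : 4 * δ * κ ≤ 1 := by
    have h1 : δ ≤ 1 / (4 * κ + 1) := min_le_right _ _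
    rw [le_div_iff₀ (by positivity)] at h1
    nlinarith
  -- Below this threshold `-(Q + μ) ≥ 4 κ / δ`, so the `L²` part of the trace inequality is absorbed
  -- as well.
  refine ⟨-Q - 4 * κ / δ, fun μ hμ x y => ?_⟩
  have h4 : 0 ≤ 4 * κ / δ := by positivity
  have hs : IsShort L Q μ p r := ⟨hp, hpr, hr, by nlinarith [sq_nonneg (r - p)]⟩
  obtain ⟨u, v, hu, hx, hy⟩ := exists_isSolution_boundary hs h x y
  have h1 := sq_left_le hu.hasContDeriv hδ0 hp hδr hr
  have h2 := sq_right_le hu.hasContDeriv hδ0 hp hδr hr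
  have h3 := h.le_energy μ hu.hasContDeriv hp hpr.le hr
  rw [F.energy_eq_pieceForm hs h hu] at h3
  rw [hx] at h1 h3
  rw [hy] at h2 h3
  set I := ∫ t in p..r, u t ^ 2
  set J := ∫ t in p..r, v t ^ 2
  have hI : 0 ≤ I := HasContDeriv.integral_sq_nonneg hpr.le
  have hJ : 0 ≤ J := HasContDeriv.integral_sq_nonneg hpr.le
  refine le_trans ?_ h3
  have h5 : κ * (x ^ 2 + y ^ 2) ≤ κ * (4 / δ * I + 4 * δ * J) := by
    refine mul_le_mul_of_nonneg_left ?_ hκ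
    have : 4 / δ * I = 2 / δ * I + 2 / δ * I := by ring
    linarith
  have h6 : κ * (4 / δ * I + 4 * δ * J) = 4 * κ / δ * I + 4 * δ * κ * J := by ring
  rw [h6] at h5
  refine h5.trans ?_
  nlinarith [mul_le_mul_of_nonneg_right hδκ hJ,
    mul_le_mul_of_nonneg_right (show 4 * κ / δ ≤ -(Q + μ) by linarith) hI]

theorem contDiffAt_coef (hs : IsShort L Q μ p r) (h : IsPotential L Q q) :
    ContDiffAt ℝ 2 (fun μ => F.coefLeft μ p r) μ ∧ ContDiffAt ℝ 2 (fun μ => F.coefMix μ p r) μ ∧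
      ContDiffAt ℝ 2 (fun μ => F.coefRight μ p r) μ := by
  have a1 := (F.contDiff_c p hs.left_mem).contDiffAt (x := μ)
  have a2 := (F.contDiff_c' p hs.left_mem).contDiffAt (x := μ)
  have a3 := (F.contDiff_s p hs.left_mem).contDiffAt (x := μ)
  have a4 := (F.contDiff_s' p hs.left_mem).contDiffAt (x := μ)
  have b1 := (F.contDiff_c r hs.right_mem).contDiffAt (x := μ)
  have b2 := (F.contDiff_c' r hs.right_mem).contDiffAt (x := μ)
  have b3 := (F.contDiff_s r hs.right_mem).contDiffAt (x := μ)
  have b4 := (F.contDiff_s' r hs.right_mem).contDiffAt (x := μ)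
  have h0 := F.sine_ne_zero hs h
  have hd : ContDiffAt ℝ 2 (fun μ => F.sine μ p r) μ := (a1.mul b3).sub (a3.mul b1)
  exact ⟨((a4.mul b1).sub (a2.mul b3)).div hd h0, contDiffAt_const.div hd h0,
    ((a1.mul b4).sub (a3.mul b2)).div hd h0⟩

end FundamentalSystem

/-! ### Counting eigenvalues by the jumps of an index -/

/-- `f` is a monotone integer-valued function on `(-∞, M]` that jumps at `μ` by `g μ`. -/
structure IsSpectralFlow (M : ℝ) (f g : ℝ → ℕ) : Prop where
  jump_le : ∀ {μ μ'}, μ < μ' → μ' ≤ M → f μ + g μ ≤ f μ'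
  left : ∀ μ ≤ M, ∀ᶠ ν in 𝓝[<] μ, f μ ≤ f ν
  right : ∀ μ < M, ∀ᶠ ν in 𝓝[>] μ, f ν ≤ f μ + g μ
  exists_zero : ∃ m ≤ M, f m = 0

namespace IsSpectralFlow

variable {M : ℝ} {f g : ℝ → ℕ}

/-- The crossing is the supremum of the points where `f < k`: by `left` the inequality persists at
the supremum, and by `right` the jump there must reach `k`. -/
theorem exists_crossing (h : IsSpectralFlow M f g) {k : ℕ} {μ : ℝ} (hμ : μ ≤ M) (hk : 0 < k)
    (hkf : k ≤ f μ) : ∃ ν < μ, f ν < k ∧ k ≤ f ν + g ν := by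
  obtain ⟨m, hm, hm0⟩ := h.exists_zero
  have mono : ∀ {a b}, a ≤ b → b ≤ M → f a ≤ f b := fun {a b} hab hb => by
    rcases hab.eq_or_lt with rfl | hlt
    · exact le_rfl
    · exact (Nat.le_add_right _ _).trans (h.jump_le hlt hb)
  set S := {ν | ν ≤ μ ∧ f ν < k} with hS
  have hmS : m ∈ S := by
    refine ⟨?_, by omega⟩
    by_contra hlt
    have := mono (not_le.1 hlt).le hm
    omega
  have hbdd : BddAbove S := ⟨μ, fun ν hν => hν.1⟩
  set ν := sSup S with hν
  have hνμ : ν ≤ μ := csSup_le ⟨m, hmS⟩ fun x hx => hx.1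
  have hfν : f ν < k := by
    obtain ⟨l, hl, hl'⟩ := mem_nhdsLT_iff_exists_Ioo_subset.1 (h.left ν (hνμ.trans hμ))
    obtain ⟨x, hx, hlx⟩ := exists_lt_of_lt_csSup ⟨m, hmS⟩ hl
    rcases (le_csSup hbdd hx).eq_or_lt with heq | hlt
    · exact (show x = ν from heq) ▸ hx.2
    · exact lt_of_le_of_lt (hl' ⟨hlx, hlt⟩) hx.2
  have hlt : ν < μ := lt_of_le_of_ne hνμ fun heq => by rw [heq] at hfν; omega
  refine ⟨ν, hlt, hfν, ?_⟩
  obtain ⟨x, hx, hx'⟩ := ((h.right ν (hlt.trans_le hμ)).and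
    (Ioo_mem_nhdsGT hlt)).exists
  refine le_trans ?_ hx
  by_contra hxk
  exact absurd (le_csSup hbdd (show x ∈ S from ⟨hx'.2.le, not_le.1 hxk⟩)) (not_le.2 hx'.1)

variable {Y : Type*} [AddCommGroup Y] [Module ℂ Y] {S : ℝ → Submodule ℂ Y}

theorem rank_Iic_eq (hS : iSupIndep S) (μ : ℝ) :
    Module.rank ℂ ↥(⨆ ν ∈ Set.Iic μ, S ν) =
      Module.rank ℂ ↥(⨆ ν ∈ Set.Iio μ, S ν) + Module.rank ℂ (S μ) := by
  have h1 : (⨆ ν ∈ Set.Iic μ, S ν) = S μ ⊔ ⨆ ν ∈ Set.Iio μ, S ν := by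
    rw [← Set.Iio_insert, iSup_insert]
  have h2 := Submodule.rank_sup_add_rank_inf_eq (S μ) (⨆ ν ∈ Set.Iio μ, S ν)
  rw [(hS.disjoint_biSup (y := Set.Iio μ) (by simp)).eq_bot, rank_bot, add_zero] at h2
  rw [h1, h2, add_comm]

/-- Induction on the value `f μ`. The crossing of this value is the last parameter below `μ` with a
nonzero space: a later jump would push `f` beyond `f μ`. -/
theorem rank_Iio_eq (h : IsSpectralFlow M f g) (hS : iSupIndep S)
    (hg : ∀ μ ≤ M, Module.rank ℂ (S μ) = g μ) {μ : ℝ} (hμ : μ ≤ M) :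
    Module.rank ℂ ↥(⨆ ν ∈ Set.Iio μ, S ν) = f μ := by
  induction hk : f μ using Nat.strong_induction_on generalizing μ with
  | _ k ih =>
    have hbot : ∀ {ν}, ν ≤ M → g ν = 0 → S ν = ⊥ := fun {ν} hν h0 => by
      have := hg ν hν
      rw [h0, Nat.cast_zero] at this
      exact Submodule.rank_eq_zero.1 this
    rcases Nat.eq_zero_or_pos k with h0 | hpos
    · have : (⨆ ν ∈ Set.Iio μ, S ν) = ⊥ := by
        rw [iSup₂_eq_bot]
        intro ν hν
        have := h.jump_le hν hμ
        exact hbot ((le_of_lt hν).trans hμ) (by omega)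
      rw [this, h0]; simp
    · obtain ⟨ν, hν, h1, h2⟩ := h.exists_crossing hμ hpos hk.ge
      have h3 := h.jump_le hν hμ
      have h4 : (⨆ x ∈ Set.Iio μ, S x) = ⨆ x ∈ Set.Iic ν, S x := by
        refine le_antisymm (iSup₂_le fun x hx => ?_)
          (biSup_mono fun x hx => lt_of_le_of_lt hx hν)
        rcases le_or_gt x ν with hxν | hxν
        · exact le_biSup S (show x ∈ Set.Iic ν from hxν)
        · have e1 := h.jump_le hxν ((le_of_lt hx).trans hμ)
          have e2 := h.jump_le hx hμ
          rw [hbot ((le_of_lt hx).trans hμ) (by omega)]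
          exact bot_le
      rw [h4, rank_Iic_eq hS, ih (f ν) h1 (hν.le.trans hμ) rfl, hg ν (hν.le.trans hμ),
        ← Nat.cast_add]
      congr 1
      omega

end IsSpectralFlow

/-! ### The signature of a family of quadratic forms -/

section Signature

variable {X : Type*} [NormedAddCommGroup X] [NormedSpace ℝ X] [FiniteDimensional ℝ X]

/-- Positivity on the compact unit sphere of a maximal positive subspace is stable under small
changes of the parameter. -/
theorem eventually_sigPos_le {T : Type*} [TopologicalSpace T] (q : T → QuadraticForm ℝ X) (t₀ : T)
    (hq : ∀ x, ContinuousAt (fun z : T × X => q z.1 z.2) (t₀, x)) :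
    ∀ᶠ t in 𝓝 t₀, sigPos (q t₀) ≤ sigPos (q t) := by
  have : ProperSpace X := FiniteDimensional.proper ℝ X
  obtain ⟨V, hV, hpos⟩ := exists_finrank_eq_sigPos_and_posDef (q t₀)
  have hK : IsCompact (Metric.sphere (0 : X) 1 ∩ V) :=
    (isCompact_sphere 0 1).inter_right V.closed_of_finiteDimensional
  have h1 : ∀ᶠ t in 𝓝 t₀, ∀ x ∈ Metric.sphere (0 : X) 1 ∩ V, 0 < q t x := by
    refine hK.eventually_forall_of_forall_eventually fun x hx => ?_
    refine (hq x).eventually (lt_mem_nhds ?_)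
    refine hpos ⟨x, hx.2⟩ fun h0 => ?_
    have : x = 0 := congrArg Subtype.val h0
    simp [this] at hx
  filter_upwards [h1] with t ht
  rw [← hV]
  refine le_sigPos_of_posDef _ fun x hx => ?_
  have hx0 : (x : X) ≠ 0 := fun h => hx (Subtype.ext h)
  have hn : ‖(x : X)‖ ≠ 0 := norm_ne_zero_iff.2 hx0
  have h2 := ht (‖(x : X)‖⁻¹ • (x : X))
    ⟨by simp [norm_smul, hn], V.smul_mem _ x.2⟩
  rw [QuadraticMap.map_smul, smul_eq_mul] at h2
  exact (pos_iff_pos_of_mul_pos h2).1 (by positivity)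

theorem eventually_sigNeg_le {T : Type*} [TopologicalSpace T] (q : T → QuadraticForm ℝ X) (t₀ : T)
    (hq : ∀ x, ContinuousAt (fun z : T × X => q z.1 z.2) (t₀, x)) :
    ∀ᶠ t in 𝓝 t₀, sigNeg (q t₀) ≤ sigNeg (q t) := by
  have := eventually_sigPos_le (fun t => -q t) t₀ fun x => by
    simp only [neg_apply]
    exact (hq x).neg
  simpa using this

variable {X : Type*} [AddCommGroup X] [Module ℝ X] [FiniteDimensional ℝ X]

/-- On the direct sum of a maximal negative subspace and the radical `q ≤ 0`, so the strictly
smaller form is negative definite there. This is what makes eigenvalues cross in only one direction.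
-/
theorem sigNeg_add_radical_le {q q' : QuadraticForm ℝ X} (h : ∀ x ≠ 0, q' x < q x) :
    sigNeg q + Module.finrank ℝ q.radical ≤ sigNeg q' := by
  obtain ⟨V, hV, hneg⟩ := exists_finrank_eq_sigNeg_and_negDef q
  have hneg' : ∀ x ∈ V, x ≠ 0 → q x < 0 := fun x hx h0 => by
    have := hneg ⟨x, hx⟩ fun h => h0 (congrArg Subtype.val h)
    simpa using this
  have hdisj : V ⊓ q.radical = ⊥ := by
    rw [eq_bot_iff]
    rintro x ⟨hx, hr⟩
    by_contra h0
    have := hneg' x hx h0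
    rw [(QuadraticMap.mem_radical_iff'.1 hr).1] at this
    exact lt_irrefl _ this
  have h1 := Submodule.finrank_sup_add_finrank_inf_eq V q.radical
  rw [hdisj, finrank_bot, add_zero, hV] at h1
  rw [← h1]
  refine le_sigNeg_of_negDef _ fun x hx => ?_
  obtain ⟨v, hv, r, hr, hvr⟩ := Submodule.mem_sup.1 x.2
  have hx0 : (x : X) ≠ 0 := fun h => hx (Subtype.ext h)
  have h2 : q x ≤ 0 := by
    rw [← hvr, add_comm, (QuadraticMap.mem_radical_iff'.1 hr).2]
    rcases eq_or_ne v 0 with rfl | hv0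
    · simp
    · exact (hneg' v hv hv0).le
  have h3 := h x hx0
  simp only [QuadraticMap.restrict_apply, neg_apply, Left.neg_pos_iff]
  linarith

end Signature

/-! ### Perturbation of a simple kernel -/

section Perturbation

open ComplexConjugate

variable {W P : Type*} [Fintype W] [Fintype P]

/-- The real part of the standard Hermitian product on `W → ℂ`. -/
noncomputable def pairing (g : W → ℂ) : (W → ℂ) →L[ℝ] ℝ :=
  LinearMap.toContinuousLinearMap
    { toFun := fun f => ∑ v, (conj (g v) * f v).re
      map_add' := fun f f' => by
        simp only [Pi.add_apply, mul_add, Complex.add_re, Finset.sum_add_distrib]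
      map_smul' := fun c f => by
        simp only [Pi.smul_apply, Complex.real_smul, RingHom.id_apply, smul_eq_mul,
          Finset.mul_sum]
        refine Finset.sum_congr rfl fun v _ => ?_
        rw [mul_left_comm, Complex.re_ofReal_mul] }

theorem pairing_apply (g f : W → ℂ) : pairing g f = ∑ v, (conj (g v) * f v).re := rfl

theorem pairing_comm (g f : W → ℂ) : pairing g f = pairing f g := by
  simp only [pairing_apply]
  refine Finset.sum_congr rfl fun v _ => ?_
  simp only [Complex.mul_re, Complex.conj_re, Complex.conj_im]
  ring

theorem pairing_add_left (g g' f : W → ℂ) : pairing (g + g') f = pairing g f + pairing g' f := by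
  rw [pairing_comm, map_add, pairing_comm f, pairing_comm f]

theorem pairing_smul_left (c : ℝ) (g f : W → ℂ) : pairing (c • g) f = c * pairing g f := by
  rw [pairing_comm, map_smul, pairing_comm f, smul_eq_mul]

theorem pairing_I_self (g : W → ℂ) : pairing (Complex.I • g) (Complex.I • g) = pairing g g := by
  simp only [pairing_apply]
  refine Finset.sum_congr rfl fun v _ => ?_
  simp

theorem pairing_I_left (g f : W → ℂ) :
    pairing (Complex.I • g) f = -pairing g (Complex.I • f) := by
  simp only [pairing_apply, ← Finset.sum_neg_distrib]
  refine Finset.sum_congr rfl fun v _ => ?_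
  simp
  ring

theorem pairing_self_pos {g : W → ℂ} {v : W} (hv : g v ≠ 0) : 0 < pairing g g := by
  rw [pairing_apply]
  have e : ∀ v, (conj (g v) * g v).re = Complex.normSq (g v) := fun v => by
    rw [Complex.normSq_eq_conj_mul_self.symm]; simp
  simp only [e]
  exact Finset.sum_pos' (fun v _ => Complex.normSq_nonneg _)
    ⟨v, Finset.mem_univ _, Complex.normSq_pos.2 hv⟩

theorem eq_zero_of_pairing {f : W → ℂ} (h : ∀ g, pairing g f = 0) : f = 0 := by
  by_contra h0
  obtain ⟨v, hv⟩ := Function.ne_iff.1 h0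
  exact (pairing_self_pos hv).ne' (h f)

theorem continuous_pairing : Continuous fun z : (W → ℂ) × (W → ℂ) => pairing z.1 z.2 := by
  simp only [pairing_apply]
  fun_prop

theorem pairing_smul_smul (c : ℝ) (g f : W → ℂ) :
    pairing (c • g) (c • f) = c ^ 2 * pairing g f := by
  rw [pairing_smul_left, map_smul, smul_eq_mul]; ring

/-- A family of symmetric operators on `W → ℂ`, depending on a spectral parameter and on fluxes,
whose kernel at the base point is spanned by the constants and which at the base value of the
spectral parameter is a magnetic Laplacian with the weights `w`. -/
structure MagneticFamily (k : ℕ) (s t : P → W) (w : P → ℝ) (Φ : (Fin k → ℝ) →ₗ[ℝ] (P → ℝ))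
    (lam c₀ : ℝ) (T : ℝ × (Fin k → ℝ) → (W → ℂ) →L[ℝ] (W → ℂ)) : Prop where
  contDiffAt : ContDiffAt ℝ 2 T (lam, 0)
  map_I : ∀ z f, T z (Complex.I • f) = Complex.I • T z f
  symm : ∀ z g f, pairing g (T z f) = pairing (T z g) f
  form : ∀ α g f, pairing g (T (lam, α) f) =
    ∑ p, w p * (conj (g (t p) - Complex.exp (Complex.I * Φ α p) * g (s p)) *
      (f (t p) - Complex.exp (Complex.I * Φ α p) * f (s p))).re
  ker : ∀ f, T (lam, 0) f = 0 → ∃ c : ℂ, f = fun _ => c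
  hasDerivAt : HasDerivAt (fun μ => pairing 1 (T (μ, 0) 1)) (-c₀) lam
  pos : 0 < c₀

namespace MagneticFamily

variable {k : ℕ} {s t : P → W} {w : P → ℝ} {Φ : (Fin k → ℝ) →ₗ[ℝ] (P → ℝ)}
  {lam c₀ : ℝ} {T : ℝ × (Fin k → ℝ) → (W → ℂ) →L[ℝ] (W → ℂ)}

theorem apply_one (h : MagneticFamily k s t w Φ lam c₀ T) : T (lam, 0) 1 = 0 :=
  eq_zero_of_pairing fun g => by
    rw [h.form]
    simp

theorem apply_I (h : MagneticFamily k s t w Φ lam c₀ T) :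
    T (lam, 0) (Complex.I • 1) = 0 := by rw [h.map_I, h.apply_one, smul_zero]

theorem hasFDerivAt (h : MagneticFamily k s t w Φ lam c₀ T) :
    HasFDerivAt T (fderiv ℝ T (lam, 0)) (lam, 0) :=
  (h.contDiffAt.differentiableAt (by norm_num)).hasFDerivAt

theorem pairing_deriv_lam (h : MagneticFamily k s t w Φ lam c₀ T) :
    pairing 1 (fderiv ℝ T (lam, 0) (1, 0) 1) = -c₀ := by
  have h1 : HasDerivAt (fun μ : ℝ => (μ, (0 : Fin k → ℝ))) ((1 : ℝ), (0 : Fin k → ℝ)) lam :=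
    (hasDerivAt_id lam).prodMk (hasDerivAt_const _ _)
  have h2 := h.hasFDerivAt.comp_hasDerivAt lam h1
  have h3 := (pairing (1 : W → ℂ)).hasFDerivAt.comp_hasDerivAt lam
    (h2.clm_apply (hasDerivAt_const lam (1 : W → ℂ)))
  have h4 := h3.unique h.hasDerivAt
  simpa using h4

/-- Differentiate `form` along the ray through `α`. The factor coming from the constant vector
vanishes at zero flux, so only its derivative contributes. -/
theorem pairing_deriv_flux (h : MagneticFamily k s t w Φ lam c₀ T) (α : Fin k → ℝ) (g : W → ℂ) :
    pairing g (fderiv ℝ T (lam, 0) (0, α) 1) =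
      ∑ p, w p * (conj (g (t p) - g (s p)) * (-(Complex.I * Φ α p))).re := by
  have h1 : HasDerivAt (fun r : ℝ => (lam, r • α)) ((0 : ℝ), α) 0 := by
    have := (hasDerivAt_const (0 : ℝ) lam).prodMk ((hasDerivAt_id (0 : ℝ)).smul_const α)
    simpa using this
  have h2 := HasFDerivAt.comp_hasDerivAt (x := (0 : ℝ)) (f := fun r : ℝ => (lam, r • α))
    (l := T) (l' := fderiv ℝ T (lam, 0)) (by simpa using h.hasFDerivAt) h1
  have h3 := (pairing g).hasFDerivAt.comp_hasDerivAt 0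
    (h2.clm_apply (hasDerivAt_const (0 : ℝ) (1 : W → ℂ)))
  have h5 : HasDerivAt (fun r : ℝ => ∑ p, w p *
      (conj (g (t p) - Complex.exp (Complex.I * Φ (r • α) p) * g (s p)) *
      ((1 : W → ℂ) (t p) - Complex.exp (Complex.I * Φ (r • α) p) * (1 : W → ℂ) (s p))).re)
      (∑ p, w p * (conj (g (t p) - g (s p)) * (-(Complex.I * Φ α p))).re) 0 := by
    refine HasDerivAt.fun_sum fun p _ => HasDerivAt.const_mul _ ?_
    have e1 : HasDerivAt (fun r : ℝ => Complex.exp (Complex.I * Φ (r • α) p))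
        (Complex.I * Φ α p) 0 := by
      have : HasDerivAt (fun r : ℝ => Complex.I * ((r : ℂ) * (Φ α p : ℂ)))
          (Complex.I * (1 * (Φ α p : ℂ))) 0 :=
        ((Complex.ofRealCLM.hasDerivAt (x := (0 : ℝ))).mul_const _).const_mul _
      have := this.cexp
      simpa using this
    have e2 : HasDerivAt (fun r : ℝ =>
        conj (g (t p) - Complex.exp (Complex.I * Φ (r • α) p) * g (s p)))
        (conj (-(Complex.I * Φ α p * g (s p)))) 0 := by
      have := Complex.conjCLE.toContinuousLinearMap.hasFDerivAt.comp_hasDerivAt (0 : ℝ)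
        ((e1.mul_const (g (s p))).const_sub (g (t p)))
      exact this
    have e3 := e2.mul ((e1.const_sub 1))
    have e4 := Complex.reCLM.hasFDerivAt.comp_hasDerivAt (0 : ℝ) e3
    convert! e4 using 1
    · funext r; simp
    · simp
  have h6 : (fun r : ℝ => pairing g (T (lam, r • α) 1)) = fun r : ℝ => ∑ p, w p *
      (conj (g (t p) - Complex.exp (Complex.I * Φ (r • α) p) * g (s p)) *
      ((1 : W → ℂ) (t p) - Complex.exp (Complex.I * Φ (r • α) p) * (1 : W → ℂ) (s p))).re := by
    funext r; exact h.form _ _ _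
  rw [← h6] at h5
  have h7 := h3.unique h5
  simpa using h7

/-- The equation for an eigenvector normalized at `v₀`; the last unknown is a Lagrange multiplier
that makes the number of equations match the number of unknowns. -/
noncomputable def eqn (T : ℝ × (Fin k → ℝ) → (W → ℂ) →L[ℝ] (W → ℂ)) (v₀ : W)
    (z : (Fin k → ℝ) × ((W → ℂ) × ℝ × ℝ)) : (W → ℂ) × ℂ :=
  (T (z.2.2.1, z.1) z.2.1 + z.2.2.2 • (Complex.I • z.2.1), z.2.1 v₀ - 1)

theorem contDiffAt_eqn (h : MagneticFamily k s t w Φ lam c₀ T) (v₀ : W) :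
    ContDiffAt ℝ 2 (eqn T v₀) (0, (1, lam, 0)) := by
  have e1 : ContDiffAt ℝ 2 (fun z : (Fin k → ℝ) × ((W → ℂ) × ℝ × ℝ) => T (z.2.2.1, z.1))
      (0, (1, lam, 0)) :=
    ContDiffAt.comp (g := T) (f := fun z : (Fin k → ℝ) × ((W → ℂ) × ℝ × ℝ) => (z.2.2.1, z.1))
      (0, (1, lam, 0)) h.contDiffAt (by fun_prop)
  have e2 : ContDiffAt ℝ 2 (fun z : (Fin k → ℝ) × ((W → ℂ) × ℝ × ℝ) => z.2.1)
    (0, (1, lam, 0)) := by fun_prop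
  have e3 : ContDiffAt ℝ 2 (fun z : (Fin k → ℝ) × ((W → ℂ) × ℝ × ℝ) =>
      z.2.2.2 • (Complex.I • z.2.1)) (0, (1, lam, 0)) := by fun_prop
  have e4 : ContDiffAt ℝ 2 (fun z : (Fin k → ℝ) × ((W → ℂ) × ℝ × ℝ) => z.2.1 v₀ - 1)
    (0, (1, lam, 0)) := by fun_prop
  exact ((e1.clm_apply e2).add e3).prodMk e4

theorem fderiv_eqn_apply (h : MagneticFamily k s t w Φ lam c₀ T) (v₀ : W) (y : W → ℂ) (μ τ : ℝ) :
    fderiv ℝ (eqn T v₀) (0, (1, lam, 0)) (0, (y, μ, τ)) =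
      (T (lam, 0) y + μ • fderiv ℝ T (lam, 0) (1, 0) 1 + τ • (Complex.I • 1), y v₀) := by
  set z₀ : (Fin k → ℝ) × ((W → ℂ) × ℝ × ℝ) := (0, (1, lam, 0))
  have hd := ((h.contDiffAt_eqn v₀).differentiableAt (by norm_num)).hasFDerivAt
  have hl : HasDerivAt (fun r : ℝ => z₀ + r • ((0, (y, μ, τ)) : (Fin k → ℝ) × ((W → ℂ) × ℝ × ℝ)))
      (0, (y, μ, τ)) 0 := by
    have := ((hasDerivAt_id (0 : ℝ)).smul_const
      ((0, (y, μ, τ)) : (Fin k → ℝ) × ((W → ℂ) × ℝ × ℝ))).const_add z₀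
    simpa using this
  have h1 := HasFDerivAt.comp_hasDerivAt (x := (0 : ℝ)) (l := eqn T v₀)
    (f := fun r : ℝ => z₀ + r • ((0, (y, μ, τ)) : (Fin k → ℝ) × ((W → ℂ) × ℝ × ℝ)))
    (by simpa using hd) hl
  refine h1.unique ?_
  have a1 : HasDerivAt (fun r : ℝ => (lam + r * μ, (0 : Fin k → ℝ))) (μ, (0 : Fin k → ℝ)) 0 := by
    have := (((hasDerivAt_id (0 : ℝ)).mul_const μ).const_add lam).prodMk
      (hasDerivAt_const (0 : ℝ) (0 : Fin k → ℝ))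
    simpa using this
  have a2 := HasFDerivAt.comp_hasDerivAt (x := (0 : ℝ)) (l := T) (l' := fderiv ℝ T (lam, 0))
    (f := fun r : ℝ => (lam + r * μ, (0 : Fin k → ℝ))) (by simpa using h.hasFDerivAt) a1
  have a3 : HasDerivAt (fun r : ℝ => (1 : W → ℂ) + r • y) y 0 := by
    have := ((hasDerivAt_id (0 : ℝ)).smul_const y).const_add (1 : W → ℂ)
    simpa using this
  have a4 := a2.clm_apply a3
  have a5 : HasDerivAt (fun r : ℝ => (r * τ) • (Complex.I • ((1 : W → ℂ) + r • y)))
      (τ • (Complex.I • (1 : W → ℂ))) 0 := by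
    exact (((hasDerivAt_id (0 : ℝ)).mul_const τ).smul (a3.const_smul Complex.I)).congr_deriv
      (by simp)
  have a6 : HasDerivAt (fun r : ℝ => ((1 : W → ℂ) + r • y) v₀ - 1) (y v₀) 0 :=
    ((hasDerivAt_pi.1 a3) v₀).sub_const 1
  have a7 := (a4.add a5).prodMk a6
  convert! a7 using 1
  · funext r
    simp [eqn, z₀]
  · have : fderiv ℝ T (lam, 0) (μ, 0) = μ • fderiv ℝ T (lam, 0) (1, 0) := by
      rw [← map_smul]; simp
    rw [this]
    simp
    abel

/-- Injectivity suffices, since both sides have real dimension `2 |W| + 2`. Pairing with `1` kills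
the spectral parameter because `c₀ ≠ 0`, pairing with `i` kills the multiplier, and what remains is
a constant vector vanishing at `v₀`. -/
theorem isInvertible_fderiv_eqn (h : MagneticFamily k s t w Φ lam c₀ T) (v₀ : W) :
    (fderiv ℝ (eqn T v₀) (0, (1, lam, 0)) ∘L
      ContinuousLinearMap.inr ℝ (Fin k → ℝ) ((W → ℂ) × ℝ × ℝ)).IsInvertible := by
  set D := fderiv ℝ (eqn T v₀) (0, (1, lam, 0)) ∘L
      ContinuousLinearMap.inr ℝ (Fin k → ℝ) ((W → ℂ) × ℝ × ℝ) with hD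
  have hinj : Function.Injective D.toLinearMap := by
    rw [← LinearMap.ker_eq_bot, LinearMap.ker_eq_bot']
    rintro ⟨y, μ, τ⟩ h0
    have h1 : D (y, μ, τ) =
        (T (lam, 0) y + μ • fderiv ℝ T (lam, 0) (1, 0) 1 + τ • (Complex.I • 1), y v₀) :=
      h.fderiv_eqn_apply v₀ y μ τ
    have h0' : D (y, μ, τ) = 0 := h0
    rw [h1, Prod.mk_eq_zero] at h0'
    obtain ⟨h2, h3⟩ := h0'
    have hv : 0 < pairing (1 : W → ℂ) 1 := pairing_self_pos (v := v₀) (by simp)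
    have e1 : pairing (1 : W → ℂ) (Complex.I • 1) = 0 := by simp [pairing_apply]
    have p1 := congrArg (pairing 1) h2
    simp only [map_add, map_smul, map_zero, h.symm _ (1 : W → ℂ), h.apply_one,
      h.pairing_deriv_lam, e1, smul_eq_mul] at p1
    rw [pairing_comm, map_zero] at p1
    have hμ : μ = 0 := by
      have : μ * c₀ = 0 := by linarith
      exact (mul_eq_zero.1 this).resolve_right h.pos.ne'
    have p2 := congrArg (pairing (Complex.I • 1)) h2
    rw [hμ] at p2
    simp only [map_add, map_smul, map_zero, h.symm _ (Complex.I • (1 : W → ℂ)), h.apply_I,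
      zero_smul, smul_eq_mul, pairing_I_self] at p2
    rw [pairing_comm, map_zero, add_zero, zero_add] at p2
    have hτ : τ = 0 := (mul_eq_zero.1 p2).resolve_right hv.ne'
    rw [hμ, hτ, zero_smul, zero_smul, add_zero, add_zero] at h2
    obtain ⟨c, hc⟩ := h.ker y h2
    rw [hc] at h3
    simp only at h3
    rw [hc, hμ, hτ, h3]
    rfl
  have hrank : Module.finrank ℝ ((W → ℂ) × ℝ × ℝ) = Module.finrank ℝ ((W → ℂ) × ℂ) := by
    simp [Module.finrank_prod, Complex.finrank_real_complex]
  refine ⟨(LinearEquiv.ofInjectiveOfFinrankEq D.toLinearMap hinj hrank).toContinuousLinearEquiv,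
    ?_⟩
  exact ContinuousLinearMap.ext fun x => rfl

/-- The perturbed kernel vector and spectral parameter. -/
theorem exists_branch (h : MagneticFamily k s t w Φ lam c₀ T) (v₀ : W) :
    ∃ (Y : (Fin k → ℝ) → W → ℂ) (Λ : (Fin k → ℝ) → ℝ), ContDiffAt ℝ 2 Y 0 ∧ ContDiffAt ℝ 2 Λ 0 ∧
      Y 0 = 1 ∧ Λ 0 = lam ∧ ∀ᶠ α in 𝓝 0, T (Λ α, α) (Y α) = 0 ∧ Y α v₀ = 1 := by
  have hc := h.contDiffAt_eqn v₀
  have hi := h.isInvertible_fderiv_eqn v₀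
  set φ := hc.implicitFunction (by norm_num) hi
  have h0 : φ 0 = (1, lam, 0) := hc.implicitFunction_apply_self (by norm_num) hi
  have h1 : ∀ᶠ α in 𝓝 0, eqn T v₀ (α, φ α) = eqn T v₀ (0, (1, lam, 0)) :=
    hc.eventually_apply_implicitFunction (by norm_num) hi
  have h2 : ContDiffAt ℝ 2 φ 0 := hc.contDiffAt_implicitFunction (by norm_num) hi
  refine ⟨fun α => (φ α).1, fun α => (φ α).2.1, h2.fst, h2.snd.fst,
    congrArg Prod.fst h0, congrArg (fun z => z.2.1) h0, ?_⟩
  filter_upwards [h1] with α hα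
  have e0 : eqn T v₀ (0, (1, lam, 0)) = 0 := by
    simp only [eqn, h.apply_one]
    simp
  rw [e0, eqn, Prod.mk_eq_zero] at hα
  obtain ⟨e1, e2⟩ := hα
  have e3 : (φ α).1 v₀ = 1 := sub_eq_zero.1 e2
  -- The multiplier is zero along the branch: by symmetry `T Y` is orthogonal to `i Y`, so pairing
  -- with `i Y` leaves the multiplier times `|Y|²`.
  have e4 := congrArg (pairing (Complex.I • (φ α).1)) e1
  simp only [map_add, map_smul, map_zero, smul_eq_mul, pairing_I_self] at e4
  have e5 : pairing (Complex.I • (φ α).1) (T ((φ α).2.1, α) (φ α).1) = 0 := by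
    have a1 := pairing_I_left (φ α).1 (T ((φ α).2.1, α) (φ α).1)
    have a2 : pairing (φ α).1 (Complex.I • T ((φ α).2.1, α) (φ α).1) =
        pairing (Complex.I • (φ α).1) (T ((φ α).2.1, α) (φ α).1) := by
      rw [← h.map_I, h.symm, pairing_comm]
    linarith
  rw [e5, zero_add] at e4
  have e6 : (φ α).2.2 = 0 := (mul_eq_zero.1 e4).resolve_right
    (pairing_self_pos (v := v₀) (by rw [e3]; exact one_ne_zero)).ne'
  rw [e6, zero_smul, add_zero] at e1
  exact ⟨e1, e3⟩

end MagneticFamily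

end Perturbation

/-! ### First- and second-order perturbation theory of the eigenvalue branch -/

section Perturbation

open ComplexConjugate

variable {W P : Type*} [Fintype W] [Fintype P]

/-- One application of L'Hôpital's rule along the ray reduces this to differentiability of `fderiv ℝ
Λ` at the origin. -/
theorem tendsto_second_order {k : ℕ} {Λ : (Fin k → ℝ) → ℝ} (h : ContDiffAt ℝ 2 Λ 0)
    (h0 : fderiv ℝ Λ 0 = 0) (α : Fin k → ℝ) :
    Tendsto (fun r : ℝ => (Λ (r • α) - Λ 0) / r ^ 2) (𝓝[≠] 0)
      (𝓝 (fderiv ℝ (fderiv ℝ Λ) 0 α α / 2)) := by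
  have h1 : ∀ᶠ x in 𝓝 (0 : Fin k → ℝ), DifferentiableAt ℝ Λ x :=
    (h.eventually (by simp)).mono fun x hx => hx.differentiableAt (by norm_num)
  have hl : ContinuousAt (fun r : ℝ => r • α) 0 := by fun_prop
  have h1' : ∀ᶠ r in 𝓝 (0 : ℝ), DifferentiableAt ℝ Λ (r • α) := by
    refine hl.eventually ?_
    simpa using h1
  have hd : ∀ r : ℝ, HasDerivAt (fun r : ℝ => r • α) α r := fun r => by
    simpa using (hasDerivAt_id r).smul_const α
  refine HasDerivAt.lhopital_zero_nhdsNE (f' := fun r => fderiv ℝ Λ (r • α) α)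
    (g' := fun r => 2 * r) ?_ ?_ ?_ ?_ ?_ ?_
  · refine eventually_nhdsWithin_of_eventually_nhds (h1'.mono fun r hr => ?_)
    exact (hr.hasFDerivAt.comp_hasDerivAt r (hd r)).sub_const _
  · exact Eventually.of_forall fun r => by simpa using hasDerivAt_pow 2 r
  · filter_upwards [self_mem_nhdsWithin] with r hr
    simpa using hr
  · refine tendsto_nhdsWithin_of_tendsto_nhds ?_
    have h2 : ContinuousAt (fun r : ℝ => Λ (r • α) - Λ 0) 0 :=
      (ContinuousAt.comp (g := Λ) (by simpa using h.continuousAt) hl).sub continuousAt_const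
    simpa using h2.tendsto
  · refine tendsto_nhdsWithin_of_tendsto_nhds ?_
    have : ContinuousAt (fun r : ℝ => r ^ 2) 0 := by fun_prop
    simpa using this.tendsto
  · have h3 : DifferentiableAt ℝ (fderiv ℝ Λ) 0 :=
      (h.fderiv_right (m := 1) (by norm_num)).differentiableAt (by norm_num)
    have h4 : HasDerivAt (fun r : ℝ => fderiv ℝ Λ (r • α) α) (fderiv ℝ (fderiv ℝ Λ) 0 α α) 0 := by
      have e1 := HasFDerivAt.comp_hasDerivAt (x := (0 : ℝ)) (l := fderiv ℝ Λ)
        (f := fun r : ℝ => r • α) (by simpa using h3.hasFDerivAt) (hd 0)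
      simpa using e1.clm_apply (hasDerivAt_const (0 : ℝ) α)
    have h5 := (hasDerivAt_iff_tendsto_slope_zero.1 h4).div_const 2
    refine h5.congr fun r => ?_
    simp [h0]
    ring

namespace MagneticFamily

variable {k : ℕ} {s t : P → W} {w : P → ℝ} {Φ : (Fin k → ℝ) →ₗ[ℝ] (P → ℝ)}
  {lam c₀ : ℝ} {T : ℝ × (Fin k → ℝ) → (W → ℂ) →L[ℝ] (W → ℂ)}
  {Y : (Fin k → ℝ) → W → ℂ} {Λ : (Fin k → ℝ) → ℝ}

theorem first_order (h : MagneticFamily k s t w Φ lam c₀ T) (hY : ContDiffAt ℝ 2 Y 0)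
    (hΛ : ContDiffAt ℝ 2 Λ 0) (hY0 : Y 0 = 1) (hΛ0 : Λ 0 = lam)
    (heq : ∀ᶠ α in 𝓝 0, T (Λ α, α) (Y α) = 0) (α : Fin k → ℝ) :
    T (lam, 0) (fderiv ℝ Y 0 α) + fderiv ℝ Λ 0 α • fderiv ℝ T (lam, 0) (1, 0) 1 +
      fderiv ℝ T (lam, 0) (0, α) 1 = 0 := by
  have d1 := (hY.differentiableAt (by norm_num)).hasFDerivAt
  have d2 := (hΛ.differentiableAt (by norm_num)).hasFDerivAt
  have d3 : HasFDerivAt (fun α => (Λ α, α)) ((fderiv ℝ Λ 0).prod (ContinuousLinearMap.id ℝ _))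
      (0 : Fin k → ℝ) := d2.prodMk (hasFDerivAt_id _)
  have d4 : HasFDerivAt (fun α => T (Λ α, α)) ((fderiv ℝ T (lam, 0)).comp
      ((fderiv ℝ Λ 0).prod (ContinuousLinearMap.id ℝ _))) (0 : Fin k → ℝ) :=
    HasFDerivAt.comp (g := T) (f := fun α => (Λ α, α)) (0 : Fin k → ℝ)
      (by rw [hΛ0]; exact h.hasFDerivAt) d3
  have d5 := d4.clm_apply d1
  have d6 : HasFDerivAt (fun α => T (Λ α, α) (Y α)) 0 (0 : Fin k → ℝ) :=
    (hasFDerivAt_const (𝕜 := ℝ) (0 : W → ℂ) (0 : Fin k → ℝ)).congr_of_eventuallyEq heq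
  have d7 := congrArg (fun A : (Fin k → ℝ) →L[ℝ] (W → ℂ) => A α) (d5.unique d6)
  have e : ((fderiv ℝ Λ 0 α, α) : ℝ × (Fin k → ℝ)) = fderiv ℝ Λ 0 α • (1, 0) + (0, α) := by
    simp
  simp only [hY0, hΛ0, add_apply, ContinuousLinearMap.comp_apply, ContinuousLinearMap.flip_apply,
    ContinuousLinearMap.prod_apply, ContinuousLinearMap.id_apply] at d7
  rw [e, map_add, map_smul] at d7
  simp only [add_apply, smul_apply, zero_apply] at d7
  rw [← add_assoc] at d7
  exact d7

/-- Pair the first-order equation with the constant `1`: the vector term drops out by symmetry, the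
flux term because coboundaries of constants vanish, and `-c₀` is nonzero. -/
theorem fderiv_eq_zero (h : MagneticFamily k s t w Φ lam c₀ T) (hY : ContDiffAt ℝ 2 Y 0)
    (hΛ : ContDiffAt ℝ 2 Λ 0) (hY0 : Y 0 = 1) (hΛ0 : Λ 0 = lam)
    (heq : ∀ᶠ α in 𝓝 0, T (Λ α, α) (Y α) = 0) : fderiv ℝ Λ 0 = 0 := by
  ext1 α
  have h1 := congrArg (pairing 1) (h.first_order hY hΛ hY0 hΛ0 heq α)
  simp only [map_add, map_smul, map_zero, h.symm _ (1 : W → ℂ), h.apply_one, h.pairing_deriv_lam,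
    h.pairing_deriv_flux, smul_eq_mul] at h1
  rw [pairing_comm, map_zero] at h1
  simp only [Pi.one_apply, sub_self, map_zero, zero_mul, Complex.zero_re, mul_zero,
    Finset.sum_const_zero] at h1
  have : fderiv ℝ Λ 0 α * c₀ = 0 := by linarith
  simpa using (mul_eq_zero.1 this).resolve_right h.pos.ne'

/-- By `hη` the vector `i η` solves the same linear equation as the derivative of `Y`. Their
difference lies in the kernel, hence is constant, and both vanish at `v₀`. -/
theorem fderiv_vector_eq (h : MagneticFamily k s t w Φ lam c₀ T) (hY : ContDiffAt ℝ 2 Y 0)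
    (hΛ : ContDiffAt ℝ 2 Λ 0) (hY0 : Y 0 = 1) (hΛ0 : Λ 0 = lam)
    (heq : ∀ᶠ α in 𝓝 0, T (Λ α, α) (Y α) = 0) {v₀ : W} (hv : ∀ᶠ α in 𝓝 0, Y α v₀ = 1)
    {α : Fin k → ℝ} {η : W → ℝ} (hη0 : η v₀ = 0)
    (hη : ∀ g : W → ℝ, ∑ p, w p * ((Φ α p - (η (t p) - η (s p))) * (g (t p) - g (s p))) = 0) :
    fderiv ℝ Y 0 α = fun v => Complex.I * η v := by
  have h1 := h.first_order hY hΛ hY0 hΛ0 heq α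
  rw [h.fderiv_eq_zero hY hΛ hY0 hΛ0 heq, zero_apply, zero_smul, add_zero] at h1
  have h2 : T (lam, 0) (fun v => Complex.I * η v) + fderiv ℝ T (lam, 0) (0, α) 1 = 0 := by
    refine eq_zero_of_pairing fun g => ?_
    rw [map_add, h.form, h.pairing_deriv_flux, ← Finset.sum_add_distrib]
    rw [← neg_eq_zero, ← Finset.sum_neg_distrib, ← hη fun v => (g v).im]
    refine Finset.sum_congr rfl fun p _ => ?_
    simp
    ring
  have h3 : T (lam, 0) (fderiv ℝ Y 0 α - fun v => Complex.I * η v) = 0 := by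
    rw [map_sub, sub_eq_zero]
    exact add_right_cancel (h1.trans h2.symm)
  obtain ⟨c, hc⟩ := h.ker _ h3
  have h4 : fderiv ℝ Y 0 α v₀ = 0 := by
    have d1 := (hY.differentiableAt (by norm_num)).hasFDerivAt
    have d2 := hasFDerivAt_pi.1 (show HasFDerivAt (fun α v => Y α v)
      (ContinuousLinearMap.pi fun v => (ContinuousLinearMap.proj v).comp (fderiv ℝ Y 0)) 0 from d1)
    have d3 := (d2 v₀).unique ((hasFDerivAt_const (1 : ℂ) (0 : Fin k → ℝ)).congr_of_eventuallyEq hv)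
    have := congrArg (fun A : (Fin k → ℝ) →L[ℝ] ℂ => A α) d3
    simpa using this
  have h5 := congrFun hc v₀
  simp [h4, hη0] at h5
  rw [← sub_eq_zero, hc, ← h5]
  rfl

/-- The trial vector `x = 1 + i r η` agrees with the true vector `Y (r • α)` to first order. As the
operator on the branch annihilates `Y`, its quadratic form at `x` equals that at the error, hence is
`o(r²)`. Splitting off the change of the spectral parameter gives `∑ w (Φα - dη)² - c₀ H / 2 = 0` in
the limit. -/
theorem hessian_eq (h : MagneticFamily k s t w Φ lam c₀ T) (hY : ContDiffAt ℝ 2 Y 0)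
    (hΛ : ContDiffAt ℝ 2 Λ 0) (hY0 : Y 0 = 1) (hΛ0 : Λ 0 = lam)
    (heq : ∀ᶠ α in 𝓝 0, T (Λ α, α) (Y α) = 0) {v₀ : W} (hv : ∀ᶠ α in 𝓝 0, Y α v₀ = 1)
    {α : Fin k → ℝ} {η : W → ℝ}
    (hη : ∀ g : W → ℝ, ∑ p, w p * ((Φ α p - (η (t p) - η (s p))) * (g (t p) - g (s p))) = 0) :
    fderiv ℝ (fderiv ℝ Λ) 0 α α =
      2 / c₀ * ∑ p, w p * (Φ α p - (η (t p) - η (s p))) ^ 2 := by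
  -- Only differences of `η` enter, so a constant may be subtracted to match the normalization of
  -- `Y`.
  wlog hη0 : η v₀ = 0 generalizing η
  · have := this (η := fun v => η v - η v₀) (by simpa using hη) (by simp)
    simpa using this
  have hgrad := h.fderiv_eq_zero hY hΛ hY0 hΛ0 heq
  have hYd := h.fderiv_vector_eq hY hΛ hY0 hΛ0 heq hv hη0 hη
  set H := fderiv ℝ (fderiv ℝ Λ) 0 α α with hH
  set x : ℝ → W → ℂ := fun r v => 1 + r * (Complex.I * η v) with hx
  set e : ℝ → W → ℂ := fun r => x r - Y (r • α) with he
  set Tr : ℝ → (W → ℂ) →L[ℝ] (W → ℂ) := fun r => T (Λ (r • α), r • α) with hTr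
  have hl : Tendsto (fun r : ℝ => r • α) (𝓝 0) (𝓝 0) := by
    have : ContinuousAt (fun r : ℝ => r • α) 0 := by fun_prop
    simpa using this.tendsto
  have hle : 𝓝[≠] (0 : ℝ) ≤ 𝓝 0 := nhdsWithin_le_nhds
  have hxd : HasDerivAt x (fun v => Complex.I * η v) 0 := by
    refine hasDerivAt_pi.2 fun v => ?_
    have := ((Complex.ofRealCLM.hasDerivAt (x := (0 : ℝ))).mul_const
      (Complex.I * (η v : ℂ))).const_add (1 : ℂ)
    exact this.congr_deriv (by simp)
  have hx0 : x 0 = 1 := by funext v; simp [hx]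
  have hxc : Tendsto x (𝓝[≠] 0) (𝓝 1) := by
    have := hxd.continuousAt.tendsto.mono_left hle
    rwa [hx0] at this
  have hev : ∀ {A : ℝ → (W → ℂ) →L[ℝ] (W → ℂ)} {f : ℝ → W → ℂ} {A₀ f₀},
      Tendsto A (𝓝[≠] 0) (𝓝 A₀) → Tendsto f (𝓝[≠] 0) (𝓝 f₀) →
      Tendsto (fun r => A r (f r)) (𝓝[≠] 0) (𝓝 (A₀ f₀)) := fun {A f A₀ f₀} hA hf =>
    ((isBoundedBilinearMap_apply (𝕜 := ℝ)).continuous.tendsto (A₀, f₀)).comp (hA.prodMk_nhds hf)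
  -- the error of the trial vector is of second order
  have hed : HasDerivAt e 0 0 := by
    have d1 := (hY.differentiableAt (by norm_num)).hasFDerivAt
    have d2 : HasDerivAt (fun r : ℝ => r • α) α 0 := by
      simpa using (hasDerivAt_id (0 : ℝ)).smul_const α
    have d3 := HasFDerivAt.comp_hasDerivAt (x := (0 : ℝ)) (l := Y)
      (f := fun r : ℝ => r • α) (by simpa using d1) d2
    have d4 := hxd.sub d3
    rw [hYd, sub_self] at d4
    exact d4
  have he0 : e 0 = 0 := by simp [he, hx0, hY0]
  have het : Tendsto (fun r : ℝ => r⁻¹ • e r) (𝓝[≠] 0) (𝓝 0) := by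
    have := hasDerivAt_iff_tendsto_slope_zero.1 hed
    simpa [he0] using this
  have hTc : Tendsto Tr (𝓝[≠] 0) (𝓝 (T (lam, 0))) := by
    have c1 : Tendsto (fun r : ℝ => (Λ (r • α), r • α)) (𝓝 0) (𝓝 (lam, 0)) := by
      have := hΛ.continuousAt.tendsto.comp hl
      rw [hΛ0] at this
      exact this.prodMk_nhds hl
    exact (h.contDiffAt.continuousAt.tendsto.comp c1).mono_left hle
  have hlim0 : Tendsto (fun r : ℝ => pairing (r⁻¹ • e r) (Tr r (r⁻¹ • e r))) (𝓝[≠] 0) (𝓝 0) := by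
    have c1 : Tendsto (fun r : ℝ => Tr r (r⁻¹ • e r)) (𝓝[≠] 0) (𝓝 (T (lam, 0) 0)) :=
      hev hTc het
    rw [map_zero] at c1
    have c2 := ((continuous_pairing (W := W)).tendsto (0, 0)).comp (het.prodMk_nhds c1)
    rwa [map_zero] at c2
  -- The two terms on the right separate the dependence on the flux at fixed `lam` from the
  -- dependence on the spectral parameter.
  have hid : ∀ᶠ r in 𝓝[≠] (0 : ℝ), pairing (r⁻¹ • e r) (Tr r (r⁻¹ • e r)) =
      pairing (r⁻¹ • x r) (T (lam, r • α) (r⁻¹ • x r)) +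
        pairing (x r) (((r ^ 2)⁻¹ • (Tr r - T (lam, r • α))) (x r)) := by
    filter_upwards [hle (hl.eventually heq)] with r hr
    have e1 : pairing (e r) (Tr r (e r)) = pairing (x r) (Tr r (x r)) := by
      have e2 : Tr r (e r) = Tr r (x r) := by
        simp only [he, map_sub, hTr]
        rw [hr, sub_zero]
      rw [e2, hTr, h.symm, ← hTr, e2, ← h.symm]
    have e3 : ∀ (A : (W → ℂ) →L[ℝ] (W → ℂ)) (f : W → ℂ),
        pairing (r⁻¹ • f) (A (r⁻¹ • f)) = (r ^ 2)⁻¹ * pairing f (A f) := fun A f => by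
      rw [map_smul, pairing_smul_smul, inv_pow]
    rw [e3, e3, e1, smul_apply, map_smul, sub_apply, map_sub, smul_eq_mul]
    ring
  -- the quadratic form of the trial vector
  have hlim1 : Tendsto (fun r : ℝ => pairing (r⁻¹ • x r) (T (lam, r • α) (r⁻¹ • x r))) (𝓝[≠] 0)
      (𝓝 (∑ p, w p * (Φ α p - (η (t p) - η (s p))) ^ 2)) := by
    simp only [h.form]
    refine tendsto_finsetSum _ fun p _ => tendsto_const_nhds.mul ?_
    have d1 : HasDerivAt (fun r : ℝ => Complex.exp (Complex.I * Φ (r • α) p))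
        (Complex.I * Φ α p) 0 := by
      have : HasDerivAt (fun r : ℝ => Complex.I * ((r : ℂ) * (Φ α p : ℂ)))
          (Complex.I * (1 * (Φ α p : ℂ))) 0 :=
        ((Complex.ofRealCLM.hasDerivAt (x := (0 : ℝ))).mul_const _).const_mul _
      have := this.cexp
      simpa using this
    have d2 := (hasDerivAt_pi.1 hxd (t p)).sub (d1.mul (hasDerivAt_pi.1 hxd (s p)))
    have d3 := hasDerivAt_iff_tendsto_slope_zero.1 d2
    have d4 : Tendsto (fun r : ℝ => (r⁻¹ • x r) (t p) -
        Complex.exp (Complex.I * Φ (r • α) p) * (r⁻¹ • x r) (s p)) (𝓝[≠] 0)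
        (𝓝 (Complex.I * η (t p) - (Complex.I * Φ α p + Complex.I * η (s p)))) := by
      convert! d3 using 2
      · simp [hx]
        ring
      · simp [hx]
    have d5 := (Complex.continuous_conj.continuousAt.tendsto.comp d4).mul d4
    have d6 := Complex.continuous_re.continuousAt.tendsto.comp d5
    convert! d6 using 2
    simp
    ring
  have hlim2 : Tendsto (fun r : ℝ => pairing (x r) (((r ^ 2)⁻¹ • (Tr r - T (lam, r • α))) (x r)))
      (𝓝[≠] 0) (𝓝 (H / 2 * -c₀)) := by
    have c0 := tendsto_second_order hΛ hgrad α
    -- Strict differentiability compares the operators at the two nearby points `(Λ, rα)` and `(lam,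
    -- rα)`. The error is `o` of their distance, which is `O(r²)` because the gradient of `Λ`
    -- vanishes.
    have hst := h.contDiffAt.hasStrictFDerivAt (by norm_num)
    have c1 : Tendsto (fun r : ℝ => ((Λ (r • α), r • α), (lam, r • α))) (𝓝[≠] 0)
        (𝓝 ((lam, 0), (lam, 0))) := by
      have a1 := (hΛ.continuousAt.tendsto.comp hl).mono_left hle
      rw [hΛ0] at a1
      have a2 := hl.mono_left hle
      exact (a1.prodMk_nhds a2).prodMk_nhds (tendsto_const_nhds.prodMk_nhds a2)
    have c2 := hst.isLittleO.comp_tendsto c1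
    have c3 : (fun r : ℝ => Λ (r • α) - lam) =O[𝓝[≠] 0] fun r : ℝ => r ^ 2 := by
      rw [← hΛ0]
      refine Asymptotics.isBigO_of_div_tendsto_nhds ?_ _ c0
      filter_upwards [self_mem_nhdsWithin] with r hr h0
      exact absurd h0 (pow_ne_zero 2 hr)
    have c4 : (fun r : ℝ => Tr r - T (lam, r • α) -
        (Λ (r • α) - lam) • fderiv ℝ T (lam, 0) (1, 0)) =o[𝓝[≠] 0] fun r : ℝ => r ^ 2 := by
      refine (c2.congr (fun r => ?_) (fun r => rfl)).trans_isBigO ?_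
      · simp only [Function.comp, hTr]
        congr 1
        rw [← map_smul]
        simp
      · refine Asymptotics.IsBigO.trans (Asymptotics.IsBigO.of_bound 1 ?_) c3
        refine Eventually.of_forall fun r => ?_
        simp [Prod.norm_def]
    have c5 : Tendsto (fun r : ℝ => (r ^ 2)⁻¹ • (Tr r - T (lam, r • α))) (𝓝[≠] 0)
        (𝓝 ((H / 2) • fderiv ℝ T (lam, 0) (1, 0))) := by
      have a1 := c4.tendsto_inv_smul_nhds_zero
      have a2 := a1.add (c0.smul_const (fderiv ℝ T (lam, 0) (1, 0)))
      rw [zero_add, hΛ0] at a2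
      refine a2.congr fun r => ?_
      rw [smul_sub, div_eq_inv_mul, mul_smul, sub_add_cancel]
    have c6 := ((continuous_pairing (W := W)).tendsto _).comp (hxc.prodMk_nhds (hev c5 hxc))
    simp only [smul_apply, map_smul, h.pairing_deriv_lam] at c6
    exact c6
  have hlim := (hlim1.add hlim2).congr' (hid.mono fun r hr => hr.symm)
  have := tendsto_nhds_unique hlim hlim0
  have hc := h.pos
  field_simp
  linarith

end MagneticFamily

end Perturbation

/-! ### Index of direct sums -/

section Index

open Module

variable {X X₁ X₂ : Type*} [AddCommGroup X] [Module ℝ X] [FiniteDimensional ℝ X]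
  [AddCommGroup X₁] [Module ℝ X₁] [FiniteDimensional ℝ X₁]
  [AddCommGroup X₂] [Module ℝ X₂] [FiniteDimensional ℝ X₂]

/-- Maximal positive subspaces are added. Injectivity of the sum map on them need not be assumed,
since `q` is positive on every nonzero pair. -/
theorem sigPos_add_le {q : QuadraticForm ℝ X} {q₁ : QuadraticForm ℝ X₁} {q₂ : QuadraticForm ℝ X₂}
    {f₁ : X₁ →ₗ[ℝ] X} {f₂ : X₂ →ₗ[ℝ] X} {a b : ℝ} (ha : 0 < a) (hb : 0 < b)
    (h : ∀ x y, q (f₁ x + f₂ y) = a * q₁ x + b * q₂ y) : sigPos q₁ + sigPos q₂ ≤ sigPos q := by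
  obtain ⟨V₁, hV₁, p₁⟩ := exists_finrank_eq_sigPos_and_posDef q₁
  obtain ⟨V₂, hV₂, p₂⟩ := exists_finrank_eq_sigPos_and_posDef q₂
  have key : ∀ z : V₁ × V₂, z ≠ 0 → 0 < q (f₁ z.1 + f₂ z.2) := by
    rintro ⟨x, y⟩ hz
    rw [h]
    by_cases hx : x = 0
    · have hy : y ≠ 0 := fun hy => hz (by rw [hx, hy]; rfl)
      have := mul_pos hb (p₂ y hy)
      rw [QuadraticMap.restrict_apply] at this
      simpa [hx] using this
    · have h1 := mul_pos ha (p₁ x hx)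
      have h2 : 0 ≤ b * q₂ y := by
        have := mul_nonneg hb.le (p₂.nonneg y)
        rwa [QuadraticMap.restrict_apply] at this
      rw [QuadraticMap.restrict_apply] at h1
      exact add_pos_of_pos_of_nonneg h1 h2
  set F : (V₁ × V₂) →ₗ[ℝ] X := (f₁ ∘ₗ V₁.subtype).coprod (f₂ ∘ₗ V₂.subtype) with hF
  have hFa : ∀ z, F z = f₁ z.1 + f₂ z.2 := fun z => by simp [hF]
  have hinj : Function.Injective F := by
    rw [← LinearMap.ker_eq_bot, LinearMap.ker_eq_bot']
    intro z hz
    by_contra hz0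
    have := key z hz0
    rw [← hFa, hz, map_zero] at this
    exact lt_irrefl _ this
  have hpos : (q.restrict (LinearMap.range F)).PosDef := by
    rintro ⟨_, z, rfl⟩ hz
    rw [QuadraticMap.restrict_apply]
    simp only
    rw [hFa]
    refine key z fun h0 => hz ?_
    ext
    simp [h0]
  have := le_sigPos_of_posDef q hpos
  rwa [LinearMap.finrank_range_of_inj hinj, Module.finrank_prod, hV₁, hV₂] at this

theorem sigNeg_add_le {q : QuadraticForm ℝ X} {q₁ : QuadraticForm ℝ X₁} {q₂ : QuadraticForm ℝ X₂}
    {f₁ : X₁ →ₗ[ℝ] X} {f₂ : X₂ →ₗ[ℝ] X} {a b : ℝ} (ha : 0 < a) (hb : 0 < b)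
    (h : ∀ x y, q (f₁ x + f₂ y) = a * q₁ x + b * q₂ y) : sigNeg q₁ + sigNeg q₂ ≤ sigNeg q := by
  simp only [← sigPos_neg]
  refine sigPos_add_le (f₁ := f₁) (f₂ := f₂) ha hb fun x y => ?_
  rw [neg_apply, h, neg_apply, neg_apply]
  ring

variable {W P : Type*} [Fintype W] [Fintype P]

/-- The index of a real form doubles under complexification. -/
theorem sigNeg_complexification {q : QuadraticForm ℝ (W → ℂ)} {q₀ : QuadraticForm ℝ (W → ℝ)}
    (h : ∀ f, q f = q₀ (fun v => (f v).re) + q₀ fun v => (f v).im) : sigNeg q = 2 * sigNeg q₀ := by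
  set f₁ : (W → ℝ) →ₗ[ℝ] (W → ℂ) :=
    { toFun := fun g v => (g v : ℂ)
      map_add' := fun g g' => by ext; simp
      map_smul' := fun c g => by ext; simp } with hf₁
  set f₂ : (W → ℝ) →ₗ[ℝ] (W → ℂ) :=
    { toFun := fun g v => (g v : ℂ) * Complex.I
      map_add' := fun g g' => by ext; simp [add_mul]
      map_smul' := fun c g => by ext; simp [mul_assoc] } with hf₂
  have h' : ∀ x y, q (f₁ x + f₂ y) = 1 * q₀ x + 1 * q₀ y := fun x y => by
    rw [h, one_mul, one_mul]; simp [hf₁, hf₂]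
  have a1 := sigPos_add_le one_pos one_pos h'
  have a2 := sigNeg_add_le one_pos one_pos h'
  have b1 := QuadraticForm.sigPos_add_sigNeg_add_radical (Q := q)
  have b2 := QuadraticForm.sigPos_add_sigNeg_add_radical (Q := q₀)
  have b3 : 2 * finrank ℝ q₀.radical ≤ finrank ℝ q.radical := by
    set F : (q₀.radical × q₀.radical) →ₗ[ℝ] (W → ℂ) :=
      (f₁ ∘ₗ q₀.radical.subtype).coprod (f₂ ∘ₗ q₀.radical.subtype) with hF
    have hinj : Function.Injective F := by
      rintro ⟨x, y⟩ ⟨x', y'⟩ hxy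
      have e : ∀ v, ((x : W → ℝ) v : ℂ) + (y : W → ℝ) v * Complex.I =
          (x' : W → ℝ) v + (y' : W → ℝ) v * Complex.I := fun v => by
        simpa [hF, hf₁, hf₂] using congrFun hxy v
      refine Prod.ext (Subtype.ext (funext fun v => ?_)) (Subtype.ext (funext fun v => ?_))
      · simpa using congrArg Complex.re (e v)
      · simpa using congrArg Complex.im (e v)
    have hle : LinearMap.range F ≤ q.radical := by
      rintro _ ⟨⟨⟨x, hx⟩, ⟨y, hy⟩⟩, rfl⟩
      rw [QuadraticMap.mem_radical_iff'] at hx hy ⊢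
      refine ⟨?_, fun m => ?_⟩
      · simpa [hF, hx.1, hy.1] using h' x y
      · rw [h, h]
        have e1 := hx.2 fun v => (m v).re
        have e2 := hy.2 fun v => (m v).im
        rw [← e1, ← e2]
        congr 1 <;> congr 1 <;> ext v <;> simp [hF, hf₁, hf₂]
    have := Submodule.finrank_mono hle
    rwa [LinearMap.finrank_range_of_inj hinj, Module.finrank_prod, ← two_mul] at this
  have c1 : finrank ℝ (W → ℂ) = 2 * Fintype.card W := by
    rw [Module.finrank_pi_fintype]; simp [mul_comm]
  have c2 : finrank ℝ (W → ℝ) = Fintype.card W := Module.finrank_pi ℝ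
  -- Coindex, index and radical are each bounded below by twice the real one, and both triples add
  -- up to the full dimension, so all three bounds are equalities.
  lia

/-- The index of the quadratic form induced on the cokernel of `d`. -/
theorem index_cokernel {Y : Type*} [AddCommGroup Y] [Module ℝ Y] [FiniteDimensional ℝ Y]
    {w : P → ℝ} (hw : ∀ p, w p ≠ 0) {d : (W → ℝ) →ₗ[ℝ] (P → ℝ)} {H : QuadraticForm ℝ Y}
    {Fl : (P → ℝ) →ₗ[ℝ] Y} (hsurj : Function.Surjective Fl)
    (hexact : ∀ c, Fl c = 0 ↔ ∃ g, c = d g)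
    (hker : ∀ g, (∀ g', ∑ p, w p * (d g p * d g' p) = 0) → d g = 0) {κ : ℝ} (hκ : 0 < κ)
    (hH : ∀ c, (∀ g, ∑ p, w p * (c p * d g p) = 0) → H (Fl c) = κ * ∑ p, w p * c p ^ 2) :
    H.radical = ⊥ ∧ sigNeg H + sigNeg ((QuadraticMap.weightedSumSquares ℝ w).comp d) =
      (Finset.univ.filter fun p => w p < 0).card := by
  set B := QuadraticMap.weightedSumSquares ℝ w with hB
  have hBa : ∀ c, B c = ∑ p, w p * c p ^ 2 := fun c => by
    simp [hB, QuadraticMap.weightedSumSquares_apply, sq]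
  set β : (P → ℝ) →ₗ[ℝ] (P → ℝ) →ₗ[ℝ] ℝ := LinearMap.mk₂ ℝ (fun c c' => ∑ p, w p * (c p * c' p))
    (fun a b c => by simp only [Pi.add_apply, add_mul, mul_add, Finset.sum_add_distrib])
    (fun r a b => by
      simp only [Pi.smul_apply, smul_eq_mul, Finset.mul_sum]
      exact Finset.sum_congr rfl fun p _ => by ring)
    (fun a b c => by simp only [Pi.add_apply, mul_add, Finset.sum_add_distrib])
    (fun r a b => by
      simp only [Pi.smul_apply, smul_eq_mul, Finset.mul_sum]
      exact Finset.sum_congr rfl fun p _ => by ring) with hβ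
  have hβa : ∀ c c', β c c' = ∑ p, w p * (c p * c' p) := fun c c' => rfl
  have hBadd : ∀ c c', B (c + c') = B c + B c' + 2 * β c c' := fun c c' => by
    rw [hBa, hBa, hBa, hβa, Finset.mul_sum, ← Finset.sum_add_distrib, ← Finset.sum_add_distrib]
    exact Finset.sum_congr rfl fun p _ => by simp only [Pi.add_apply]; ring
  set D := LinearMap.range d
  set C : Submodule ℝ (P → ℝ) := LinearMap.ker
    ((LinearMap.lcomp ℝ ℝ d).comp β) with hC
  have hCm : ∀ c, c ∈ C ↔ ∀ g, β c (d g) = 0 := fun c => by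
    rw [hC, LinearMap.mem_ker, LinearMap.ext_iff]; rfl
  -- every chain is the sum of one in `C` and a coboundary
  have hdec : ∀ c, ∃ g, c - d g ∈ C := by
    intro c
    -- By `hker` the form is nondegenerate on the coboundaries, so the functional `β c` on them is
    -- represented by a coboundary, which is subtracted from `c`. Positivity is not available, since
    -- the weights have both signs.
    set R : D →ₗ[ℝ] Module.Dual ℝ D := (LinearMap.lcomp ℝ ℝ D.subtype).comp (β.comp D.subtype)
    have hR : ∀ x y : D, R x y = β x y := fun x y => rfl
    have hinj : Function.Injective R := by
      rw [← LinearMap.ker_eq_bot, LinearMap.ker_eq_bot']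
      rintro ⟨_, g, rfl⟩ hx
      have : d g = 0 := hker g fun g' => by
        have := LinearMap.congr_fun hx ⟨d g', g', rfl⟩
        rwa [hR, hβa] at this
      ext; simp [this]
    have hs := (LinearMap.injective_iff_surjective_of_finrank_eq_finrank
      (Subspace.dual_finrank_eq (K := ℝ) (V := D)).symm).1 hinj
    obtain ⟨⟨_, g, rfl⟩, hg⟩ := hs ((β c).comp D.subtype)
    refine ⟨g, (hCm _).2 fun g' => ?_⟩
    have := LinearMap.congr_fun hg ⟨d g', g', rfl⟩
    rw [hR] at this
    simp only [LinearMap.comp_apply, Submodule.subtype_apply] at this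
    rw [map_sub, LinearMap.sub_apply, ← this, sub_self]
  have hFd : ∀ g, Fl (d g) = 0 := fun g => (hexact _).2 ⟨g, rfl⟩
  have hinjC : Function.Injective (Fl ∘ₗ C.subtype) := by
    rw [← LinearMap.ker_eq_bot, LinearMap.ker_eq_bot']
    rintro ⟨c, hc⟩ h0
    obtain ⟨g, rfl⟩ := (hexact c).1 h0
    ext1
    exact hker g fun g' => (hCm _).1 hc g'
  have hsurjC : Function.Surjective (Fl ∘ₗ C.subtype) := by
    intro y
    obtain ⟨c, rfl⟩ := hsurj y
    obtain ⟨g, hg⟩ := hdec c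
    refine ⟨⟨_, hg⟩, ?_⟩
    simp [hFd]
  set e := LinearEquiv.ofBijective _ ⟨hinjC, hsurjC⟩ with he
  have hea : ∀ c : C, e c = Fl c := fun c => rfl
  set f₁ : Y →ₗ[ℝ] (P → ℝ) := C.subtype ∘ₗ e.symm.toLinearMap with hf₁
  have hFf : ∀ y, Fl (f₁ y) = y := fun y => by
    have := e.apply_symm_apply y
    rwa [hea] at this
  have hfC : ∀ y, f₁ y ∈ C := fun y => (e.symm y).2
  have hHB : ∀ y, B (f₁ y) = κ⁻¹ * H y := fun y => by
    have := hH (f₁ y) ((hCm _).1 (hfC y))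
    rw [hFf, ← hBa] at this
    rw [this, inv_mul_cancel_left₀ hκ.ne']
  have hsum : ∀ y g, B (f₁ y + d g) = κ⁻¹ * H y + 1 * (B.comp d) g := fun y g => by
    rw [hBadd, hHB, (hCm _).1 (hfC y) g, QuadraticMap.comp_apply]; ring
  have hrad : H.radical = ⊥ := by
    rw [eq_bot_iff]
    intro y hy
    rw [QuadraticMap.mem_radical_iff'] at hy
    have h0 : ∀ c, β (f₁ y) c = 0 := by
      intro c
      obtain ⟨g, hg⟩ := hdec c
      have e1 : f₁ (Fl c) = c - d g := by
        have : e.symm (Fl c) = ⟨_, hg⟩ := by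
          rw [LinearEquiv.symm_apply_eq, hea]; simp [hFd]
        simp [hf₁, this]
      have e2 := hHB (y + Fl c)
      rw [map_add, hBadd, hHB, hHB, hy.1, hy.2, e1] at e2
      have e3 := (hCm _).1 (hfC y) g
      rw [map_sub, e3] at e2
      linarith
    have h1 : f₁ y = 0 := by
      classical
      ext p
      have := h0 (Pi.single p 1)
      rw [hβa, Finset.sum_eq_single p (fun p' _ hp => by simp [hp]) (by simp)] at this
      simpa [hw p] using this
    rw [Submodule.mem_bot, ← hFf y, h1, map_zero]
  refine ⟨hrad, ?_⟩
  have a1 := sigPos_add_le (inv_pos.2 hκ) one_pos hsum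
  have a2 := sigNeg_add_le (inv_pos.2 hκ) one_pos hsum
  have b1 := QuadraticForm.sigPos_add_sigNeg_add_radical (Q := B)
  have b2 := QuadraticForm.sigPos_add_sigNeg_add_radical (Q := H)
  have b3 := QuadraticForm.sigPos_add_sigNeg_add_radical (Q := B.comp d)
  have c1 : finrank ℝ (B.comp d).radical ≤ finrank ℝ (LinearMap.ker d) := by
    refine Submodule.finrank_mono fun g hg => ?_
    rw [QuadraticMap.mem_radical_iff'] at hg
    refine hker g fun g' => ?_
    have := hg.2 g'
    have h1 := hg.1
    rw [QuadraticMap.comp_apply] at h1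
    rw [QuadraticMap.comp_apply, QuadraticMap.comp_apply, map_add, hBadd, h1] at this
    rw [← hβa]
    linarith
  have c2 := LinearMap.finrank_range_add_finrank_ker d
  have c3 := LinearMap.finrank_range_add_finrank_ker Fl
  have c4 : LinearMap.ker Fl = LinearMap.range d := by
    ext c
    rw [LinearMap.mem_ker, hexact, LinearMap.mem_range]
    exact exists_congr fun g => eq_comm
  rw [c4, LinearMap.range_eq_top.2 hsurj, finrank_top] at c3
  have c5 : sigNeg B = (Finset.univ.filter fun p => w p < 0).card := by
    rw [hB, QuadraticForm.sigNeg_weightedSumSquares, ← Set.ncard_coe_finset]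
    congr 1
    ext p; simp
  rw [hrad, finrank_bot] at b2
  rw [← c5]
  -- Both indices are superadditive for the orthogonal splitting, and the dimensions add up: `H` is
  -- nondegenerate and the radical of `B.comp d` is at most the kernel of `d`. Hence superadditivity
  -- is an equality.
  lia

namespace MagneticFamily

variable {k : ℕ} {s t : P → W} {w : P → ℝ} {Φ : (Fin k → ℝ) →ₗ[ℝ] (P → ℝ)}
  {lam c₀ : ℝ} {T : ℝ × (Fin k → ℝ) → (W → ℂ) →L[ℝ] (W → ℂ)}
  {Y : (Fin k → ℝ) → W → ℂ} {Λ : (Fin k → ℝ) → ℝ}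

/-- The coboundary operator. -/
def coboundary (s t : P → W) : (W → ℝ) →ₗ[ℝ] (P → ℝ) where
  toFun g p := g (t p) - g (s p)
  map_add' g g' := by ext; simp only [Pi.add_apply]; ring
  map_smul' r g := by ext; simp only [Pi.smul_apply, RingHom.id_apply, smul_eq_mul]; ring

-- A real function whose coboundary is orthogonal to all coboundaries lies in the kernel at zero
-- flux, hence is constant. This is where simplicity of the eigenvalue gives nondegeneracy on
-- coboundaries.
open ComplexConjugate in
theorem coboundary_eq_zero (h : MagneticFamily k s t w Φ lam c₀ T) {g : W → ℝ}
    (hg : ∀ g', ∑ p, w p * (coboundary s t g p * coboundary s t g' p) = 0) :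
    coboundary s t g = 0 := by
  have h1 : T (lam, 0) (fun v => (g v : ℂ)) = 0 := by
    refine eq_zero_of_pairing fun f => ?_
    rw [h.form, ← hg fun v => (f v).re]
    refine Finset.sum_congr rfl fun p _ => ?_
    congr 1
    simp [coboundary, mul_comm]
  obtain ⟨c, hc⟩ := h.ker _ h1
  have h2 : ∀ v, g v = c.re := fun v => by simpa using congrArg Complex.re (congrFun hc v)
  ext p
  simp [coboundary, h2]

/-- For `c` orthogonal to coboundaries, the cochains `Φ (Fl c)` and `c` have the same flux and so
differ by some `dη`. This `η` is the one needed in `hessian_eq`, and `index_cokernel` becomes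
applicable. -/
theorem nondegenerate_hessian_and_index (h : MagneticFamily k s t w Φ lam c₀ T)
    (hY : ContDiffAt ℝ 2 Y 0)
    (hΛ : ContDiffAt ℝ 2 Λ 0) (hY0 : Y 0 = 1) (hΛ0 : Λ 0 = lam) {v₀ : W}
    (heq : ∀ᶠ α in 𝓝 0, T (Λ α, α) (Y α) = 0) (hv : ∀ᶠ α in 𝓝 0, Y α v₀ = 1)
    (hw : ∀ p, w p ≠ 0) {Fl : (P → ℝ) →ₗ[ℝ] (Fin k → ℝ)} (hFl : ∀ α, Fl (Φ α) = α)
    (hexact : ∀ c, Fl c = 0 ↔ ∃ g, c = coboundary s t g) :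
    (hessianAt Λ 0).Nondegenerate ∧ morseIndex Λ 0 +
      sigNeg ((QuadraticMap.weightedSumSquares ℝ w).comp (coboundary s t)) =
        (Finset.univ.filter fun p => w p < 0).card := by
  set H := LinearMap.BilinMap.toQuadraticMap (hessianAt Λ 0) with hHdef
  have hH : ∀ c, (∀ g, ∑ p, w p * (c p * coboundary s t g p) = 0) →
      H (Fl c) = 2 / c₀ * ∑ p, w p * c p ^ 2 := by
    intro c hc
    obtain ⟨η, hη⟩ := (hexact (Φ (Fl c) - c)).1 (by rw [map_sub, hFl, sub_self])
    have e : ∀ p, Φ (Fl c) p - (η (t p) - η (s p)) = c p := fun p => by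
      have := congrFun hη p
      simp only [Pi.sub_apply, coboundary, LinearMap.coe_mk, AddHom.coe_mk] at this
      linarith
    have := h.hessian_eq hY hΛ hY0 hΛ0 heq hv (α := Fl c) (η := η) (fun g => by
      simp only [e]; exact hc g)
    simp only [e] at this
    exact this
  obtain ⟨h1, h2⟩ := index_cokernel hw (d := coboundary s t) (H := H) (Fl := Fl)
    (fun α => ⟨Φ α, hFl α⟩) hexact (fun g hg => h.coboundary_eq_zero hg)
    (div_pos two_pos h.pos) hH
  refine ⟨?_, h2⟩
  have hsymm : ∀ a b, hessianAt Λ 0 a b = hessianAt Λ 0 b a := fun a b =>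
    (hΛ.isSymmSndFDerivAt (by simp)) a b
  have key : ∀ a, (∀ b, hessianAt Λ 0 a b = 0) → a = 0 := by
    intro a ha
    have : a ∈ H.radical := by
      rw [QuadraticMap.mem_radical_iff']
      refine ⟨ha a, fun b => ?_⟩
      change hessianAt Λ 0 (a + b) (a + b) = hessianAt Λ 0 b b
      simp [ha, hsymm b a]
    rwa [h1, Submodule.mem_bot] at this
  exact ⟨key, fun b hb => key b fun a => by rw [hsymm]; exact hb a⟩

end MagneticFamily

end Index

/-! ### Discretization of a quantum graph -/

/-- Complex-valued solutions of `-u'' + q u = μ u`; the second function is the derivative. -/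
structure IsComplexSolution (L : ℝ) (q : ℝ → ℝ) (μ : ℝ) (u v : ℝ → ℂ) : Prop where
  re : IsSolution L q μ (fun x => (u x).re) (fun x => (v x).re)
  im : IsSolution L q μ (fun x => (u x).im) (fun x => (v x).im)

namespace QuantumGraph

open ComplexConjugate

variable {V E : Type*} [DecidableEq V] [Fintype E]

/-- A subdivision of each edge into `m + 1` pieces of equal length, so short that the Dirichlet
problem on each piece is positive for all spectral parameters up to `M`. -/
structure Discretization (G : QuantumGraph V E) where
  m : ℕ
  Q : ℝ
  M : ℝ
  isPotential : ∀ e, IsPotential (G.length e) Q (G.q e)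
  F : ∀ e, FundamentalSystem (G.length e) (G.q e)
  short : ∀ e, (Q + M) * (G.length e / (m + 1)) ^ 2 < 8

namespace Discretization

variable {G : QuantumGraph V E} (D : G.Discretization)

/-- The points of the subdivision at which a function may be non-zero. -/
inductive Node (D : G.Discretization)
  | vtx (v : V) (h : v ∉ G.dirichlet)
  | inner (e : E) (j : Fin D.m)

/-- The point number `k` on the edge `e`. -/
noncomputable def point (e : E) (k : ℕ) : ℝ := k * (G.length e / (D.m + 1))

theorem point_zero (e : E) : D.point e 0 = 0 := by simp [point]

theorem point_last (e : E) : D.point e (D.m + 1) = G.length e := by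
  have : (D.m + 1 : ℝ) ≠ 0 := by positivity
  rw [point]; push_cast; field_simp

theorem step_pos (e : E) : 0 < G.length e / (D.m + 1) := div_pos (G.length_pos e) (by positivity)

theorem point_succ_sub (e : E) (k : ℕ) :
    D.point e (k + 1) - D.point e k = G.length e / (D.m + 1) := by
  rw [point, point]; push_cast; ring

theorem point_strictMono (e : E) : StrictMono (D.point e) := strictMono_nat_of_lt_succ fun k => by
  have := D.point_succ_sub e k
  have := D.step_pos e
  linarith

theorem isShort {μ : ℝ} (hμ : μ ≤ D.M) (e : E) {k : ℕ} (hk : k ≤ D.m) :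
    IsShort (G.length e) D.Q μ (D.point e k) (D.point e (k + 1)) where
  nonneg := by rw [← D.point_zero e]; exact (D.point_strictMono e).monotone (Nat.zero_le _)
  lt := D.point_strictMono e (Nat.lt_succ_self k)
  le := by rw [← D.point_last e]; exact (D.point_strictMono e).monotone (by lia)
  short := by
    rw [point_succ_sub]
    refine lt_of_le_of_lt ?_ (D.short e)
    gcongr

theorem point_mem (e : E) {k : ℕ} (hk : k ≤ D.m + 1) : D.point e k ∈ Set.Icc 0 (G.length e) := by
  constructor
  · rw [← D.point_zero e]; exact (D.point_strictMono e).monotone (Nat.zero_le _)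
  · rw [← D.point_last e]; exact (D.point_strictMono e).monotone hk

open Classical in
/-- The node at a vertex; there is none at a Dirichlet vertex. -/
noncomputable def vertexNode (v : V) : Option D.Node :=
  if h : v ∈ G.dirichlet then none else some (Node.vtx v h)

/-- The node at the point number `k` of the edge `e`. -/
noncomputable def node (e : E) (k : ℕ) : Option D.Node :=
  if k = 0 then D.vertexNode (G.src e)
  else if h : k - 1 < D.m then some (Node.inner e ⟨k - 1, h⟩) else D.vertexNode (G.tgt e)

theorem node_zero (e : E) : D.node e 0 = D.vertexNode (G.src e) := by simp [node]

theorem node_last (e : E) : D.node e (D.m + 1) = D.vertexNode (G.tgt e) := by simp [node]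

theorem node_inner (e : E) (j : Fin D.m) : D.node e (j + 1) = some (Node.inner e j) := by
  simp [node]

theorem vertexNode_of_mem {v : V} (h : v ∈ G.dirichlet) : D.vertexNode v = none := by
  simp [vertexNode, h]

theorem vertexNode_of_notMem {v : V} (h : v ∉ G.dirichlet) :
    D.vertexNode v = some (Node.vtx v h) := by simp [vertexNode, h]

/-- Evaluation at a node, which is zero at Dirichlet vertices. -/
def eval (o : Option D.Node) : (D.Node → ℂ) →ₗ[ℂ] ℂ where
  toFun x := o.elim 0 x
  map_add' x y := by cases o <;> simp
  map_smul' c x := by cases o <;> simp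

@[simp] theorem eval_none (x : D.Node → ℂ) : D.eval none x = 0 := rfl

@[simp] theorem eval_some (w : D.Node) (x : D.Node → ℂ) : D.eval (some w) x = x w := rfl

/-- The factor by which the phase of an edge enters at its points: only at the last one. -/
def twist (z : E → ℂ) (e : E) (k : ℕ) : ℂ := if k = D.m + 1 then conj (z e) else 1

/-- Evaluation at the point number `k` of the edge `e`, in the gauge of that edge. -/
noncomputable def edgeEval (z : E → ℂ) (e : E) (k : ℕ) : (D.Node → ℂ) →ₗ[ℂ] ℂ :=
  D.twist z e k • D.eval (D.node e k)

theorem edgeEval_apply (z : E → ℂ) (e : E) (k : ℕ) (x : D.Node → ℂ) :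
    D.edgeEval z e k x = D.twist z e k * D.eval (D.node e k) x := rfl

theorem edgeEval_zero (z : E → ℂ) (e : E) (x : D.Node → ℂ) :
    D.edgeEval z e 0 x = D.eval (D.vertexNode (G.src e)) x := by
  simp [edgeEval_apply, twist, node_zero]

theorem edgeEval_last (z : E → ℂ) (e : E) (x : D.Node → ℂ) :
    D.edgeEval z e (D.m + 1) x = conj (z e) * D.eval (D.vertexNode (G.tgt e)) x := by
  simp [edgeEval_apply, twist, node_last]

theorem edgeEval_inner (z : E → ℂ) (e : E) (j : Fin D.m) (x : D.Node → ℂ) :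
    D.edgeEval z e (j + 1) x = x (Node.inner e j) := by
  have : (j : ℕ) ≠ D.m := j.2.ne
  simp [edgeEval_apply, twist, node_inner, this]

/-- The diagonal coefficient at the left end of a piece. -/
noncomputable def left (μ : ℝ) (e : E) (k : ℕ) : ℝ :=
  (D.F e).coefLeft μ (D.point e k) (D.point e (k + 1))

/-- The diagonal coefficient at the right end of a piece. -/
noncomputable def right (μ : ℝ) (e : E) (k : ℕ) : ℝ :=
  (D.F e).coefRight μ (D.point e k) (D.point e (k + 1))

/-- The off-diagonal coefficient of a piece. -/
noncomputable def mix (μ : ℝ) (e : E) (k : ℕ) : ℝ :=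
  (D.F e).coefMix μ (D.point e k) (D.point e (k + 1))

theorem complex_deriv {μ : ℝ} {u v : ℝ → ℂ} {e : E} (hμ : μ ≤ D.M) {k : ℕ} (hk : k ≤ D.m)
    (hu : IsComplexSolution (G.length e) (G.q e) μ u v) :
    v (D.point e k) = D.mix μ e k * u (D.point e (k + 1)) - D.left μ e k * u (D.point e k) ∧
      v (D.point e (k + 1)) =
        D.right μ e k * u (D.point e (k + 1)) - D.mix μ e k * u (D.point e k) := by
  have hs := D.isShort hμ e hk
  have h := D.isPotential e
  constructor
  · apply Complex.ext
    · simpa [mix, left] using (D.F e).deriv_left hs h hu.re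
    · simpa [mix, left] using (D.F e).deriv_left hs h hu.im
  · apply Complex.ext
    · simpa [mix, right] using (D.F e).deriv_right hs h hu.re
    · simpa [mix, right] using (D.F e).deriv_right hs h hu.im

variable [Fintype V]

noncomputable instance : Fintype D.Node :=
  Fintype.ofInjective (β := V ⊕ E × Fin D.m)
    (fun w => match w with
      | .vtx v _ => Sum.inl v
      | .inner e j => Sum.inr (e, j)) (by
    rintro (⟨v, h⟩ | ⟨e, j⟩) (⟨v', h'⟩ | ⟨e', j'⟩) hw <;> simp_all)

/-- The discretized sesquilinear form. -/
noncomputable def form (μ : ℝ) (z : E → ℂ) (y x : D.Node → ℂ) : ℂ :=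
  (∑ e, ∑ k ∈ Finset.range (D.m + 1),
    (conj (D.edgeEval z e k y) *
        (D.left μ e k * D.edgeEval z e k x - D.mix μ e k * D.edgeEval z e (k + 1) x) +
      conj (D.edgeEval z e (k + 1) y) *
        (D.right μ e k * D.edgeEval z e (k + 1) x - D.mix μ e k * D.edgeEval z e k x))) +
    ∑ v, (G.χ v : ℂ) * (conj (D.eval (D.vertexNode v) y) * D.eval (D.vertexNode v) x)

variable (μ : ℝ) (z : E → ℂ)

theorem form_add_right (y x x' : D.Node → ℂ) :
    D.form μ z y (x + x') = D.form μ z y x + D.form μ z y x' := by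
  simp only [form, map_add]
  rw [add_add_add_comm, ← Finset.sum_add_distrib, ← Finset.sum_add_distrib]
  congr 1
  · refine Finset.sum_congr rfl fun e _ => ?_
    rw [← Finset.sum_add_distrib]
    exact Finset.sum_congr rfl fun k _ => by ring
  · exact Finset.sum_congr rfl fun k _ => by ring

theorem form_smul_right (c : ℂ) (y x : D.Node → ℂ) :
    D.form μ z y (c • x) = c * D.form μ z y x := by
  simp only [form, map_smul, smul_eq_mul]
  rw [mul_add, Finset.mul_sum, Finset.mul_sum]
  congr 1
  · refine Finset.sum_congr rfl fun e _ => ?_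
    rw [Finset.mul_sum]
    exact Finset.sum_congr rfl fun k _ => by ring
  · exact Finset.sum_congr rfl fun k _ => by ring

theorem conj_form (y x : D.Node → ℂ) : conj (D.form μ z y x) = D.form μ z x y := by
  simp only [form, map_add, map_sum, map_mul, map_sub, Complex.conj_conj, Complex.conj_ofReal]
  congr 1
  · refine Finset.sum_congr rfl fun e _ => ?_
    exact Finset.sum_congr rfl fun k _ => by ring
  · exact Finset.sum_congr rfl fun k _ => by ring

/-- The discretized operator. -/
noncomputable def op : (D.Node → ℂ) →ₗ[ℂ] (D.Node → ℂ) where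
  toFun x w := open Classical in D.form μ z (Pi.single w 1) x
  map_add' x x' := by ext w; exact D.form_add_right μ z _ x x'
  map_smul' c x := by ext w; exact D.form_smul_right μ z c _ x

theorem sum_op (y x : D.Node → ℂ) : ∑ w, conj (y w) * D.op μ z x w = D.form μ z y x := by
  classical
  set ℓ : (D.Node → ℂ) →ₗ[ℂ] ℂ :=
    { toFun := fun y => D.form μ z x y
      map_add' := D.form_add_right μ z x
      map_smul' := fun c y => D.form_smul_right μ z c x y }
  have h := LinearMap.pi_apply_eq_sum_univ ℓ y
  rw [← conj_form, show D.form μ z x y = ℓ y from rfl, h, map_sum]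
  refine Finset.sum_congr rfl fun w _ => ?_
  rw [smul_eq_mul, map_mul]
  congr 1
  rw [show ℓ _ = D.form μ z x _ from rfl, conj_form]
  simp only [op, LinearMap.coe_mk, AddHom.coe_mk]
  congr 1
  ext i
  by_cases hi : i = w
  · subst hi; simp
  · simp [hi, Ne.symm hi]

theorem pairing_op (y x : D.Node → ℂ) : pairing y (D.op μ z x) = (D.form μ z y x).re := by
  rw [pairing_apply, ← sum_op, Complex.re_sum]

theorem pairing_op_comm (y x : D.Node → ℂ) :
    pairing y (D.op μ z x) = pairing (D.op μ z y) x := by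
  rw [pairing_comm (D.op μ z y), pairing_op, pairing_op, ← conj_form, Complex.conj_re]

theorem op_eq_zero_iff (x : D.Node → ℂ) : D.op μ z x = 0 ↔ ∀ y, D.form μ z y x = 0 := by
  constructor
  · intro h y
    rw [← sum_op, h]; simp
  · intro h
    ext w
    exact h _

/-- The discretized quadratic form. -/
noncomputable def quad : QuadraticForm ℝ (D.Node → ℂ) :=
  LinearMap.BilinMap.toQuadraticMap (LinearMap.mk₂ ℝ (fun y x => pairing y (D.op μ z x))
    (fun y y' x => pairing_add_left y y' _) (fun c y x => pairing_smul_left c y _)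
    (fun y x x' => by rw [map_add, map_add])
    (fun c y x => by rw [LinearMap.map_smul_of_tower, map_smul]))

theorem quad_apply (x : D.Node → ℂ) : D.quad μ z x = pairing x (D.op μ z x) := rfl

theorem quad_add (x y : D.Node → ℂ) :
    D.quad μ z (x + y) = D.quad μ z x + D.quad μ z y + 2 * pairing y (D.op μ z x) := by
  simp only [quad_apply, map_add, pairing_add_left]
  rw [D.pairing_op_comm μ z x y, pairing_comm (D.op μ z x) y]
  ring

theorem mem_radical_quad_iff (x : D.Node → ℂ) : x ∈ (D.quad μ z).radical ↔ D.op μ z x = 0 := by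
  rw [QuadraticMap.mem_radical_iff']
  constructor
  · rintro ⟨h, h'⟩
    refine eq_zero_of_pairing fun y => ?_
    have := h' y
    rw [quad_add, h] at this
    linarith
  · intro h
    refine ⟨by rw [quad_apply, h, map_zero], fun y => ?_⟩
    rw [quad_add, quad_apply, h, map_zero, map_zero]
    ring

/-- Real dimensions and signatures of the Hermitian form are twice the complex ones; this is the
source of the halving in `index`. -/
theorem finrank_radical_quad :
    Module.finrank ℝ (D.quad μ z).radical = 2 * Module.finrank ℂ (LinearMap.ker (D.op μ z)) := by
  have e : (D.quad μ z).radical = (LinearMap.ker (D.op μ z)).restrictScalars ℝ := by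
    ext x
    rw [mem_radical_quad_iff]; rfl
  rw [e]
  exact finrank_real_of_complex (LinearMap.ker (D.op μ z))

variable {μ z}

/-- Summation by parts: the form in terms of the boundary values of solutions. -/
theorem form_eq_boundary (hμ : μ ≤ D.M) {x : D.Node → ℂ} {u v : E → ℝ → ℂ}
    (hu : ∀ e, IsComplexSolution (G.length e) (G.q e) μ (u e) (v e))
    (hx : ∀ e, ∀ k ≤ D.m + 1, u e (D.point e k) = D.edgeEval z e k x) (y : D.Node → ℂ) :
    D.form μ z y x = (∑ e, (conj (D.edgeEval z e (D.m + 1) y) * v e (G.length e) -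
      conj (D.edgeEval z e 0 y) * v e 0)) +
      ∑ v, (G.χ v : ℂ) * (conj (D.eval (D.vertexNode v) y) * D.eval (D.vertexNode v) x) := by
  rw [form]
  congr 1
  refine Finset.sum_congr rfl fun e _ => ?_
  have := Finset.sum_range_sub (fun k => conj (D.edgeEval z e k y) * v e (D.point e k)) (D.m + 1)
  rw [D.point_last, D.point_zero] at this
  rw [← this]
  refine Finset.sum_congr rfl fun k hk => ?_
  have hk' : k ≤ D.m := by simpa [Nat.lt_succ_iff] using hk
  obtain ⟨h1, h2⟩ := D.complex_deriv hμ hk' (hu e)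
  rw [← hx e k (by lia), ← hx e (k + 1) (by lia), h1, h2]
  ring

theorem quad_eq_sum (x : D.Node → ℂ) : D.quad μ z x =
    (∑ e, ∑ k ∈ Finset.range (D.m + 1),
      ((D.F e).pieceForm μ (D.point e k) (D.point e (k + 1)) (D.edgeEval z e k x).re
        (D.edgeEval z e (k + 1) x).re +
      (D.F e).pieceForm μ (D.point e k) (D.point e (k + 1)) (D.edgeEval z e k x).im
        (D.edgeEval z e (k + 1) x).im)) +
    ∑ v, G.χ v * Complex.normSq (D.eval (D.vertexNode v) x) := by
  rw [quad_apply, pairing_op, form, Complex.add_re, Complex.re_sum, Complex.re_sum]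
  congr 1
  · refine Finset.sum_congr rfl fun e _ => ?_
    rw [Complex.re_sum]
    refine Finset.sum_congr rfl fun k _ => ?_
    simp only [FundamentalSystem.pieceForm, left, right, mix, Complex.add_re, Complex.mul_re,
      Complex.mul_im, Complex.sub_re, Complex.sub_im, Complex.conj_re, Complex.conj_im,
      Complex.ofReal_re, Complex.ofReal_im]
    ring
  · refine Finset.sum_congr rfl fun v _ => ?_
    simp [Complex.normSq_apply]

end Discretization

end QuantumGraph

/-! ### Monotonicity and spectral flow of the discretized form -/

namespace QuantumGraph

open ComplexConjugate

variable {V E : Type*} [DecidableEq V] [Fintype E]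

namespace Discretization

variable {G : QuantumGraph V E} (D : G.Discretization) {μ : ℝ} {z : E → ℂ}

theorem twist_norm (hz : ∀ e, ‖z e‖ = 1) (e : E) (k : ℕ) : ‖D.twist z e k‖ = 1 := by
  rw [twist]; split_ifs
  · rw [RCLike.norm_conj, hz]
  · exact norm_one

theorem edgeEval_ne_zero_iff (hz : ∀ e, ‖z e‖ = 1) (e : E) (k : ℕ) (x : D.Node → ℂ) :
    D.edgeEval z e k x ≠ 0 ↔ D.eval (D.node e k) x ≠ 0 := by
  have : D.twist z e k ≠ 0 := norm_ne_zero_iff.1 (by rw [D.twist_norm hz]; exact one_ne_zero)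
  rw [edgeEval_apply, Ne, mul_eq_zero, not_or]
  exact ⟨fun h => h.2, fun h => ⟨this, h⟩⟩

theorem exists_piece_node (hinc : ∀ v, ∃ e, G.src e = v ∨ G.tgt e = v) (w : D.Node) :
    ∃ e, ∃ k ≤ D.m, D.node e k = some w ∨ D.node e (k + 1) = some w := by
  rcases w with ⟨v, hv⟩ | ⟨e, j⟩
  · obtain ⟨e, rfl | rfl⟩ := hinc v
    · exact ⟨e, 0, Nat.zero_le _, Or.inl (by rw [node_zero, vertexNode_of_notMem])⟩
    · exact ⟨e, D.m, le_rfl, Or.inr (by rw [node_last, vertexNode_of_notMem])⟩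
  · exact ⟨e, j, j.2.le, Or.inr (D.node_inner e j)⟩

variable [Fintype V]

/-- The vertex terms do not depend on the spectral parameter and every piece is monotone in it. A
node with nonzero value is an end of some piece, and that piece decreases strictly. -/
theorem quad_strictAnti (hinc : ∀ v, ∃ e, G.src e = v ∨ G.tgt e = v) (hz : ∀ e, ‖z e‖ = 1)
    {ν : ℝ} (hν : ν < μ) (hμ : μ ≤ D.M) {x : D.Node → ℂ} (hx : x ≠ 0) :
    D.quad μ z x < D.quad ν z x := by
  rw [quad_eq_sum, quad_eq_sum]
  refine add_lt_add_of_lt_of_le ?_ le_rfl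
  obtain ⟨w, hw⟩ := Function.ne_iff.1 hx
  obtain ⟨e, k, hk, hek⟩ := D.exists_piece_node hinc w
  have mono : ∀ e, ∀ k ≤ D.m, ∀ a b, (D.F e).pieceForm μ (D.point e k) (D.point e (k + 1)) a b ≤
      (D.F e).pieceForm ν (D.point e k) (D.point e (k + 1)) a b := by
    intro e k hk a b
    by_cases hab : a ≠ 0 ∨ b ≠ 0
    · exact ((D.F e).pieceForm_strictAnti (D.isShort hμ e hk) (D.isPotential e) hν hab).le
    · push Not at hab
      simp [hab.1, hab.2, FundamentalSystem.pieceForm]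
  have mem : ∀ {k}, k ∈ Finset.range (D.m + 1) ↔ k ≤ D.m := by simp
  refine Finset.sum_lt_sum (fun e _ => Finset.sum_le_sum fun k hk => ?_)
    ⟨e, Finset.mem_univ _, Finset.sum_lt_sum (fun k hk => ?_) ⟨k, mem.2 hk, ?_⟩⟩
  · exact add_le_add (mono e k (mem.1 hk) _ _) (mono e k (mem.1 hk) _ _)
  · exact add_le_add (mono e k (mem.1 hk) _ _) (mono e k (mem.1 hk) _ _)
  have h0 : D.edgeEval z e k x ≠ 0 ∨ D.edgeEval z e (k + 1) x ≠ 0 := by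
    rw [D.edgeEval_ne_zero_iff hz, D.edgeEval_ne_zero_iff hz]
    refine hek.imp (fun h => ?_) fun h => ?_ <;> rw [h] <;> exact hw
  have strict := fun a b hab => (D.F e).pieceForm_strictAnti (x := a) (y := b)
    (D.isShort hμ e hk) (D.isPotential e) hν hab
  by_cases hre : (D.edgeEval z e k x).re ≠ 0 ∨ (D.edgeEval z e (k + 1) x).re ≠ 0
  · exact add_lt_add_of_lt_of_le (strict _ _ hre) (mono e k hk _ _)
  · refine add_lt_add_of_le_of_lt (mono e k hk _ _) (strict _ _ ?_)
    push Not at hre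
    refine h0.imp (fun h h' => h (Complex.ext hre.1 h')) fun h h' => h (Complex.ext hre.2 h')

theorem continuousAt_quad (hμ : μ ≤ D.M) (z : E → ℂ) (x : D.Node → ℂ) :
    ContinuousAt (fun t : (ℝ × (E → ℂ)) × (D.Node → ℂ) => D.quad t.1.1 t.1.2 t.2)
      ((μ, z), x) := by
  simp only [quad_apply, pairing_op]
  refine Complex.continuous_re.continuousAt.comp ?_
  have hev : ∀ o, Continuous fun t : (ℝ × (E → ℂ)) × (D.Node → ℂ) => D.eval o t.2 := fun o =>
    (D.eval o).continuous_of_finiteDimensional.comp continuous_snd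
  have hee : ∀ e k, ContinuousAt (fun t : (ℝ × (E → ℂ)) × (D.Node → ℂ) =>
      D.edgeEval t.1.2 e k t.2) ((μ, z), x) := by
    intro e k
    simp only [edgeEval_apply, twist]
    refine Continuous.continuousAt (Continuous.mul ?_ (hev _))
    split_ifs
    · fun_prop
    · fun_prop
  have hc : ∀ e, ∀ k ∈ Finset.range (D.m + 1),
      ContinuousAt (fun t : (ℝ × (E → ℂ)) × (D.Node → ℂ) => (D.left t.1.1 e k : ℂ)) ((μ, z), x) ∧
      ContinuousAt (fun t : (ℝ × (E → ℂ)) × (D.Node → ℂ) => (D.mix t.1.1 e k : ℂ)) ((μ, z), x) ∧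
      ContinuousAt (fun t : (ℝ × (E → ℂ)) × (D.Node → ℂ) => (D.right t.1.1 e k : ℂ))
        ((μ, z), x) := by
    intro e k hk
    have hk' : k ≤ D.m := by simpa [Nat.lt_succ_iff] using hk
    obtain ⟨h1, h2, h3⟩ := (D.F e).contDiffAt_coef (D.isShort hμ e hk') (D.isPotential e)
    have hp : ContinuousAt (fun t : (ℝ × (E → ℂ)) × (D.Node → ℂ) => t.1.1) ((μ, z), x) := by
      fun_prop
    refine ⟨?_, ?_, ?_⟩
    · exact Complex.continuous_ofReal.continuousAt.comp
        (ContinuousAt.comp (g := fun μ => D.left μ e k) h1.continuousAt hp)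
    · exact Complex.continuous_ofReal.continuousAt.comp
        (ContinuousAt.comp (g := fun μ => D.mix μ e k) h2.continuousAt hp)
    · exact Complex.continuous_ofReal.continuousAt.comp
        (ContinuousAt.comp (g := fun μ => D.right μ e k) h3.continuousAt hp)
  have hconj : ∀ {f : (ℝ × (E → ℂ)) × (D.Node → ℂ) → ℂ}, ContinuousAt f ((μ, z), x) →
      ContinuousAt (fun t => conj (f t)) ((μ, z), x) := fun h =>
    Complex.continuous_conj.continuousAt.comp h
  simp only [form]
  refine ContinuousAt.add (tendsto_finsetSum _ fun e _ => tendsto_finsetSum _ fun k hk => ?_)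
    (tendsto_finsetSum _ fun v _ => ?_)
  · obtain ⟨h1, h2, h3⟩ := hc e k hk
    exact ((hconj (hee e k)).mul ((h1.mul (hee e k)).sub (h2.mul (hee e (k + 1))))).add
      ((hconj (hee e (k + 1))).mul ((h3.mul (hee e (k + 1))).sub (h2.mul (hee e k))))
  · exact continuousAt_const.mul ((hconj (hev _).continuousAt).mul (hev _).continuousAt)

/-- Lower semicontinuity of the index and of the coindex. -/
theorem eventually_sig_le (hμ : μ ≤ D.M) (z : E → ℂ) :
    ∀ᶠ t : ℝ × (E → ℂ) in 𝓝 (μ, z), sigNeg (D.quad μ z) ≤ sigNeg (D.quad t.1 t.2) ∧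
      sigPos (D.quad μ z) ≤ sigPos (D.quad t.1 t.2) :=
  (eventually_sigNeg_le (fun t : ℝ × (E → ℂ) => D.quad t.1 t.2) (μ, z)
    (D.continuousAt_quad hμ z)).and
  (eventually_sigPos_le (fun t : ℝ × (E → ℂ) => D.quad t.1 t.2) (μ, z) (D.continuousAt_quad hμ z))

theorem eventually_quad_nonneg (hinc : ∀ v, ∃ e, G.src e = v ∨ G.tgt e = v)
    (hz : ∀ e, ‖z e‖ = 1) : ∀ᶠ μ in atBot, ∀ x : D.Node → ℂ, 0 ≤ D.quad μ z x := by
  -- For very negative `μ` each piece dominates `κ` times the squares of its end values. As every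
  -- vertex is an end of some piece, this absorbs the vertex terms of either sign.
  set κ := ∑ v, |G.χ v| with hκ
  have hκ0 : 0 ≤ κ := Finset.sum_nonneg fun v _ => abs_nonneg _
  have h1 : ∀ᶠ μ in atBot, ∀ e, ∀ k ∈ Finset.range (D.m + 1), ∀ x y,
      κ * (x ^ 2 + y ^ 2) ≤ (D.F e).pieceForm μ (D.point e k) (D.point e (k + 1)) x y := by
    rw [eventually_all]
    intro e
    rw [Filter.eventually_all_finset]
    intro k hk
    have hk' : k ≤ D.m := by simpa [Nat.lt_succ_iff] using hk
    have hs := D.isShort le_rfl e hk'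
    exact eventually_atBot.2 ((D.F e).exists_le_pieceForm (D.isPotential e) hs.nonneg hs.lt
      hs.le hκ0)
  filter_upwards [h1] with μ hμ x
  rw [quad_eq_sum]
  set n : E → ℕ → ℝ := fun e k => Complex.normSq (D.edgeEval z e k x) with hn
  have hn0 : ∀ e k, 0 ≤ n e k := fun e k => Complex.normSq_nonneg _
  set S := ∑ e, ∑ k ∈ Finset.range (D.m + 1), (n e k + n e (k + 1)) with hS
  have hpiece : ∀ e, ∀ k ≤ D.m, n e k + n e (k + 1) ≤ S := by
    intro e k hk
    have a1 := Finset.single_le_sum (f := fun k => n e k + n e (k + 1))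
      (fun k _ => add_nonneg (hn0 e k) (hn0 e (k + 1)))
      (Finset.mem_range.2 (Nat.lt_succ_of_le hk))
    have a2 := Finset.single_le_sum
      (f := fun e => ∑ k ∈ Finset.range (D.m + 1), (n e k + n e (k + 1)))
      (fun e _ => Finset.sum_nonneg fun k _ => add_nonneg (hn0 e k) (hn0 e (k + 1)))
      (Finset.mem_univ e)
    exact a1.trans a2
  have hS0 : 0 ≤ S := Finset.sum_nonneg fun e _ => Finset.sum_nonneg fun k _ =>
    add_nonneg (hn0 e k) (hn0 e (k + 1))
  have hnorm : ∀ e k, n e k = Complex.normSq (D.eval (D.node e k) x) := fun e k => by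
    simp only [hn, edgeEval_apply, map_mul]
    rw [Complex.normSq_eq_norm_sq, D.twist_norm hz]; simp
  have hv : ∀ v, Complex.normSq (D.eval (D.vertexNode v) x) ≤ S := by
    intro v
    obtain ⟨e, rfl | rfl⟩ := hinc v
    · have := hpiece e 0 (Nat.zero_le _)
      rw [hnorm e 0, node_zero] at this
      have := hn0 e (0 + 1)
      linarith
    · have := hpiece e D.m le_rfl
      rw [hnorm e (D.m + 1), node_last] at this
      have := hn0 e D.m
      linarith
  have b1 : -(κ * S) ≤ ∑ v, G.χ v * Complex.normSq (D.eval (D.vertexNode v) x) := by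
    rw [hκ, Finset.sum_mul, ← Finset.sum_neg_distrib]
    refine Finset.sum_le_sum fun v _ => ?_
    have e1 := mul_le_mul_of_nonneg_left (hv v) (abs_nonneg (G.χ v))
    have e2 := mul_le_mul_of_nonneg_right (neg_abs_le (G.χ v))
      (Complex.normSq_nonneg (D.eval (D.vertexNode v) x))
    linarith
  have b2 : κ * S ≤ ∑ e, ∑ k ∈ Finset.range (D.m + 1),
      ((D.F e).pieceForm μ (D.point e k) (D.point e (k + 1)) (D.edgeEval z e k x).re
        (D.edgeEval z e (k + 1) x).re +
      (D.F e).pieceForm μ (D.point e k) (D.point e (k + 1)) (D.edgeEval z e k x).im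
        (D.edgeEval z e (k + 1) x).im) := by
    rw [hS, Finset.mul_sum]
    refine Finset.sum_le_sum fun e _ => ?_
    rw [Finset.mul_sum]
    refine Finset.sum_le_sum fun k hk => ?_
    have c1 := hμ e k hk (D.edgeEval z e k x).re (D.edgeEval z e (k + 1) x).re
    have c2 := hμ e k hk (D.edgeEval z e k x).im (D.edgeEval z e (k + 1) x).im
    simp only [hn, Complex.normSq_apply]
    linarith
  linarith

theorem sigNeg_eq_zero_of_nonneg {X : Type*} [AddCommGroup X] [Module ℝ X]
    [FiniteDimensional ℝ X] {q : QuadraticForm ℝ X} (h : ∀ x, 0 ≤ q x) : sigNeg q = 0 := by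
  obtain ⟨U, hU, hpos⟩ := exists_finrank_eq_sigNeg_and_negDef q
  rw [← hU, Submodule.finrank_eq_zero, Submodule.eq_bot_iff]
  intro x hx
  by_contra h0
  have := hpos ⟨x, hx⟩ (by simpa using h0)
  rw [QuadraticMap.restrict_apply, neg_apply] at this
  linarith [h x]

/-- The number of negative complex directions of the discretized form. -/
noncomputable def index (μ : ℝ) (z : E → ℂ) : ℕ := sigNeg (D.quad μ z) / 2

/-- The jump comes from strict monotonicity, `left` from semicontinuity of the index. For `right`,
semicontinuity of the coindex is converted into an upper bound on the index through the dimension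
formula. -/
theorem isSpectralFlow (hinc : ∀ v, ∃ e, G.src e = v ∨ G.tgt e = v) (hz : ∀ e, ‖z e‖ = 1) :
    IsSpectralFlow D.M (fun μ => D.index μ z)
      fun μ => Module.finrank ℂ (LinearMap.ker (D.op μ z)) where
  jump_le := by
    intro μ μ' hμ hM
    have := sigNeg_add_radical_le fun x hx => D.quad_strictAnti hinc hz hμ hM (x := x) hx
    rw [finrank_radical_quad] at this
    simp only [index]
    lia
  left := by
    intro μ hμ
    have h1 : ContinuousAt (fun ν : ℝ => (ν, z)) μ := by fun_prop
    have := h1.eventually (D.eventually_sig_le hμ z)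
    filter_upwards [eventually_nhdsWithin_of_eventually_nhds this] with ν hν
    exact Nat.div_le_div_right hν.1
  right := by
    intro μ hμ
    have h1 : ContinuousAt (fun ν : ℝ => (ν, z)) μ := by fun_prop
    have := h1.eventually (D.eventually_sig_le hμ.le z)
    filter_upwards [eventually_nhdsWithin_of_eventually_nhds this] with ν hν
    have e1 := QuadraticForm.sigPos_add_sigNeg_add_radical (Q := D.quad μ z)
    have e2 := QuadraticForm.sigPos_add_sigNeg_add_radical (Q := D.quad ν z)
    rw [finrank_radical_quad] at e1
    simp only [index]
    lia
  exists_zero := by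
    obtain ⟨m, hm, hM⟩ := ((D.eventually_quad_nonneg hinc hz).and (eventually_le_atBot D.M)).exists
    refine ⟨m, hM, ?_⟩
    simp only [index]
    rw [sigNeg_eq_zero_of_nonneg hm]

end Discretization

end QuantumGraph

/-! ### Gauge transformation on an edge -/

section Gauge

open ComplexConjugate

variable {L Q μ : ℝ} {q A A' : ℝ → ℝ}

theorem isComplexSolution_iff {u v : ℝ → ℂ} : IsComplexSolution L q μ u v ↔
    HasIntegralDeriv L u v ∧ HasIntegralDeriv L v (fun t => ((q t - μ : ℝ) : ℂ) * u t) := by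
  rw [hasIntegralDeriv_complex_iff, hasIntegralDeriv_complex_iff (f := v)]
  simp only [Complex.re_ofReal_mul, Complex.im_ofReal_mul]
  exact ⟨fun h => ⟨⟨h.re.left, h.im.left⟩, h.re.right, h.im.right⟩,
    fun h => ⟨⟨h.1.1, h.2.1⟩, ⟨h.1.2, h.2.2⟩⟩⟩

theorem IsComplexSolution.continuousOn {u v : ℝ → ℂ} (h : IsComplexSolution L q μ u v) :
    ContinuousOn u (Set.Icc 0 L) ∧ ContinuousOn v (Set.Icc 0 L) :=
  ⟨(isComplexSolution_iff.1 h).1.continuousOn, (isComplexSolution_iff.1 h).2.continuousOn⟩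

theorem HasIntegralDeriv.congr_left {F : Type*} [NormedAddCommGroup F] [NormedSpace ℝ F]
    {f f₁ g : ℝ → F} (hL : 0 ≤ L) (h : HasIntegralDeriv L f g)
    (hf : ∀ x ∈ Set.Icc 0 L, f₁ x = f x) : HasIntegralDeriv L f₁ g :=
  ⟨h.1, fun x hx => by rw [hf x hx, hf 0 ⟨le_rfl, hL⟩, h.2 x hx]⟩

/-- The gauge factor of the magnetic potential `A`. -/
noncomputable def magneticPhase (A : ℝ → ℝ) (x : ℝ) : ℂ :=
  Complex.exp (Complex.I * ((∫ t in (0 : ℝ)..x, A t : ℝ) : ℂ))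

theorem magneticPhase_zero (A : ℝ → ℝ) : magneticPhase A 0 = 1 := by simp [magneticPhase]

theorem norm_magneticPhase (A : ℝ → ℝ) (x : ℝ) : ‖magneticPhase A x‖ = 1 := by
  rw [magneticPhase, mul_comm, Complex.norm_exp_ofReal_mul_I]

theorem conj_mul_self_of_norm {z : ℂ} (h : ‖z‖ = 1) : conj z * z = 1 := by
  rw [Complex.conj_mul', h]; simp

theorem hasIntegralDeriv_magneticPhase (hL : 0 ≤ L) (hA : ContinuousOn A (Set.Icc 0 L)) :
    HasIntegralDeriv L (magneticPhase A) (fun x => Complex.I * A x * magneticPhase A x) := by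
  -- A continuous extension to the line makes the phase differentiable everywhere, including at the
  -- end points, without changing it on `[0, L]`.
  set B : ℝ → ℝ := Set.IccExtend hL ((Set.Icc 0 L).domRestrict A) with hB
  have hBc : Continuous B := (continuousOn_iff_continuous_domRestrict.1 hA).Icc_extend'
  have hBA : ∀ x ∈ Set.Icc 0 L, B x = A x := fun x hx => by
    rw [hB, Set.IccExtend_of_mem hL _ hx]; rfl
  have hg : ∀ x ∈ Set.Icc 0 L, magneticPhase A x = magneticPhase B x := by
    intro x hx
    rw [magneticPhase, magneticPhase]
    congr 3
    refine intervalIntegral.integral_congr fun t ht => (hBA t ?_).symm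
    rw [Set.uIcc_of_le hx.1] at ht
    exact ⟨ht.1, ht.2.trans hx.2⟩
  have hd : ∀ x, HasDerivAt (magneticPhase B) (Complex.I * B x * magneticPhase B x) x := by
    intro x
    have h1 : HasDerivAt (fun x => ∫ t in (0 : ℝ)..x, B t) (B x) x :=
      intervalIntegral.integral_hasDerivAt_right (hBc.intervalIntegrable _ _)
        hBc.aestronglyMeasurable.stronglyMeasurableAtFilter hBc.continuousAt
    have h2 := (h1.ofReal_comp.const_mul Complex.I).cexp
    convert! h2 using 1
    rw [magneticPhase]; ring
  have hgc : Continuous (magneticPhase B) := continuous_iff_continuousAt.2 fun x => (hd x).continuousAt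
  have hdc : Continuous fun x => Complex.I * B x * magneticPhase B x := by fun_prop
  have h3 : HasIntegralDeriv L (magneticPhase B) (fun x => Complex.I * B x * magneticPhase B x) :=
    ⟨hdc.intervalIntegrable _ _, fun x _ => by
      rw [intervalIntegral.integral_eq_sub_of_hasDerivAt (fun y _ => hd y)
        (hdc.intervalIntegrable _ _)]
      ring⟩
  refine (h3.congr_left hL hg).congr_deriv hL ?_
  filter_upwards [ae_restrict_mem measurableSet_Icc] with x hx
  rw [hBA x hx, hg x hx]

theorem hasIntegralDeriv_conj_magneticPhase (hL : 0 ≤ L) (hA : ContinuousOn A (Set.Icc 0 L)) :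
    HasIntegralDeriv L (fun x => conj (magneticPhase A x))
      (fun x => -(Complex.I * A x) * conj (magneticPhase A x)) := by
  have h := hasIntegralDeriv_magneticPhase hL hA
  rw [hasIntegralDeriv_complex_iff] at h ⊢
  refine ⟨?_, ?_⟩
  · convert! h.1 using 2
    simp
  · convert! h.2.const_mul (-1) using 2 <;> simp

/-- The gauge transformation removes the magnetic potential. -/
theorem isComplexSolution_conj_magneticPhase_mul (hL : 0 ≤ L) (hA : ContinuousOn A (Set.Icc 0 L))
    {f f' D D' : ℝ → ℂ} (hD : ∀ x, D x = f' x - Complex.I * A x * f x)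
    (h1 : HasIntegralDeriv L f f') (h2 : HasIntegralDeriv L D D')
    (heq : ∀ᵐ x ∂volume.restrict (Set.Icc 0 L),
      -(D' x - Complex.I * A x * D x) + q x * f x = μ * f x) :
    IsComplexSolution L q μ (fun x => conj (magneticPhase A x) * f x)
      (fun x => conj (magneticPhase A x) * D x) := by
  have hg := hasIntegralDeriv_conj_magneticPhase hL hA
  rw [isComplexSolution_iff]
  constructor
  · refine (hg.mul_complex hL h1).congr_deriv hL (Eventually.of_forall fun x => ?_)
    rw [hD]; ring
  · refine (hg.mul_complex hL h2).congr_deriv hL ?_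
    filter_upwards [heq] with x hx
    push_cast
    linear_combination -conj (magneticPhase A x) * hx

theorem memLp_of_continuousOn {f : ℝ → ℂ} (hf : ContinuousOn f (Set.Icc 0 L)) :
    MemLp f 2 (volume.restrict (Set.Icc 0 L)) := by
  obtain ⟨C, hC⟩ := isCompact_Icc.exists_bound_of_continuousOn hf
  refine MemLp.of_bound (hf.aestronglyMeasurable measurableSet_Icc) C ?_
  filter_upwards [ae_restrict_mem measurableSet_Icc] with x hx using hC x hx

theorem IsPotential.memLp_mul (h : IsPotential L Q q) (μ : ℝ) {f : ℝ → ℂ}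
    (hf : ContinuousOn f (Set.Icc 0 L)) :
    MemLp (fun x => ((q x - μ : ℝ) : ℂ) * f x) 2 (volume.restrict (Set.Icc 0 L)) := by
  obtain ⟨C, hC⟩ := isCompact_Icc.exists_bound_of_continuousOn hf
  have hq : AEStronglyMeasurable q (volume.restrict (Set.Icc 0 L)) :=
    ((intervalIntegrable_iff_integrableOn_Icc_of_le h.pos.le).1 h.integrable).aestronglyMeasurable
  refine MemLp.of_bound ((Complex.continuous_ofReal.comp_aestronglyMeasurable
    (hq.sub aestronglyMeasurable_const)).mul (hf.aestronglyMeasurable measurableSet_Icc))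
    ((Q + |μ|) * C) ?_
  filter_upwards [ae_restrict_mem measurableSet_Icc] with x hx
  rw [norm_mul, Complex.norm_real, Real.norm_eq_abs]
  refine mul_le_mul ?_ (hC x hx) (norm_nonneg _) (add_nonneg h.nonneg (abs_nonneg _))
  exact (abs_sub _ _).trans (add_le_add (h.bound x hx) le_rfl)

/-- The inverse gauge transformation, with the regularity of the result. -/
theorem IsComplexSolution.magneticPhase_mul (hq : IsPotential L Q q) (hA : HasH1Deriv L A A')
    {u v : ℝ → ℂ} (hu : IsComplexSolution L q μ u v) :
    ∃ f'' D' : ℝ → ℂ,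
      HasH1Deriv L (fun x => magneticPhase A x * u x)
        (fun x => magneticPhase A x * v x + Complex.I * A x * (magneticPhase A x * u x)) ∧
      HasH1Deriv L (fun x => magneticPhase A x * v x + Complex.I * A x * (magneticPhase A x * u x)) f'' ∧
      HasH1Deriv L (fun x => magneticPhase A x * v x) D' ∧
      ∀ x, -(D' x - Complex.I * A x * (magneticPhase A x * v x)) + q x * (magneticPhase A x * u x) =
        μ * (magneticPhase A x * u x) := by
  have hL := hq.pos.le
  have hAi := hA.hasIntegralDeriv hL
  have hAc : ContinuousOn A (Set.Icc 0 L) := hAi.continuousOn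
  have hAC : ContinuousOn (fun x => Complex.I * A x) (Set.Icc 0 L) :=
    continuousOn_const.mul (Complex.continuous_ofReal.comp_continuousOn hAc)
  have hg := hasIntegralDeriv_magneticPhase hL hAc
  have hgc := hg.continuousOn
  obtain ⟨huc, hvc⟩ := hu.continuousOn
  obtain ⟨h1, h2⟩ := isComplexSolution_iff.1 hu
  have a1 := hg.mul_complex hL h1
  have a2 := hg.mul_complex hL h2
  have hAI : HasIntegralDeriv L (fun x => Complex.I * A x) (fun x => Complex.I * A' x) := by
    refine HasIntegralDeriv.const_mul (𝕜 := ℂ) ?_ Complex.I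
    rw [hasIntegralDeriv_complex_iff]
    refine ⟨by simpa using hAi, ?_⟩
    simp only [Complex.ofReal_im]
    exact (HasH1Deriv.zero L).hasIntegralDeriv hL
  have a3 := hAI.mul_complex hL a1
  have m2 : MemLp (fun x => Complex.I * A x * magneticPhase A x * v x +
      magneticPhase A x * (((q x - μ : ℝ) : ℂ) * u x)) 2 (volume.restrict (Set.Icc 0 L)) := by
    refine (memLp_of_continuousOn ((hAC.mul hgc).mul hvc)).add ?_
    convert! hq.memLp_mul μ (hgc.mul huc) using 2
    simp only [Pi.mul_apply]
    ring
  have m1c : ContinuousOn (fun x => Complex.I * A x * magneticPhase A x * u x + magneticPhase A x * v x)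
    (Set.Icc 0 L) := ((hAC.mul hgc).mul huc).add (hgc.mul hvc)
  have m3 : MemLp (fun x => Complex.I * A' x * (magneticPhase A x * u x) +
      Complex.I * A x * (Complex.I * A x * magneticPhase A x * u x + magneticPhase A x * v x)) 2
      (volume.restrict (Set.Icc 0 L)) := by
    refine MemLp.add ?_ (memLp_of_continuousOn (hAC.mul m1c))
    obtain ⟨C, hC⟩ := isCompact_Icc.exists_bound_of_continuousOn (hgc.mul huc)
    refine MemLp.of_le_mul (g := A') (c := C) hA.1 ?_ ?_
    · exact ((Complex.continuous_ofReal.comp_aestronglyMeasurable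
        hA.1.aestronglyMeasurable).const_mul Complex.I).mul
          ((hgc.mul huc).aestronglyMeasurable measurableSet_Icc)
    · filter_upwards [ae_restrict_mem measurableSet_Icc] with x hx
      rw [norm_mul, norm_mul, Complex.norm_I, one_mul, Complex.norm_real, mul_comm]
      exact mul_le_mul_of_nonneg_right (hC x hx) (norm_nonneg _)
  refine ⟨fun x => (Complex.I * A x * magneticPhase A x * v x +
      magneticPhase A x * (((q x - μ : ℝ) : ℂ) * u x)) + (Complex.I * A' x * (magneticPhase A x * u x) +
      Complex.I * A x * (Complex.I * A x * magneticPhase A x * u x + magneticPhase A x * v x)),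
    fun x => Complex.I * A x * magneticPhase A x * v x + magneticPhase A x * (((q x - μ : ℝ) : ℂ) * u x),
    ⟨?_, fun x hx => ?_⟩, ⟨m2.add m3, (a2.add a3).2⟩, ⟨m2, a2.2⟩, fun x => by push_cast; ring⟩
  · refine memLp_of_continuousOn (m1c.congr fun x _ => ?_)
    ring
  · have := a1.2 x hx
    convert! this using 3
    funext t
    ring

end Gauge

/-! ### Eigenfunctions as kernel vectors of the discretized operator -/

namespace QuantumGraph

open ComplexConjugate

variable {V E : Type*} [DecidableEq V] [Fintype E]

/-- The phases of the edges. -/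
noncomputable def MagneticPotential.phase {G : QuantumGraph V E} (A : G.MagneticPotential)
    (e : E) : ℂ := magneticPhase (A.A e) (G.length e)

theorem MagneticPotential.norm_phase {G : QuantumGraph V E} (A : G.MagneticPotential) (e : E) :
    ‖A.phase e‖ = 1 := norm_magneticPhase _ _

theorem MagneticPotential.continuousOn {G : QuantumGraph V E} (A : G.MagneticPotential) (e : E) :
    ContinuousOn (A.A e) (Set.Icc 0 (G.length e)) := by
  obtain ⟨A', hA⟩ := A.regular e
  exact (hA.hasIntegralDeriv (G.length_pos e).le).continuousOn

/-- Boundary terms are regrouped from edges to vertices, where the `δ`-conditions are stated; a loop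
contributes twice to its vertex, as it should. -/
theorem sum_vertices [Fintype V] (G : QuantumGraph V E) (y : V → ℂ) (a b : E → ℂ) :
    ∑ e, (y (G.tgt e) * b e - y (G.src e) * a e) =
      -∑ v, y v * (∑ e with G.src e = v, a e - ∑ e with G.tgt e = v, b e) := by
  have key : ∀ (s : E → V) (c : E → ℂ), ∑ e, y (s e) * c e = ∑ v, y v * ∑ e with s e = v, c e := by
    intro s c
    rw [← Finset.sum_fiberwise Finset.univ s]
    refine Finset.sum_congr rfl fun v _ => ?_
    rw [Finset.mul_sum]
    refine Finset.sum_congr rfl fun e he => ?_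
    rw [(Finset.mem_filter.1 he).2]
  rw [Finset.sum_sub_distrib, key, key]
  simp only [mul_sub, Finset.sum_sub_distrib]
  ring

namespace Discretization

variable {G : QuantumGraph V E} (D : G.Discretization) {μ : ℝ} {z : E → ℂ}

theorem node_eq_inner_iff {e e' : E} {k : ℕ} {j : Fin D.m} :
    D.node e' k = some (Node.inner e j) ↔ e' = e ∧ k = j + 1 := by
  constructor
  · intro h
    have hv : ∀ v, D.vertexNode v ≠ some (Node.inner e j) := by
      intro v
      rw [vertexNode]; split_ifs <;> simp
    rw [node] at h
    split_ifs at h with h0 h1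
    · exact absurd h (hv _)
    · simp only [Option.some.injEq, Node.inner.injEq] at h
      refine ⟨h.1, ?_⟩
      rw [← h.2]; simp only; lia
    · exact absurd h (hv _)
  · rintro ⟨rfl, rfl⟩
    exact D.node_inner e' j

theorem edgeEval_single_inner [DecidableEq D.Node] (e e' : E) (k : ℕ) (j : Fin D.m) :
    D.edgeEval z e' k (Pi.single (Node.inner e j) 1) =
      open Classical in if e' = e ∧ k = j + 1 then 1 else 0 := by
  split_ifs with h
  · obtain ⟨rfl, rfl⟩ := h
    rw [edgeEval_inner, Pi.single_eq_same]
  · rw [edgeEval_apply]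
    rw [← node_eq_inner_iff] at h
    rcases ho : D.node e' k with _ | w
    · simp
    · rw [ho] at h
      have : w ≠ Node.inner e j := fun h' => h (congrArg some h')
      simp [this]

open Classical in
/-- The values of a function at the nodes, in the gauge in which the magnetic potential vanishes on
the edges. -/
noncomputable def sample (hinc : ∀ v, ∃ e, G.src e = v ∨ G.tgt e = v) (A : G.MagneticPotential) :
    (E → ℝ → ℂ) →ₗ[ℂ] (D.Node → ℂ) where
  toFun f w := match w with
    -- Any incident edge end may be used: for functions continuous at the vertices the choice does
    -- not matter (`sample_vtx`).
    | .vtx v _ => if G.src (hinc v).choose = v then f (hinc v).choose 0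
        else f (hinc v).choose (G.length (hinc v).choose)
    | .inner e j => conj (magneticPhase (A.A e) (D.point e (j + 1))) * f e (D.point e (j + 1))
  map_add' f g := by
    ext w
    rcases w with ⟨v, hv⟩ | ⟨e, j⟩
    · simp only [Pi.add_apply]; split_ifs <;> rfl
    · simp only [Pi.add_apply]; ring
  map_smul' c f := by
    ext w
    rcases w with ⟨v, hv⟩ | ⟨e, j⟩
    · simp only [Pi.smul_apply, RingHom.id_apply]; split_ifs <;> rfl
    · simp only [Pi.smul_apply, RingHom.id_apply, smul_eq_mul]; ring

variable {hinc : ∀ v, ∃ e, G.src e = v ∨ G.tgt e = v} {A : G.MagneticPotential}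

theorem sample_inner (f : E → ℝ → ℂ) (e : E) (j : Fin D.m) : D.sample hinc A f (Node.inner e j) =
    conj (magneticPhase (A.A e) (D.point e (j + 1))) * f e (D.point e (j + 1)) := rfl

theorem sample_vtx {f : E → ℝ → ℂ} {val : V → ℂ}
    (hval : ∀ e, f e 0 = val (G.src e) ∧ f e (G.length e) = val (G.tgt e)) (v : V)
    (hv : v ∉ G.dirichlet) : D.sample hinc A f (Node.vtx v hv) = val v := by
  simp only [sample, LinearMap.coe_mk, AddHom.coe_mk]
  have h := (hinc v).choose_spec
  split_ifs with h0
  · rw [(hval _).1, h0]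
  · rw [(hval _).2, h.resolve_left h0]

theorem edgeEval_sample {f : E → ℝ → ℂ} {val : V → ℂ}
    (hval : ∀ e, f e 0 = val (G.src e) ∧ f e (G.length e) = val (G.tgt e))
    (hd : ∀ v ∈ G.dirichlet, val v = 0) (e : E) {k : ℕ} (hk : k ≤ D.m + 1) :
    conj (magneticPhase (A.A e) (D.point e k)) * f e (D.point e k) =
      D.edgeEval A.phase e k (D.sample hinc A f) := by
  have hev : ∀ v, D.eval (D.vertexNode v) (D.sample hinc A f) = val v := by
    intro v
    by_cases hv : v ∈ G.dirichlet
    · rw [D.vertexNode_of_mem hv, hd v hv, eval_none]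
    · rw [D.vertexNode_of_notMem hv, eval_some, D.sample_vtx hval]
  rcases k with _ | k
  · rw [edgeEval_zero, point_zero, magneticPhase_zero, (hval e).1, hev]; simp
  · rcases Nat.lt_or_ge k D.m with h | h
    · have := D.edgeEval_inner A.phase e ⟨k, h⟩ (D.sample hinc A f)
      rw [this, sample_inner]
    · obtain rfl : k = D.m := by lia
      rw [edgeEval_last, point_last, hev, (hval e).2]; rfl

variable [Fintype V]

/-- Testing with the indicator of an inner node expresses that the derivatives of the interpolating
solutions on the two adjacent pieces match. -/
theorem inner_equation {x : D.Node → ℂ} (hx : D.op μ z x = 0) (e : E) {k : ℕ} (hk : k < D.m) :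
    D.left μ e (k + 1) * D.edgeEval z e (k + 1) x -
        D.mix μ e (k + 1) * D.edgeEval z e (k + 2) x +
      (D.right μ e k * D.edgeEval z e (k + 1) x - D.mix μ e k * D.edgeEval z e k x) = 0 := by
  classical
  have h := (D.op_eq_zero_iff μ z x).1 hx (Pi.single (Node.inner e ⟨k, hk⟩) 1)
  rw [form] at h
  have hv : ∀ v, D.eval (D.vertexNode v) (Pi.single (Node.inner e ⟨k, hk⟩) 1) = 0 := by
    intro v
    rw [vertexNode]
    split_ifs <;> simp
  simp only [edgeEval_single_inner, hv, map_zero, zero_mul, mul_zero, Finset.sum_const_zero,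
    add_zero] at h
  rw [Finset.sum_eq_single e (fun e' _ he' => by simp [he']) (by simp)] at h
  simp only [true_and, apply_ite conj, map_one, map_zero, ite_mul, one_mul, zero_mul,
    Finset.sum_add_distrib, add_left_inj] at h
  rw [Finset.sum_ite_eq' (Finset.range (D.m + 1)) (k + 1),
    Finset.sum_ite_eq' (Finset.range (D.m + 1)) k, if_pos (Finset.mem_range.2 (by lia)),
    if_pos (Finset.mem_range.2 (by lia))] at h
  exact h

/-- Every kernel vector is interpolated by solutions on the edges. -/
theorem exists_solution_of_op_eq_zero (hμ : μ ≤ D.M) {x : D.Node → ℂ} (hx : D.op μ z x = 0)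
    (e : E) : ∃ u v, IsComplexSolution (G.length e) (G.q e) μ u v ∧
      ∀ k ≤ D.m + 1, u (D.point e k) = D.edgeEval z e k x := by
  have hs := D.isShort hμ e (Nat.zero_le _)
  obtain ⟨u₁, v₁, h₁, h₁0, h₁1⟩ := FundamentalSystem.exists_isSolution_boundary hs
    (D.isPotential e) (D.edgeEval z e 0 x).re (D.edgeEval z e 1 x).re
  obtain ⟨u₂, v₂, h₂, h₂0, h₂1⟩ := FundamentalSystem.exists_isSolution_boundary hs
    (D.isPotential e) (D.edgeEval z e 0 x).im (D.edgeEval z e 1 x).im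
  set u : ℝ → ℂ := fun t => ⟨u₁ t, u₂ t⟩ with hu
  set v : ℝ → ℂ := fun t => ⟨v₁ t, v₂ t⟩ with hv
  have hsol : IsComplexSolution (G.length e) (G.q e) μ u v := ⟨h₁, h₂⟩
  refine ⟨u, v, hsol, ?_⟩
  -- The solution fixed on the first piece is propagated: both its values and the kernel vector obey
  -- the same three-term recursion, and the coefficient of the next value is nonzero.
  have key : ∀ k ≤ D.m, u (D.point e k) = D.edgeEval z e k x ∧
      u (D.point e (k + 1)) = D.edgeEval z e (k + 1) x := by
    intro k
    induction k with
    | zero => exact fun _ => ⟨Complex.ext h₁0 h₂0, Complex.ext h₁1 h₂1⟩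
    | succ k ih =>
      intro hk
      obtain ⟨i1, i2⟩ := ih (by lia)
      refine ⟨i2, ?_⟩
      have e1 := (D.complex_deriv hμ (by lia) hsol (k := k)).2
      have e2 := (D.complex_deriv hμ hk hsol).1
      have e3 := D.inner_equation hx e (k := k) (by lia)
      have hb : (D.mix μ e (k + 1) : ℂ) ≠ 0 := by
        exact_mod_cast ((D.F e).coefMix_pos (D.isShort hμ e hk) (D.isPotential e)).ne'
      rw [i1, i2] at e1
      rw [i2] at e2
      refine mul_left_cancel₀ hb ?_
      linear_combination e1 - e2 + e3
  intro k hk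
  rcases k with _ | k
  · exact (key 0 (Nat.zero_le _)).1
  · exact (key k (by lia)).2

/-- After the gauge transformation, summation by parts leaves only boundary terms; regrouped at the
vertices, these cancel against the `χ` terms by the vertex conditions. -/
theorem sample_mem_ker (hμ : μ ≤ D.M) {f : E → ℝ → ℂ} (hf : f ∈ eigenspace A μ) :
    D.op μ A.phase (D.sample hinc A f) = 0 ∧ ∃ u v : E → ℝ → ℂ,
      (∀ e, IsComplexSolution (G.length e) (G.q e) μ (u e) (v e)) ∧
      (∀ e x, u e x = conj (magneticPhase (A.A e) x) * f e x) ∧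
      ∀ e, ∀ k ≤ D.m + 1, u e (D.point e k) =
        D.edgeEval A.phase e k (D.sample hinc A f) := by
  obtain ⟨hf0, f', f'', D', h1, h2, h3, ⟨val, hval, hd, hδ⟩, heq⟩ := hf
  have hsol : ∀ e, IsComplexSolution (G.length e) (G.q e) μ
      (fun x => conj (magneticPhase (A.A e) x) * f e x)
      (fun x => conj (magneticPhase (A.A e) x) * covDeriv A f f' e x) := fun e =>
    isComplexSolution_conj_magneticPhase_mul (G.length_pos e).le (A.continuousOn e)
      (fun x => rfl) ((h1 e).hasIntegralDeriv (G.length_pos e).le)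
      ((h3 e).hasIntegralDeriv (G.length_pos e).le) (heq e)
  have hev := fun e (k : ℕ) hk => D.edgeEval_sample (hinc := hinc) (A := A) hval hd e (k := k) hk
  refine ⟨?_, fun e x => conj (magneticPhase (A.A e) x) * f e x,
    fun e x => conj (magneticPhase (A.A e) x) * covDeriv A f f' e x, hsol, fun e x => rfl, hev⟩
  rw [op_eq_zero_iff]
  intro y
  rw [D.form_eq_boundary hμ (u := fun e x => conj (magneticPhase (A.A e) x) * f e x)
    (v := fun e x => conj (magneticPhase (A.A e) x) * covDeriv A f f' e x) hsol hev y]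
  have hs := G.sum_vertices (fun v => conj (D.eval (D.vertexNode v) y))
    (fun e => covDeriv A f f' e 0) (fun e => covDeriv A f f' e (G.length e))
  have e1 : ∑ e, (conj (D.edgeEval A.phase e (D.m + 1) y) *
        (conj (magneticPhase (A.A e) (G.length e)) * covDeriv A f f' e (G.length e)) -
      conj (D.edgeEval A.phase e 0 y) *
        (conj (magneticPhase (A.A e) 0) * covDeriv A f f' e 0)) =
      ∑ e, (conj (D.eval (D.vertexNode (G.tgt e)) y) * covDeriv A f f' e (G.length e) -
        conj (D.eval (D.vertexNode (G.src e)) y) * covDeriv A f f' e 0) := by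
    refine Finset.sum_congr rfl fun e _ => ?_
    rw [edgeEval_zero, edgeEval_last, magneticPhase_zero, map_one, map_mul, Complex.conj_conj]
    have := conj_mul_self_of_norm (A.norm_phase e)
    rw [show magneticPhase (A.A e) (G.length e) = A.phase e from rfl]
    linear_combination (conj (D.eval (D.vertexNode (G.tgt e)) y) *
      covDeriv A f f' e (G.length e)) * this
  rw [e1, hs, neg_add_eq_sub, ← Finset.sum_sub_distrib]
  refine Finset.sum_eq_zero fun v _ => ?_
  by_cases hv : v ∈ G.dirichlet
  · rw [D.vertexNode_of_mem hv]; simp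
  · rw [hδ v hv, D.vertexNode_of_notMem hv, eval_some, eval_some, D.sample_vtx hval]
    ring

/-- On every edge the gauged function vanishes at the ends of the first piece, and a short interval
has no nonzero Dirichlet solution. -/
theorem sample_injOn (hμ : μ ≤ D.M) {f : E → ℝ → ℂ} (hf : f ∈ eigenspace A μ)
    (h0 : D.sample hinc A f = 0) : f = 0 := by
  obtain ⟨-, u, v, hsol, huf, hev⟩ := D.sample_mem_ker (hinc := hinc) hμ hf
  funext e x
  by_cases hx : x ∈ Set.Icc 0 (G.length e)
  · have a0 := hev e 0 (by lia)
    have a1 := hev e (0 + 1) (by lia)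
    rw [h0, map_zero] at a0 a1
    have hs := D.isShort hμ e (Nat.zero_le _)
    have r := hs.eq_zero_of_dirichlet (D.isPotential e) (hsol e).re (by rw [a0]; rfl)
      (by rw [a1]; rfl) x hx
    have i := hs.eq_zero_of_dirichlet (D.isPotential e) (hsol e).im (by rw [a0]; rfl)
      (by rw [a1]; rfl) x hx
    have hu0 : u e x = 0 := Complex.ext r.1 i.1
    rw [huf, mul_eq_zero, map_eq_zero] at hu0
    refine hu0.resolve_left fun h => ?_
    have := norm_magneticPhase (A.A e) x
    rw [h, norm_zero] at this
    exact zero_ne_one this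
  · exact hf.1 e x hx

theorem exists_sample_eq (hμ : μ ≤ D.M) {x : D.Node → ℂ} (hx : D.op μ A.phase x = 0) :
    ∃ f ∈ eigenspace A μ, D.sample hinc A f = x := by
  classical
  choose u v hsol hev using D.exists_solution_of_op_eq_zero hμ hx
  choose A' hA' using A.regular
  choose f'' D' h1 h2 h3 heq using fun e =>
    (hsol e).magneticPhase_mul (D.isPotential e) (hA' e)
  set f : E → ℝ → ℂ := fun e => (Set.Icc 0 (G.length e)).indicator
    fun t => magneticPhase (A.A e) t * u e t with hf
  have hfx : ∀ e, ∀ t ∈ Set.Icc 0 (G.length e), f e t = magneticPhase (A.A e) t * u e t :=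
    fun e t ht => Set.indicator_of_mem ht _
  set f' : E → ℝ → ℂ := fun e t => magneticPhase (A.A e) t * v e t +
    Complex.I * A.A e t * (magneticPhase (A.A e) t * u e t) with hf'
  have hDx : ∀ e, ∀ t ∈ Set.Icc 0 (G.length e),
      covDeriv A f f' e t = magneticPhase (A.A e) t * v e t := fun e t ht => by
    simp only [covDeriv, hf']
    rw [hfx e t ht]; ring
  have hL := fun e => (G.length_pos e).le
  have h0 : ∀ e, (0 : ℝ) ∈ Set.Icc 0 (G.length e) := fun e => ⟨le_rfl, hL e⟩
  have hLm : ∀ e, G.length e ∈ Set.Icc 0 (G.length e) := fun e => ⟨hL e, le_rfl⟩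
  set val : V → ℂ := fun v => D.eval (D.vertexNode v) x with hval
  have hphase := fun e => conj_mul_self_of_norm (A.norm_phase e)
  have hu0 : ∀ e, u e 0 = val (G.src e) := fun e => by
    have := hev e 0 (by lia)
    rwa [point_zero, edgeEval_zero] at this
  have huL : ∀ e, u e (G.length e) = conj (A.phase e) * val (G.tgt e) := fun e => by
    have := hev e (D.m + 1) le_rfl
    rwa [point_last, edgeEval_last] at this
  have hends : ∀ e, f e 0 = val (G.src e) ∧ f e (G.length e) = val (G.tgt e) := by
    intro e
    constructor
    · rw [hfx e 0 (h0 e), magneticPhase_zero, one_mul, hu0]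
    · rw [hfx e _ (hLm e), huL, show magneticPhase (A.A e) (G.length e) = A.phase e from rfl]
      linear_combination val (G.tgt e) * hphase e
  have hmem : f ∈ eigenspace A μ := by
    refine ⟨fun e t ht => Set.indicator_of_notMem ht _, f', f'', D',
      fun e => ⟨(h1 e).1, fun t ht => ?_⟩, h2, fun e => ⟨(h3 e).1, fun t ht => ?_⟩,
      ⟨val, hends, fun w hw => ?_, fun w hw => ?_⟩, fun e => ?_⟩
    · rw [hfx e t ht, hfx e 0 (h0 e)]; exact (h1 e).2 t ht
    · rw [hDx e t ht, hDx e 0 (h0 e)]; exact (h3 e).2 t ht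
    · simp only [hval]; rw [D.vertexNode_of_mem hw, eval_none]
    -- Testing with the indicator of the vertex `w` isolates the `δ`-condition at `w`.
    · have hb := D.form_eq_boundary hμ hsol hev (Pi.single (Node.vtx w hw) 1)
      rw [(D.op_eq_zero_iff μ _ x).1 hx] at hb
      have hy : ∀ a, D.eval (D.vertexNode a) (Pi.single (Node.vtx w hw) 1) =
          if a = w then 1 else 0 := by
        intro a
        by_cases ha : a ∈ G.dirichlet
        · have : a ≠ w := fun h => hw (h ▸ ha)
          rw [D.vertexNode_of_mem ha, eval_none, if_neg this]
        · rw [D.vertexNode_of_notMem ha, eval_some, Pi.single_apply]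
          simp
      have hs := G.sum_vertices (fun a => if a = w then 1 else 0)
        (fun e => covDeriv A f f' e 0) (fun e => covDeriv A f f' e (G.length e))
      have e1 : ∑ e, (conj (D.edgeEval A.phase e (D.m + 1) (Pi.single (Node.vtx w hw) 1)) *
          v e (G.length e) - conj (D.edgeEval A.phase e 0 (Pi.single (Node.vtx w hw) 1)) *
          v e 0) = ∑ e, ((if G.tgt e = w then 1 else 0) * covDeriv A f f' e (G.length e) -
            (if G.src e = w then 1 else 0) * covDeriv A f f' e 0) := by
        refine Finset.sum_congr rfl fun e _ => ?_
        rw [edgeEval_zero, edgeEval_last, hy, hy, hDx e 0 (h0 e), hDx e _ (hLm e),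
          magneticPhase_zero, one_mul, map_mul, Complex.conj_conj, apply_ite conj, apply_ite conj,
          map_one, map_zero, show magneticPhase (A.A e) (G.length e) = A.phase e from rfl]
        ring
      rw [e1, hs] at hb
      simp only [hy, apply_ite conj, map_one, map_zero, ite_mul, one_mul, zero_mul, mul_ite,
        mul_zero, Finset.sum_ite_eq', Finset.mem_univ, if_true] at hb
      linear_combination hb
    · filter_upwards [ae_restrict_mem measurableSet_Icc] with t ht
      have := heq e t
      rw [← hDx e t ht, ← hfx e t ht] at this
      exact this
  refine ⟨f, hmem, ?_⟩
  ext w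
  rcases w with ⟨a, ha⟩ | ⟨e, j⟩
  · rw [D.sample_vtx hends, hval]
    simp only
    rw [D.vertexNode_of_notMem ha, eval_some]
  · have hk : (j : ℕ) + 1 ≤ D.m + 1 := by lia
    rw [sample_inner, hfx e _ (D.point_mem e hk), hev e _ hk, edgeEval_inner]
    linear_combination (x (Node.inner e j)) *
      conj_mul_self_of_norm (norm_magneticPhase (A.A e) (D.point e (j + 1)))

theorem rank_eigenspace (hinc : ∀ v, ∃ e, G.src e = v ∨ G.tgt e = v) (A : G.MagneticPotential)
    (hμ : μ ≤ D.M) : Module.rank ℂ (eigenspace A μ) =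
      Module.finrank ℂ (LinearMap.ker (D.op μ A.phase)) := by
  set R : eigenspace A μ →ₗ[ℂ] LinearMap.ker (D.op μ A.phase) :=
    (D.sample hinc A).restrict fun f hf => (D.sample_mem_ker (hinc := hinc) hμ hf).1
  have hinj : Function.Injective R := by
    rw [← LinearMap.ker_eq_bot, LinearMap.ker_eq_bot']
    intro f hf
    ext1
    exact D.sample_injOn (hinc := hinc) hμ f.2 (congrArg Subtype.val hf)
  have hsurj : Function.Surjective R := by
    rintro ⟨x, hx⟩
    obtain ⟨f, hf, hfx⟩ := D.exists_sample_eq (hinc := hinc) hμ hx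
    exact ⟨⟨f, hf⟩, Subtype.ext hfx⟩
  have := (LinearEquiv.ofBijective R ⟨hinj, hsurj⟩).lift_rank_eq
  rw [← Module.finrank_eq_rank ℂ (LinearMap.ker (D.op μ A.phase)), Cardinal.lift_natCast,
    Cardinal.lift_eq_nat_iff] at this
  exact this

end Discretization

end QuantumGraph

/-! ### Independence of the eigenspaces -/

theorem HasIntegralDeriv.sum {F ι : Type*} [NormedAddCommGroup F] [NormedSpace ℝ F] {L : ℝ}
    {f g : ι → ℝ → F} (s : Finset ι) (h : ∀ i ∈ s, HasIntegralDeriv L (f i) (g i)) :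
    HasIntegralDeriv L (fun x => ∑ i ∈ s, f i x) (fun x => ∑ i ∈ s, g i x) := by
  classical
  induction s using Finset.induction_on with
  | empty =>
    simp only [Finset.sum_empty]
    exact ⟨intervalIntegrable_const, fun x _ => by simp⟩
  | insert a s ha ih =>
    simp only [Finset.sum_insert ha]
    exact (h a (Finset.mem_insert_self a s)).add
      (ih fun i hi => h i (Finset.mem_insert_of_mem hi))

theorem HasIntegralDeriv.eqOn_zero {L : ℝ} (hL : 0 < L) {f g : ℝ → ℂ}
    (h : HasIntegralDeriv L f g) (hf : ∀ x ∈ Set.Icc 0 L, f x = 0)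
    (hg : ContinuousOn g (Set.Icc 0 L)) : ∀ x ∈ Set.Icc 0 L, g x = 0 := by
  set B : ℝ → ℂ := Set.IccExtend hL.le ((Set.Icc 0 L).domRestrict g) with hB
  have hBc : Continuous B := (continuousOn_iff_continuous_domRestrict.1 hg).Icc_extend'
  have hBg : ∀ x ∈ Set.Icc 0 L, B x = g x := fun x hx => by
    rw [hB, Set.IccExtend_of_mem hL.le _ hx]; rfl
  have hI : ∀ x ∈ Set.Icc 0 L, ∫ t in (0 : ℝ)..x, B t = 0 := by
    intro x hx
    have e1 : ∫ t in (0 : ℝ)..x, B t = ∫ t in (0 : ℝ)..x, g t := by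
      refine intervalIntegral.integral_congr fun t ht => hBg t ?_
      rw [Set.uIcc_of_le hx.1] at ht
      exact ⟨ht.1, ht.2.trans hx.2⟩
    have := h.2 x hx
    rw [hf x hx, hf 0 ⟨le_rfl, hL.le⟩, zero_add] at this
    rw [e1, ← this]
  have hIoo : Set.EqOn B (fun _ => 0) (Set.Ioo 0 L) := by
    intro x hx
    have h1 : HasDerivAt (fun x => ∫ t in (0 : ℝ)..x, B t) (B x) x :=
      intervalIntegral.integral_hasDerivAt_right (hBc.intervalIntegrable _ _)
        hBc.aestronglyMeasurable.stronglyMeasurableAtFilter hBc.continuousAt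
    have h2 : HasDerivAt (fun x => ∫ t in (0 : ℝ)..x, B t) 0 x := by
      refine (hasDerivAt_const x (0 : ℂ)).congr_of_eventuallyEq ?_
      filter_upwards [isOpen_Ioo.mem_nhds hx] with y hy
      exact hI y ⟨hy.1.le, hy.2.le⟩
    exact h1.unique h2
  have := hIoo.closure hBc continuous_const
  rw [closure_Ioo hL.ne] at this
  intro x hx
  rw [← hBg x hx]
  exact this hx

namespace QuantumGraph

open ComplexConjugate

variable {V E : Type*} [DecidableEq V] [Fintype E]

theorem exists_isComplexSolution {G : QuantumGraph V E} {A : G.MagneticPotential} {μ : ℝ}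
    {f : E → ℝ → ℂ} (hf : f ∈ eigenspace A μ) (e : E) :
    ∃ v, IsComplexSolution (G.length e) (G.q e) μ
      (fun x => conj (magneticPhase (A.A e) x) * f e x) v := by
  obtain ⟨-, f', f'', D', h1, -, h3, -, heq⟩ := hf
  exact ⟨_, isComplexSolution_conj_magneticPhase_mul (G.length_pos e).le (A.continuousOn e)
    (fun x => rfl) ((h1 e).hasIntegralDeriv (G.length_pos e).le)
    ((h3 e).hasIntegralDeriv (G.length_pos e).le) (heq e)⟩

/-- This is the operator applied to a vanishing sum. In the gauge without potential the derivatives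
of the sum vanish in succession, and in the second one the terms with `q` cancel, leaving the sum
weighted by the eigenvalues. -/
theorem sum_smul_eq_zero {G : QuantumGraph V E} {A : G.MagneticPotential} {s : Finset ℝ}
    {f : ℝ → E → ℝ → ℂ} (hf : ∀ ν ∈ s, f ν ∈ eigenspace A ν) (h0 : ∑ ν ∈ s, f ν = 0) :
    ∑ ν ∈ s, (ν : ℂ) • f ν = 0 := by
  funext e x
  have h0' : ∀ x, ∑ ν ∈ s, f ν e x = 0 := fun x => by
    have := congrFun (congrFun h0 e) x
    simpa [Finset.sum_apply] using this
  simp only [Finset.sum_apply, Pi.smul_apply, smul_eq_mul, Pi.zero_apply]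
  by_cases hx : x ∈ Set.Icc 0 (G.length e)
  swap
  · exact Finset.sum_eq_zero fun ν hν => by rw [(hf ν hν).1 e x hx, mul_zero]
  have hL := G.length_pos e
  have hex : ∀ ν, ∃ v, ν ∈ s → IsComplexSolution (G.length e) (G.q e) ν
      (fun x => conj (magneticPhase (A.A e) x) * f ν e x) v := fun ν => by
    by_cases hν : ν ∈ s
    · obtain ⟨v, hv⟩ := exists_isComplexSolution (hf ν hν) e
      exact ⟨v, fun _ => hv⟩
    · exact ⟨0, fun h => absurd h hν⟩
  choose v hv using hex
  have d1 := HasIntegralDeriv.sum s fun ν hν => (isComplexSolution_iff.1 (hv ν hν)).1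
  have d2 := HasIntegralDeriv.sum s fun ν hν => (isComplexSolution_iff.1 (hv ν hν)).2
  have z0 : ∀ x, ∑ ν ∈ s, conj (magneticPhase (A.A e) x) * f ν e x = 0 := fun x => by
    rw [← Finset.mul_sum, h0', mul_zero]
  have z1 := d1.eqOn_zero hL (fun x _ => z0 x)
    (continuousOn_finsetSum s fun ν hν => (hv ν hν).continuousOn.2)
  have e2 : (fun t => ∑ ν ∈ s, ((G.q e t - ν : ℝ) : ℂ) *
      (conj (magneticPhase (A.A e) t) * f ν e t)) =
      fun t => -∑ ν ∈ s, (ν : ℂ) * (conj (magneticPhase (A.A e) t) * f ν e t) := by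
    funext t
    have := z0 t
    push_cast
    simp only [sub_mul, Finset.sum_sub_distrib, ← Finset.mul_sum _ _ (G.q e t : ℂ), this]
    ring
  rw [e2] at d2
  have z2 := d2.eqOn_zero hL z1 (ContinuousOn.neg (continuousOn_finsetSum s fun ν hν =>
    continuousOn_const.mul (hv ν hν).continuousOn.1)) x hx
  have z3 : conj (magneticPhase (A.A e) x) * ∑ ν ∈ s, (ν : ℂ) * f ν e x = 0 := by
    rw [Finset.mul_sum, ← neg_eq_zero, ← z2]
    congr 1
    exact Finset.sum_congr rfl fun ν _ => by ring
  refine (mul_eq_zero.1 z3).resolve_left fun h => ?_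
  have := norm_magneticPhase (A.A e) x
  rw [← RCLike.norm_conj, h, norm_zero] at this
  exact zero_ne_one this

theorem iSupIndep_eigenspace {G : QuantumGraph V E} (A : G.MagneticPotential) :
    iSupIndep fun ν : ℝ => eigenspace A ν := by
  classical
  rw [iSupIndep_iff_finsetSum_eq_zero_imp_eq_zero]
  intro s
  induction s using Finset.induction_on with
  | empty => simp
  | insert μ s hμ ih =>
    intro f hf h0
    have h1 := sum_smul_eq_zero (A := A) hf h0
    rw [Finset.sum_insert hμ] at h0 h1
    have h2 : ∀ ν ∈ s, ((ν : ℂ) - μ) • f ν = 0 := by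
      refine ih (fun ν => ((ν : ℂ) - μ) • f ν)
        (fun ν hν => Submodule.smul_mem _ _ (hf ν (Finset.mem_insert_of_mem hν))) ?_
      simp only [sub_smul, Finset.sum_sub_distrib, ← Finset.smul_sum]
      have := congrArg ((μ : ℂ) • ·) h0
      simp only [smul_add, smul_zero] at this
      rw [← h1] at this
      rw [sub_eq_zero]
      exact (add_left_cancel this).symm
    have h3 : ∀ ν ∈ s, f ν = 0 := by
      intro ν hν
      refine (smul_eq_zero.1 (h2 ν hν)).resolve_left fun h => hμ ?_
      have : ν = μ := by exact_mod_cast sub_eq_zero.1 h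
      rwa [← this]
    intro ν hν
    rcases Finset.mem_insert.1 hν with rfl | hν
    · rwa [Finset.sum_eq_zero h3, add_zero] at h0
    · exact h3 ν hν

theorem IsNthEigenvalue.unique {G : QuantumGraph V E} {A : G.MagneticPotential} {n : ℕ}
    {μ μ' : ℝ} (h : IsNthEigenvalue A n μ) (h' : IsNthEigenvalue A n μ') : μ = μ' := by
  have key : ∀ {μ μ'}, IsNthEigenvalue A n μ → IsNthEigenvalue A n μ' → ¬μ < μ' := by
    intro μ μ' h h' hlt
    refine absurd (h.2.trans (Submodule.rank_mono ?_)) (not_le.2 h'.1)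
    exact biSup_mono fun ν hν => lt_of_le_of_lt hν hlt
  exact le_antisymm (not_lt.1 (key h' h)) (not_lt.1 (key h h'))

/-! ### Counting eigenvalues with the discretization -/

namespace Discretization

variable [Fintype V] {G : QuantumGraph V E} (D : G.Discretization) {μ : ℝ} {z : E → ℂ}

theorem isNthEigenvalue_iff (hinc : ∀ v, ∃ e, G.src e = v ∨ G.tgt e = v)
    (A : G.MagneticPotential) {n : ℕ} (hμ : μ ≤ D.M) :
    IsNthEigenvalue A n μ ↔ D.index μ A.phase < n ∧
      n ≤ D.index μ A.phase + Module.finrank ℂ (LinearMap.ker (D.op μ A.phase)) := by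
  have hfl := D.isSpectralFlow hinc A.norm_phase
  have h1 := hfl.rank_Iio_eq (iSupIndep_eigenspace A)
    (fun μ hμ => D.rank_eigenspace hinc A hμ) hμ
  rw [IsNthEigenvalue, IsSpectralFlow.rank_Iic_eq (iSupIndep_eigenspace A), h1,
    D.rank_eigenspace hinc A hμ]
  norm_cast

theorem exists_isNthEigenvalue (hinc : ∀ v, ∃ e, G.src e = v ∨ G.tgt e = v)
    (A : G.MagneticPotential) {n : ℕ} (hn : 0 < n) (hM : n ≤ D.index D.M A.phase) :
    ∃ μ < D.M, IsNthEigenvalue A n μ := by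
  obtain ⟨ν, hν, h⟩ := (D.isSpectralFlow hinc A.norm_phase).exists_crossing le_rfl hn hM
  exact ⟨ν, hν, (D.isNthEigenvalue_iff hinc A hν.le).2 h⟩

/-- Independent test functions supported near alternate nodes of the edge `e`. -/
theorem le_index {e : E} {n : ℕ} (hn : 2 * n ≤ D.m)
    (hM : D.Q + 3 / (G.length e / (D.m + 1)) ^ 2 < D.M) (z : E → ℂ) :
    n ≤ D.index D.M z := by
  classical
  set ℓ := G.length e / (D.m + 1) with hℓ
  have hℓ0 : 0 < ℓ := D.step_pos e
  -- The common upper bound from `coefLeft_le` and `coefRight_le`; the hypothesis on `D.M` is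
  -- exactly that it is negative.
  set c := 1 / ℓ + (D.Q - D.M) * (ℓ / 3) with hc
  have hc0 : c < 0 := by
    have : (D.Q + 3 / ℓ ^ 2 - D.M) * (ℓ / 3) < 0 :=
      mul_neg_of_neg_of_pos (by linarith) (by positivity)
    have e1 : (D.Q + 3 / ℓ ^ 2 - D.M) * (ℓ / 3) = c := by rw [hc]; field_simp; ring
    rwa [e1] at this
  -- The coordinate `i` sits at the point number `2 i + 1`, whose inner index is `2 i`. Points with
  -- even numbers carry zero, so every piece has a zero end and the mixed terms drop out.
  set T : (Fin n → ℂ) →ₗ[ℝ] (D.Node → ℂ) :=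
    { toFun := fun a w => match w with
        | .vtx _ _ => 0
        | .inner e' j => if h : e' = e ∧ (j : ℕ) % 2 = 0 ∧ (j : ℕ) / 2 < n then a ⟨(j : ℕ) / 2, h.2.2⟩ else 0
      map_add' := fun a b => by
        ext w; rcases w with ⟨v, hv⟩ | ⟨e', j⟩
        · simp
        · simp only [Pi.add_apply]; split_ifs <;> simp
      map_smul' := fun r a => by
        ext w; rcases w with ⟨v, hv⟩ | ⟨e', j⟩
        · simp
        · simp only [Pi.smul_apply, RingHom.id_apply]; split_ifs <;> simp } with hT
  have hv : ∀ a v, D.eval (D.vertexNode v) (T a) = 0 := by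
    intro a v
    rw [vertexNode]; split_ifs <;> simp [hT]
  have hnode : ∀ a e' k, (e' ≠ e ∨ k % 2 = 0) → D.eval (D.node e' k) (T a) = 0 := by
    intro a e' k hk
    rw [node]
    split_ifs with h0 h1
    · exact hv a _
    · simp only [eval_some, hT, LinearMap.coe_mk, AddHom.coe_mk]
      rw [dif_neg]
      rintro ⟨rfl, h2, -⟩
      rcases hk with hk | hk
      · exact hk rfl
      · lia
    · exact hv a _
  have hev : ∀ a e' k, (e' ≠ e ∨ k % 2 = 0) → D.edgeEval z e' k (T a) = 0 := fun a e' k hk => by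
    rw [edgeEval_apply, hnode a e' k hk, mul_zero]
  have hin : ∀ a (i : Fin n), D.edgeEval z e (2 * i + 1) (T a) = a i := by
    intro a i
    have hi : 2 * (i : ℕ) < D.m := by lia
    have := D.edgeEval_inner z e ⟨2 * i, hi⟩ (T a)
    rw [this]
    simp only [hT, LinearMap.coe_mk, AddHom.coe_mk]
    rw [dif_pos ⟨trivial, by simp, by simp⟩]
    congr 1
    ext
    simp
  have hneg : ∀ a, a ≠ 0 → D.quad D.M z (T a) < 0 := by
    intro a ha
    rw [quad_eq_sum]
    simp only [hv, map_zero, mul_zero, Finset.sum_const_zero, add_zero]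
    rw [Finset.sum_eq_single e (fun e' _ he => Finset.sum_eq_zero fun k _ => by
      rw [hev a e' k (Or.inl he), hev a e' (k + 1) (Or.inl he)]
      simp [FundamentalSystem.pieceForm]) (by simp)]
    set X : ℕ → ℂ := fun k => D.edgeEval z e k (T a) with hX
    have hle : ∀ k ∈ Finset.range (D.m + 1),
        (D.F e).pieceForm D.M (D.point e k) (D.point e (k + 1)) (X k).re (X (k + 1)).re +
        (D.F e).pieceForm D.M (D.point e k) (D.point e (k + 1)) (X k).im (X (k + 1)).im ≤
        c * (Complex.normSq (X k) + Complex.normSq (X (k + 1))) := by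
      intro k hk
      have hk' : k ≤ D.m := by simpa [Nat.lt_succ_iff] using hk
      have h1 := (D.F e).coefLeft_le (D.isShort le_rfl e hk') (D.isPotential e)
      have h2 := (D.F e).coefRight_le (D.isShort le_rfl e hk') (D.isPotential e)
      rw [point_succ_sub, ← hℓ, ← hc] at h1 h2
      simp only [FundamentalSystem.pieceForm, Complex.normSq_apply]
      have hz : X k = 0 ∨ X (k + 1) = 0 := by
        rcases Nat.even_or_odd k with hk2 | hk2
        · exact Or.inl (hev a e k (Or.inr (Nat.even_iff.1 hk2)))
        · refine Or.inr (hev a e (k + 1) (Or.inr ?_))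
          have := Nat.odd_iff.1 hk2
          lia
      rcases hz with hz | hz <;> rw [hz] <;> simp only [Complex.zero_re, Complex.zero_im]
      · nlinarith [mul_le_mul_of_nonneg_right h2 (mul_self_nonneg (X (k + 1)).re),
          mul_le_mul_of_nonneg_right h2 (mul_self_nonneg (X (k + 1)).im)]
      · nlinarith [mul_le_mul_of_nonneg_right h1 (mul_self_nonneg (X k).re),
          mul_le_mul_of_nonneg_right h1 (mul_self_nonneg (X k).im)]
    refine lt_of_le_of_lt (Finset.sum_le_sum hle) ?_
    rw [← Finset.mul_sum]
    refine mul_neg_of_neg_of_pos hc0 ?_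
    obtain ⟨i, hi⟩ := Function.ne_iff.1 ha
    refine Finset.sum_pos' (fun k _ => add_nonneg (Complex.normSq_nonneg _)
      (Complex.normSq_nonneg _)) ⟨2 * i + 1, Finset.mem_range.2 (by lia), ?_⟩
    refine add_pos_of_pos_of_nonneg (Complex.normSq_pos.2 ?_) (Complex.normSq_nonneg _)
    rw [hX]; simp only
    rw [hin]; exact hi
  have hinj : Function.Injective T := by
    rw [← LinearMap.ker_eq_bot, LinearMap.ker_eq_bot']
    intro a h0
    by_contra ha
    have := hneg a ha
    rw [h0, map_zero] at this
    exact lt_irrefl _ this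
  have hdef : ((-D.quad D.M z).restrict (LinearMap.range T)).PosDef := by
    rintro ⟨_, a, rfl⟩ h
    rw [QuadraticMap.restrict_apply, neg_apply]
    have := hneg a fun h0 => h (by ext1; simp [h0])
    simpa using this
  have := le_sigNeg_of_negDef _ hdef
  rw [LinearMap.finrank_range_of_inj hinj, Module.finrank_pi_fintype] at this
  simp only [Complex.finrank_real_complex, Finset.sum_const, Finset.card_univ, Fintype.card_fin,
    smul_eq_mul] at this
  rw [index]
  lia

end Discretization

/-- All sufficiently fine subdivisions carry a discretization that sees the first `n`
eigenvalues. -/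
theorem eventually_exists_discretization [Fintype V] (G : QuantumGraph V E) [Nonempty E]
    (n : ℕ) (lam : ℝ) :
    ∀ᶠ m : ℕ in atTop, ∃ D : G.Discretization, D.m = m ∧ lam < D.M ∧
      ∀ z, n ≤ D.index D.M z := by
  choose Q hQ using fun e => (G.q_piecewiseContinuous e).exists_isPotential (G.length_pos e)
  obtain ⟨e₁, he₁⟩ := Finite.exists_max Q
  obtain ⟨e₀, he₀⟩ := Finite.exists_max G.length
  have hQ' : ∀ e, IsPotential (G.length e) (Q e₁) (G.q e) := fun e =>
    ⟨(hQ e).pos, (hQ e₁).nonneg, fun x hx => ((hQ e).bound x hx).trans (he₁ e),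
      (hQ e).integrable⟩
  have hF := fun e => (hQ' e).nonempty_fundamentalSystem
  have htend : Tendsto (fun m : ℕ => (G.length e₀ / ((m : ℝ) + 1)) ^ 2) atTop (𝓝 0) := by
    have h1 : Tendsto (fun m : ℕ => G.length e₀ * (1 / ((m : ℝ) + 1))) atTop (𝓝 0) := by
      simpa using tendsto_one_div_add_atTop_nhds_zero_nat.const_mul (G.length e₀)
    have := h1.pow 2
    simp only [ne_eq, OfNat.ofNat_ne_zero, not_false_eq_true, zero_pow] at this
    refine this.congr fun m => ?_
    rw [mul_one_div]
  have t1 : ∀ᶠ m : ℕ in atTop, Q e₁ * (G.length e₀ / ((m : ℝ) + 1)) ^ 2 < 1 := by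
    have := htend.const_mul (Q e₁)
    rw [mul_zero] at this
    exact this.eventually_lt_const one_pos
  have t2 : ∀ᶠ m : ℕ in atTop, lam * (G.length e₀ / ((m : ℝ) + 1)) ^ 2 < 4 := by
    have := htend.const_mul lam
    rw [mul_zero] at this
    exact this.eventually_lt_const (by norm_num)
  filter_upwards [t1, t2, eventually_ge_atTop (2 * n)] with m h1 h2 h3
  set ℓ := G.length e₀ / ((m : ℝ) + 1) with hℓ
  have hℓ0 : 0 < ℓ := div_pos (G.length_pos e₀) (by positivity)
  have hM : 4 / ℓ ^ 2 * ℓ ^ 2 = 4 := by field_simp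
  -- With `M = 4 / ℓ²` for the largest piece length `ℓ`, the bound `Q ℓ² < 1` yields both shortness,
  -- `(Q + M) ℓ² < 5 < 8`, and `Q + 3 / ℓ² < M`, the condition of `le_index`.
  refine ⟨⟨m, Q e₁, 4 / ℓ ^ 2, hQ', fun e => (hF e).some, fun e => ?_⟩, rfl, ?_, fun z => ?_⟩
  · have hle : (G.length e / ((m : ℝ) + 1)) ^ 2 ≤ ℓ ^ 2 := by
      have := (G.length_pos e).le
      rw [hℓ]
      gcongr
      exact he₀ e
    have h0 : 0 ≤ Q e₁ + 4 / ℓ ^ 2 := add_nonneg (hQ e₁).nonneg (by positivity)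
    have := mul_le_mul_of_nonneg_left hle h0
    linarith [add_mul (Q e₁) (4 / ℓ ^ 2) (ℓ ^ 2)]
  · simp only
    rw [lt_div_iff₀ (by positivity)]
    exact h2
  · refine Discretization.le_index _ (e := e₀) h3 ?_ z
    simp only
    rw [← hℓ, ← lt_sub_iff_add_lt, ← sub_div, lt_div_iff₀ (by positivity)]
    linarith

end QuantumGraph

/-! ### Fluxes and gauge equivalence -/

namespace QuantumGraph

open ComplexConjugate

variable {V E : Type*} [DecidableEq V] [Fintype E] {G : QuantumGraph V E}

theorem IsWalk.lift_eq {M : Type*} [CommGroup M] {c : E → M} {g : V → M}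
    (h : ∀ e, g (G.tgt e) = g (G.src e) * c e) {w : List (E × Bool)} {u v : V}
    (hw : G.IsWalk u w v) : g v = g u * FreeGroup.lift c (FreeGroup.mk w) := by
  induction w generalizing u with
  | nil => cases hw; simp [FreeGroup.lift_mk]
  | cons p w ih =>
    obtain ⟨e, _ | _⟩ := p
    · obtain ⟨rfl, hw⟩ := hw
      have := ih hw
      rw [FreeGroup.lift_mk] at this ⊢
      rw [this, h e]
      simp [mul_assoc]
    · obtain ⟨rfl, hw⟩ := hw
      have := ih hw
      rw [FreeGroup.lift_mk] at this ⊢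
      rw [this, h e]
      simp [mul_assoc]

/-- A cochain that is trivial on the fundamental group is a coboundary, and conversely. -/
theorem Connected.lift_eq_one_iff (hG : G.Connected) (v₀ : V) {M : Type*} [CommGroup M]
    (c : E → M) : (∀ γ ∈ G.fundamentalGroup v₀, FreeGroup.lift c γ = 1) ↔
      ∃ g : V → M, ∀ e, g (G.tgt e) = g (G.src e) * c e := by
  constructor
  · intro h
    choose w hw using fun v => hG.2 v₀ v
    -- The potential at `v` is the holonomy along a chosen walk from `v₀`; closing up with an edge
    -- gives a closed walk at `v₀`, on which `c` is trivial.
    refine ⟨fun v => FreeGroup.lift c (FreeGroup.mk (w v)), fun e => ?_⟩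
    have hwalk : G.IsWalk v₀ (w (G.src e) ++ [(e, true)] ++ FreeGroup.invRev (w (G.tgt e))) v₀ :=
      ((hw (G.src e)).append (show G.IsWalk (G.src e) [(e, true)] (G.tgt e) from
        ⟨rfl, rfl⟩)).append (hw (G.tgt e)).invRev
    have := h _ ⟨_, hwalk, rfl⟩
    rw [← FreeGroup.mul_mk, ← FreeGroup.mul_mk, ← FreeGroup.inv_mk, map_mul, map_mul, map_inv,
      mul_inv_eq_one] at this
    simp only [← this]
    simp [FreeGroup.lift_mk]
  · rintro ⟨g, hg⟩ _ ⟨w, hw, rfl⟩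
    have := hw.lift_eq hg
    exact (mul_eq_left.1 this.symm)

theorem lift_eq_one_iff_of_closure {v₀ : V} {k : ℕ} {σ : Fin k → FreeGroup E}
    (hσ : Subgroup.closure (Set.range σ) = G.fundamentalGroup v₀) {M : Type*} [CommGroup M]
    (c : E → M) : (∀ γ ∈ G.fundamentalGroup v₀, FreeGroup.lift c γ = 1) ↔
      ∀ j, FreeGroup.lift c (σ j) = 1 := by
  rw [← hσ]
  constructor
  · exact fun h j => h _ (Subgroup.subset_closure ⟨j, rfl⟩)
  · intro h
    have : Subgroup.closure (Set.range σ) ≤ (FreeGroup.lift c).ker := by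
      rw [Subgroup.closure_le]
      rintro _ ⟨j, rfl⟩
      exact h j
    exact fun γ hγ => this hγ

/-- The flux of a cochain through the closed walks `σ`. -/
def cochainFlux {k : ℕ} (σ : Fin k → FreeGroup E) : (E → ℝ) →ₗ[ℝ] (Fin k → ℝ) where
  toFun c j := (FreeGroup.lift (fun e => Multiplicative.ofAdd (c e)) (σ j)).toAdd
  map_add' c c' := by
    have : FreeGroup.lift (fun e => Multiplicative.ofAdd ((c + c') e)) =
        FreeGroup.lift (fun e => Multiplicative.ofAdd (c e)) *
          FreeGroup.lift (fun e => Multiplicative.ofAdd (c' e)) := by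
      ext e; simp
    ext j
    rw [this]
    simp
  map_smul' r c := by
    have : FreeGroup.lift (fun e => Multiplicative.ofAdd ((r • c) e)) =
        (AddMonoidHom.toMultiplicative (AddMonoidHom.mulLeft r)).comp
          (FreeGroup.lift (fun e => Multiplicative.ofAdd (c e))) := by
      ext e; simp
    ext j
    rw [this]
    simp

theorem flux_eq_cochainFlux {k : ℕ} (σ : Fin k → FreeGroup E) (A : G.MagneticPotential)
    (j : Fin k) : flux A (σ j) =
      cochainFlux σ (fun e => ∫ x in (0 : ℝ)..G.length e, A.A e x) j := rfl

theorem cochainFlux_eq_zero_iff (hG : G.Connected) {v₀ : V} {k : ℕ} {σ : Fin k → FreeGroup E}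
    (hσ : Subgroup.closure (Set.range σ) = G.fundamentalGroup v₀) (c : E → ℝ) :
    cochainFlux σ c = 0 ↔ ∃ g : V → ℝ, ∀ e, c e = g (G.tgt e) - g (G.src e) := by
  have h1 : cochainFlux σ c = 0 ↔
      ∀ j, FreeGroup.lift (fun e => Multiplicative.ofAdd (c e)) (σ j) = 1 := by
    rw [funext_iff]; rfl
  rw [h1, ← lift_eq_one_iff_of_closure hσ, hG.lift_eq_one_iff v₀]
  constructor
  · rintro ⟨g, hg⟩
    refine ⟨fun v => (g v).toAdd, fun e => ?_⟩
    simp [hg e]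
  · rintro ⟨g, hg⟩
    refine ⟨fun v => Multiplicative.ofAdd (g v), fun e => ?_⟩
    rw [← ofAdd_add, hg e]; simp

/-- Potentials whose fluxes agree modulo `2π` have gauge equivalent phases. -/
theorem exists_gauge (hG : G.Connected) {v₀ : V} {k : ℕ} {σ : Fin k → FreeGroup E}
    (hσ : Subgroup.closure (Set.range σ) = G.fundamentalGroup v₀) {c c' : E → ℝ}
    (h : ∀ j, (cochainFlux σ c j : Real.Angle) = (cochainFlux σ c' j : Real.Angle)) :
    ∃ u : V → ℂ, (∀ v, ‖u v‖ = 1) ∧ ∀ e, Complex.exp (Complex.I * c' e) =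
      Complex.exp (Complex.I * c e) * u (G.tgt e) * conj (u (G.src e)) := by
  -- The difference cochain modulo `2π` is trivial on the generators, hence a coboundary with values
  -- in the circle; lifts of its potential to real numbers are the gauge angles.
  set d : E → Multiplicative Real.Angle :=
    fun e => Multiplicative.ofAdd ((c' e - c e : ℝ) : Real.Angle) with hd
  have hd1 : ∀ γ, FreeGroup.lift d γ = Multiplicative.ofAdd
      (((FreeGroup.lift (fun e => Multiplicative.ofAdd (c' e - c e)) γ).toAdd : ℝ) :
        Real.Angle) := by
    intro γ
    have : FreeGroup.lift d = (AddMonoidHom.toMultiplicative Real.Angle.coeHom).comp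
        (FreeGroup.lift (fun e => Multiplicative.ofAdd (c' e - c e))) := by
      ext e; simp [hd]
    rw [this]; rfl
  have h1 : ∀ j, FreeGroup.lift d (σ j) = 1 := by
    intro j
    rw [hd1]
    have e1 : (FreeGroup.lift (fun e => Multiplicative.ofAdd (c' e - c e)) (σ j)).toAdd =
        cochainFlux σ (c' - c) j := rfl
    rw [e1, map_sub, Pi.sub_apply, Real.Angle.coe_sub, h j, sub_self]
    rfl
  rw [← lift_eq_one_iff_of_closure hσ, hG.lift_eq_one_iff v₀] at h1
  obtain ⟨g, hg⟩ := h1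
  choose θ hθ using fun v => QuotientAddGroup.mk_surjective (g v).toAdd
  have hθ' : ∀ v, (θ v : Real.Angle) = (g v).toAdd := hθ
  refine ⟨fun v => Complex.exp (Complex.I * θ v), fun v => ?_, fun e => ?_⟩
  · simp only
    rw [mul_comm, Complex.norm_exp_ofReal_mul_I]
  have e1 : ((θ (G.tgt e) : ℝ) : Real.Angle) = ((θ (G.src e) + (c' e - c e) : ℝ) : Real.Angle) := by
    rw [hθ', hg e, Real.Angle.coe_add, hθ']; rfl
  obtain ⟨n, hn⟩ := Real.Angle.angle_eq_iff_two_pi_dvd_sub.1 e1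
  simp only
  rw [← Complex.exp_conj, ← Complex.exp_add, ← Complex.exp_add, Complex.exp_eq_exp_iff_exists_int]
  refine ⟨-n, ?_⟩
  simp only [map_mul, Complex.conj_I, Complex.conj_ofReal]
  have hn' : (θ (G.tgt e) : ℂ) - (θ (G.src e) + (c' e - c e)) = 2 * Real.pi * n := by
    exact_mod_cast hn
  push_cast
  linear_combination -Complex.I * hn'

theorem Connected.eq_of_src_eq_tgt (hG : G.Connected) {M : Type*} {g : V → M}
    (h : ∀ e, g (G.src e) = g (G.tgt e)) (u v : V) : g u = g v := by
  obtain ⟨w, hw⟩ := hG.2 u v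
  induction w generalizing u with
  | nil => cases hw; rfl
  | cons p w ih =>
    obtain ⟨e, _ | _⟩ := p
    · obtain ⟨rfl, hw⟩ := hw
      rw [← h e]; exact ih _ hw
    · obtain ⟨rfl, hw⟩ := hw
      rw [h e]; exact ih _ hw

/-- A dimension count: the kernel is the space of coboundaries, of dimension `|V| - 1` by
connectedness, so the rank is `|E| - |V| + 1`. -/
theorem cochainFlux_surjective [Fintype V] (hG : G.Connected) {v₀ : V}
    {σ : Fin G.betti → FreeGroup E}
    (hσ : Subgroup.closure (Set.range σ) = G.fundamentalGroup v₀) :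
    Function.Surjective (cochainFlux σ) := by
  set d : (V → ℝ) →ₗ[ℝ] (E → ℝ) := MagneticFamily.coboundary G.src G.tgt with hd
  have hda : ∀ g e, d g e = g (G.tgt e) - g (G.src e) := fun g e => rfl
  have hker : LinearMap.ker (cochainFlux σ) = LinearMap.range d := by
    ext c
    rw [LinearMap.mem_ker, cochainFlux_eq_zero_iff hG hσ, LinearMap.mem_range]
    refine exists_congr fun g => ?_
    rw [funext_iff]
    exact forall_congr' fun e => by rw [hda]; exact eq_comm
  have hconst : Module.finrank ℝ (LinearMap.ker d) = 1 := by
    have : LinearMap.ker d = Submodule.span ℝ {fun _ => (1 : ℝ)} := by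
      ext g
      rw [LinearMap.mem_ker, Submodule.mem_span_singleton]
      constructor
      · intro h
        refine ⟨g v₀, funext fun v => ?_⟩
        have := hG.eq_of_src_eq_tgt (g := g) (fun e => by
          have := congrFun h e
          rw [hda, Pi.zero_apply] at this
          linarith) v₀ v
        simp [this]
      · rintro ⟨r, rfl⟩
        ext e
        simp [hda]
    rw [this]
    exact finrank_span_singleton (fun h => one_ne_zero (congrFun h v₀))
  have r1 := LinearMap.finrank_range_add_finrank_ker d
  have r2 := LinearMap.finrank_range_add_finrank_ker (cochainFlux σ)
  rw [hconst, Module.finrank_pi] at r1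
  rw [hker, Module.finrank_pi] at r2
  rw [← LinearMap.range_eq_top]
  refine Submodule.eq_top_of_finrank_eq ?_
  rw [Module.finrank_pi, Fintype.card_fin]
  change _ = Fintype.card E + 1 - Fintype.card V
  lia

namespace Discretization

variable (D : G.Discretization) {μ : ℝ}

/-- Multiplication by the gauge factors of the vertices. -/
def gaugeMul (u : V → ℂ) (x : D.Node → ℂ) : D.Node → ℂ
  | .vtx v h => u v * x (.vtx v h)
  | .inner e j => u (G.src e) * x (.inner e j)

/-- Inner points are multiplied by the factor of the source vertex, so along an edge only the last
point is out of step, and the change of the edge phase compensates for it. -/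
theorem edgeEval_gaugeMul {u : V → ℂ} (hu : ∀ v, ‖u v‖ = 1) {z z' : E → ℂ}
    (hz : ∀ e, z' e = z e * u (G.tgt e) * conj (u (G.src e))) (x : D.Node → ℂ) (e : E) {k : ℕ}
    (hk : k ≤ D.m + 1) :
    D.edgeEval z' e k (D.gaugeMul u x) = u (G.src e) * D.edgeEval z e k x := by
  have hv : ∀ v, D.eval (D.vertexNode v) (D.gaugeMul u x) = u v * D.eval (D.vertexNode v) x := by
    intro v
    rw [vertexNode]; split_ifs
    · simp
    · rfl
  rcases k with _ | k
  · rw [edgeEval_zero, edgeEval_zero, hv]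
  · rcases Nat.lt_or_ge k D.m with h | h
    · have e1 := D.edgeEval_inner z e ⟨k, h⟩ x
      have e2 := D.edgeEval_inner z' e ⟨k, h⟩ (D.gaugeMul u x)
      rw [e1, e2]; rfl
    · obtain rfl : k = D.m := by lia
      rw [edgeEval_last, edgeEval_last, hv, hz e, map_mul, map_mul, Complex.conj_conj]
      linear_combination (conj (z e) * u (G.src e) * D.eval (D.vertexNode (G.tgt e)) x) *
        conj_mul_self_of_norm (hu (G.tgt e))

variable [Fintype V]

theorem quad_gaugeMul {u : V → ℂ} (hu : ∀ v, ‖u v‖ = 1) {z z' : E → ℂ}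
    (hz : ∀ e, z' e = z e * u (G.tgt e) * conj (u (G.src e))) (x : D.Node → ℂ) :
    D.quad μ z' (D.gaugeMul u x) = D.quad μ z x := by
  rw [quad_apply, quad_apply, pairing_op, pairing_op]
  congr 1
  rw [form, form]
  congr 1
  · refine Finset.sum_congr rfl fun e _ => Finset.sum_congr rfl fun k hk => ?_
    have hk' := Finset.mem_range.1 hk
    rw [D.edgeEval_gaugeMul hu hz x e (by lia), D.edgeEval_gaugeMul hu hz x e (by lia)]
    simp only [map_mul]
    linear_combination (conj (D.edgeEval z e k x) *
        (D.left μ e k * D.edgeEval z e k x - D.mix μ e k * D.edgeEval z e (k + 1) x) +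
      conj (D.edgeEval z e (k + 1) x) *
        (D.right μ e k * D.edgeEval z e (k + 1) x - D.mix μ e k * D.edgeEval z e k x)) *
      conj_mul_self_of_norm (hu (G.src e))
  · refine Finset.sum_congr rfl fun v _ => ?_
    have : D.eval (D.vertexNode v) (D.gaugeMul u x) = u v * D.eval (D.vertexNode v) x := by
      rw [vertexNode]; split_ifs
      · simp
      · rfl
    rw [this, map_mul]
    linear_combination (G.χ v * (conj (D.eval (D.vertexNode v) x) *
      D.eval (D.vertexNode v) x)) * conj_mul_self_of_norm (hu v)

theorem quad_equivalent {u : V → ℂ} (hu : ∀ v, ‖u v‖ = 1) {z z' : E → ℂ}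
    (hz : ∀ e, z' e = z e * u (G.tgt e) * conj (u (G.src e))) :
    (D.quad μ z).Equivalent (D.quad μ z') := by
  have h1 : ∀ v, conj (u v) * u v = 1 := fun v => conj_mul_self_of_norm (hu v)
  refine ⟨⟨{ toFun := D.gaugeMul u
             invFun := D.gaugeMul fun v => conj (u v)
             map_add' := fun x y => ?_
             map_smul' := fun c x => ?_
             left_inv := fun x => ?_
             right_inv := fun x => ?_ }, fun x => D.quad_gaugeMul hu hz x⟩⟩
  · ext w; rcases w with ⟨v, h⟩ | ⟨e, j⟩ <;> simp [gaugeMul, mul_add]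
  · ext w; rcases w with ⟨v, h⟩ | ⟨e, j⟩ <;> simp [gaugeMul, mul_left_comm]
  · ext w; rcases w with ⟨v, h⟩ | ⟨e, j⟩ <;> simp [gaugeMul, ← mul_assoc, h1]
  · ext w
    rcases w with ⟨v, h⟩ | ⟨e, j⟩
    · simp only [gaugeMul]; linear_combination x (.vtx v h) * h1 v
    · simp only [gaugeMul]; linear_combination x (.inner e j) * h1 (G.src e)

theorem index_eq_of_gauge {u : V → ℂ} (hu : ∀ v, ‖u v‖ = 1) {z z' : E → ℂ}
    (hz : ∀ e, z' e = z e * u (G.tgt e) * conj (u (G.src e))) :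
    D.index μ z = D.index μ z' ∧ Module.finrank ℂ (LinearMap.ker (D.op μ z)) =
      Module.finrank ℂ (LinearMap.ker (D.op μ z')) := by
  have h := D.quad_equivalent (μ := μ) hu hz
  refine ⟨by rw [index, index, h.sigNeg_eq], ?_⟩
  have h1 := h.rank_radical_eq
  rw [finrank_radical_quad, finrank_radical_quad] at h1
  lia

end Discretization

end QuantumGraph

/-! ### Cochains on the pieces of a subdivision -/

namespace QuantumGraph

variable {V E : Type*} [DecidableEq V] [Fintype E] {G : QuantumGraph V E}

theorem dirichlet_src {e : E} (h : G.src e ∈ G.dirichlet) :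
    (∀ e', G.src e' = G.src e → e' = e) ∧ ∀ e', G.tgt e' ≠ G.src e := by
  have hd := G.degree_dirichlet _ h
  have h1 : 0 < (Finset.univ.filter fun e' => G.src e' = G.src e).card :=
    Finset.card_pos.2 ⟨e, by simp⟩
  have h2 : (Finset.univ.filter fun e' => G.tgt e' = G.src e).card = 0 := by lia
  have h3 : (Finset.univ.filter fun e' => G.src e' = G.src e).card ≤ 1 := by lia
  constructor
  · intro e' he'
    exact Finset.card_le_one.1 h3 e' (by simpa using he') e (by simp)
  · intro e' he'
    rw [Finset.card_eq_zero, Finset.filter_eq_empty_iff] at h2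
    exact h2 (Finset.mem_univ e') he'

theorem dirichlet_tgt {e : E} (h : G.tgt e ∈ G.dirichlet) :
    (∀ e', G.tgt e' = G.tgt e → e' = e) ∧ ∀ e', G.src e' ≠ G.tgt e := by
  have hd := G.degree_dirichlet _ h
  have h1 : 0 < (Finset.univ.filter fun e' => G.tgt e' = G.tgt e).card :=
    Finset.card_pos.2 ⟨e, by simp⟩
  have h2 : (Finset.univ.filter fun e' => G.src e' = G.tgt e).card = 0 := by lia
  have h3 : (Finset.univ.filter fun e' => G.tgt e' = G.tgt e).card ≤ 1 := by lia
  constructor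
  · intro e' he'
    exact Finset.card_le_one.1 h3 e' (by simpa using he') e (by simp)
  · intro e' he'
    rw [Finset.card_eq_zero, Finset.filter_eq_empty_iff] at h2
    exact h2 (Finset.mem_univ e') he'

namespace Discretization

variable (D : G.Discretization)

/-- The pieces none of whose ends is a Dirichlet vertex. -/
abbrev Piece (D : G.Discretization) : Type _ :=
  {p : E × Fin (D.m + 1) // (D.node p.1 p.2).isSome ∧ (D.node p.1 (p.2 + 1)).isSome}

/-- The left end of a piece. -/
noncomputable def start (p : D.Piece) : D.Node := (D.node p.1.1 p.1.2).get p.2.1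

/-- The right end of a piece. -/
noncomputable def finish (p : D.Piece) : D.Node := (D.node p.1.1 (p.1.2 + 1)).get p.2.2

theorem node_start (p : D.Piece) : D.node p.1.1 p.1.2 = some (D.start p) :=
  (Option.some_get p.2.1).symm

theorem node_finish (p : D.Piece) : D.node p.1.1 (p.1.2 + 1) = some (D.finish p) :=
  (Option.some_get p.2.2).symm

open Classical in
/-- The extension by zero of a function of the pieces. -/
noncomputable def extend {R : Type*} [Zero R] (c : D.Piece → R) (e : E) (k : ℕ) : R :=
  if h : ∃ _ : k < D.m + 1, (D.node e k).isSome ∧ (D.node e (k + 1)).isSome then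
    c ⟨(e, ⟨k, h.1⟩), h.2⟩ else 0

theorem extend_coe {R : Type*} [Zero R] (c : D.Piece → R) (p : D.Piece) :
    D.extend c p.1.1 p.1.2 = c p := by
  rw [extend, dif_pos ⟨p.1.2.2, p.2⟩]

theorem extend_eq_zero {R : Type*} [Zero R] (c : D.Piece → R) {e : E} {k : ℕ}
    (h : D.node e k = none ∨ D.node e (k + 1) = none) : D.extend c e k = 0 := by
  rw [extend, dif_neg]
  rintro ⟨-, h1, h2⟩
  rcases h with h | h
  · simp [h] at h1
  · simp [h] at h2

theorem piece_cases {k : ℕ} (hk : k < D.m + 1) (e : E) :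
    (∃ p : D.Piece, p.1.1 = e ∧ (p.1.2 : ℕ) = k) ∨ D.node e k = none ∨
      D.node e (k + 1) = none := by
  by_cases h : (D.node e k).isSome ∧ (D.node e (k + 1)).isSome
  · exact Or.inl ⟨⟨(e, ⟨k, hk⟩), h⟩, rfl, rfl⟩
  · right
    rw [not_and_or] at h
    simpa using h

/-- Sums over all pieces reduce to sums over the pieces without Dirichlet ends. -/
theorem sum_extend {R : Type*} [AddCommMonoid R] (f : E → ℕ → R)
    (h : ∀ e, ∀ k < D.m + 1, (D.node e k = none ∨ D.node e (k + 1) = none) → f e k = 0) :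
    ∑ e, ∑ k ∈ Finset.range (D.m + 1), f e k = ∑ p : D.Piece, f p.1.1 p.1.2 := by
  have h1 : ∑ e, ∑ k ∈ Finset.range (D.m + 1), f e k =
      ∑ q : E × Fin (D.m + 1), f q.1 q.2 := by
    rw [Fintype.sum_prod_type]
    exact Finset.sum_congr rfl fun e _ => Finset.sum_range _
  rw [h1, ← Finset.sum_subtype (Finset.univ.filter fun q : E × Fin (D.m + 1) =>
    (D.node q.1 q.2).isSome ∧ (D.node q.1 (q.2 + 1)).isSome) (by simp)
    (fun q : E × Fin (D.m + 1) => f q.1 q.2), Finset.sum_filter]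
  refine Finset.sum_congr rfl fun q _ => ?_
  split_ifs with hq
  · rfl
  · refine h q.1 q.2 q.2.2 ?_
    rw [not_and_or] at hq
    simpa using hq

/-- The total of a cochain over each edge. -/
noncomputable def total : (D.Piece → ℝ) →ₗ[ℝ] (E → ℝ) where
  toFun c e := ∑ k ∈ Finset.range (D.m + 1), D.extend c e k
  map_add' c c' := by
    ext e
    rw [Pi.add_apply, ← Finset.sum_add_distrib]
    refine Finset.sum_congr rfl fun k _ => ?_
    simp only [extend]; split_ifs <;> simp
  map_smul' r c := by
    ext e
    rw [Pi.smul_apply, Finset.smul_sum]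
    refine Finset.sum_congr rfl fun k _ => ?_
    simp only [extend]; split_ifs <;> simp

theorem total_apply (c : D.Piece → ℝ) (e : E) :
    D.total c e = ∑ k ∈ Finset.range (D.m + 1), D.extend c e k := rfl

/-- The value at the point number `k` of the edge `e`. -/
noncomputable def pointValue {R : Type*} (a : V → R) (g : D.Node → R) (e : E) (k : ℕ) : R :=
  if k = 0 then a (G.src e)
  else if h : k - 1 < D.m then g (.inner e ⟨k - 1, h⟩) else a (G.tgt e)

theorem pointValue_eq {R : Type*} {a : V → R} {g : D.Node → R}
    (h : ∀ v hv, a v = g (.vtx v hv)) {e : E} {k : ℕ} {w : D.Node} (hw : D.node e k = some w) :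
    D.pointValue a g e k = g w := by
  have hv : ∀ v, D.vertexNode v = some w → a v = g w := by
    intro v hv
    rw [vertexNode] at hv
    split_ifs at hv with hd
    rw [← Option.some_injective _ hv, h v hd]
  rw [node] at hw
  rw [pointValue]
  split_ifs at hw ⊢ with h0 h1
  · exact hv _ hw
  · rw [← Option.some_injective _ hw]
  · exact hv _ hw

theorem node_eq_none {e : E} {k : ℕ} (hk : k ≤ D.m + 1) (h : D.node e k = none) :
    (k = 0 ∧ G.src e ∈ G.dirichlet) ∨ (k = D.m + 1 ∧ G.tgt e ∈ G.dirichlet) := by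
  have hv : ∀ v, D.vertexNode v = none → v ∈ G.dirichlet := by
    intro v hv
    by_contra hd
    rw [D.vertexNode_of_notMem hd] at hv
    simp at hv
  rw [node] at h
  split_ifs at h with h0 h1
  · exact Or.inl ⟨h0, hv _ h⟩
  · exact Or.inr ⟨by lia, hv _ h⟩

/-- The flux of a cochain on the pieces. -/
noncomputable def pieceFlux {k : ℕ} (σ : Fin k → FreeGroup E) :
    (D.Piece → ℝ) →ₗ[ℝ] (Fin k → ℝ) := cochainFlux σ ∘ₗ D.total

open Classical in
theorem exists_potential_of_coboundary (hm : 0 < D.m) (g : D.Node → ℝ) :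
    ∃ a : V → ℝ, ∀ e, D.total (MagneticFamily.coboundary D.start D.finish g) e =
      a (G.tgt e) - a (G.src e) := by
  -- A Dirichlet vertex takes the value of its neighbouring inner node, so that the omitted piece
  -- contributes zero. The vertex has degree one, so the neighbour is unique, and `0 < D.m` provides
  -- it.
  set a : V → ℝ := fun v => if h : v ∈ G.dirichlet then
      (if h : ∃ e, G.src e = v then g (.inner h.choose ⟨0, hm⟩) else
        if h : ∃ e, G.tgt e = v then g (.inner h.choose ⟨D.m - 1, by lia⟩) else 0)
    else g (.vtx v h) with ha
  have ha' : ∀ v hv, a v = g (.vtx v hv) := fun v hv => by simp only [ha]; rw [dif_neg hv]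
  refine ⟨a, fun e => ?_⟩
  have h0 : D.pointValue a g e 0 = a (G.src e) := by simp [pointValue]
  have h1 : D.pointValue a g e (D.m + 1) = a (G.tgt e) := by simp [pointValue]
  rw [total_apply, ← h0, ← h1, ← Finset.sum_range_sub]
  refine Finset.sum_congr rfl fun k hk => ?_
  have hk' := Finset.mem_range.1 hk
  rcases D.piece_cases hk' e with ⟨p, rfl, rfl⟩ | h
  · rw [extend_coe, D.pointValue_eq ha' (D.node_start p), D.pointValue_eq ha' (D.node_finish p)]
    rfl
  · rw [D.extend_eq_zero _ h]
    rcases h with h | h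
    · rcases D.node_eq_none (by lia) h with ⟨rfl, hd⟩ | ⟨h', -⟩
      · have hex : ∃ e', G.src e' = G.src e := ⟨e, rfl⟩
        have e1 : D.pointValue a g e (0 + 1) = g (.inner e ⟨0, hm⟩) := by
          simp [pointValue, hm]
        rw [h0, e1]
        simp only [ha]
        rw [dif_pos hd, dif_pos hex, (dirichlet_src hd).1 _ hex.choose_spec, sub_self]
      · lia
    · rcases D.node_eq_none (by lia) h with ⟨h', -⟩ | ⟨h', hd⟩
      · lia
      · obtain rfl : k = D.m := by lia
        have hex : ∃ e', G.tgt e' = G.tgt e := ⟨e, rfl⟩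
        have hnex : ¬∃ e', G.src e' = G.tgt e := by
          rintro ⟨e', he'⟩
          exact (dirichlet_tgt hd).2 e' he'
        have e1 : D.pointValue a g e D.m = g (.inner e ⟨D.m - 1, by lia⟩) := by
          rw [pointValue, if_neg hm.ne', dif_pos (by lia)]
        rw [h1, e1]
        simp only [ha]
        rw [dif_pos hd, dif_neg hnex, dif_pos hex, (dirichlet_tgt hd).1 _ hex.choose_spec,
          sub_self]

/-- A vertex potential for the edge totals extends to the inner nodes by summing the cochain along
each edge from its source; the total guarantees the right value at the target. -/
theorem pieceFlux_eq_zero_iff (hG : G.Connected) {v₀ : V} {k : ℕ} {σ : Fin k → FreeGroup E}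
    (hσ : Subgroup.closure (Set.range σ) = G.fundamentalGroup v₀) (hm : 0 < D.m)
    (c : D.Piece → ℝ) :
    D.pieceFlux σ c = 0 ↔ ∃ g, c = MagneticFamily.coboundary D.start D.finish g := by
  rw [pieceFlux, LinearMap.comp_apply, cochainFlux_eq_zero_iff hG hσ]
  constructor
  · rintro ⟨a, ha⟩
    set b : E → ℕ → ℝ := fun e k => a (G.src e) + ∑ i ∈ Finset.range k, D.extend c e i with hb
    set g : D.Node → ℝ := fun w => match w with
      | .vtx v _ => a v
      | .inner e j => b e (j + 1) with hg
    have hval : ∀ e, ∀ k ≤ D.m + 1, D.pointValue a g e k = b e k := by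
      intro e k hk
      rw [pointValue]
      split_ifs with h0 h1
      · simp [hb, h0]
      · simp only [hg]
        congr 1
        lia
      · obtain rfl : k = D.m + 1 := by lia
        have := ha e
        rw [total_apply] at this
        simp only [hb]
        linarith
    refine ⟨g, funext fun p => ?_⟩
    have e1 := D.pointValue_eq (a := a) (g := g) (fun v hv => rfl) (D.node_start p)
    have e2 := D.pointValue_eq (a := a) (g := g) (fun v hv => rfl) (D.node_finish p)
    rw [hval _ _ (by lia)] at e1 e2
    change c p = g (D.finish p) - g (D.start p)
    rw [← e1, ← e2]
    simp only [hb]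
    rw [Finset.sum_range_succ, extend_coe]
    ring
  · rintro ⟨g, rfl⟩
    exact D.exists_potential_of_coboundary hm g

/-- The phases of the edges, put on the last pieces. -/
def lastPiece : (E → ℝ) →ₗ[ℝ] (D.Piece → ℝ) where
  toFun θ p := if (p.1.2 : ℕ) = D.m then θ p.1.1 else 0
  map_add' θ θ' := by ext p; simp only [Pi.add_apply]; split_ifs <;> simp
  map_smul' r θ := by ext p; simp only [Pi.smul_apply, RingHom.id_apply]; split_ifs <;> simp

theorem lastPiece_apply (θ : E → ℝ) (p : D.Piece) :
    D.lastPiece θ p = if (p.1.2 : ℕ) = D.m then θ p.1.1 else 0 := rfl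

-- The last piece is missing on an edge that ends at a Dirichlet vertex. Such a vertex has degree
-- one, so the lost cochain is a coboundary supported at it and carries no flux.
open Classical in
theorem pieceFlux_lastPiece (hG : G.Connected) {v₀ : V} {k : ℕ} {σ : Fin k → FreeGroup E}
    (hσ : Subgroup.closure (Set.range σ) = G.fundamentalGroup v₀) (hm : 0 < D.m) (θ : E → ℝ) :
    D.pieceFlux σ (D.lastPiece θ) = cochainFlux σ θ := by
  rw [pieceFlux, LinearMap.comp_apply, ← sub_eq_zero, ← map_sub, cochainFlux_eq_zero_iff hG hσ]
  have htot : ∀ e, D.total (D.lastPiece θ) e = if G.tgt e ∈ G.dirichlet then 0 else θ e := by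
    intro e
    rw [total_apply, Finset.sum_eq_single D.m]
    · split_ifs with hd
      · exact D.extend_eq_zero _ (Or.inr (by rw [node_last, D.vertexNode_of_mem hd]))
      · rcases D.piece_cases (k := D.m) (by lia) e with ⟨p, rfl, hp⟩ | h
        · have := D.extend_coe (D.lastPiece θ) p
          rwa [hp, lastPiece_apply, if_pos hp] at this
        · rcases h with h | h
          · rcases D.node_eq_none (by lia) h with ⟨h', -⟩ | ⟨h', -⟩ <;> lia
          · rw [node_last, D.vertexNode_of_notMem hd] at h
            simp at h
    · intro k hk hkm
      rcases D.piece_cases (Finset.mem_range.1 hk) e with ⟨p, rfl, rfl⟩ | h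
      · rw [extend_coe, lastPiece_apply, if_neg hkm]
      · exact D.extend_eq_zero _ h
    · simp
  refine ⟨fun v => if v ∈ G.dirichlet then -∑ e with G.tgt e = v, θ e else 0, fun e => ?_⟩
  have hsrc : (if G.src e ∈ G.dirichlet then
      -∑ e' with G.tgt e' = G.src e, θ e' else (0 : ℝ)) = 0 := by
    split_ifs with hd
    · rw [Finset.filter_eq_empty_iff.2 fun e' _ => (dirichlet_src hd).2 e']
      simp
    · rfl
  simp only [Pi.sub_apply]
  rw [htot, hsrc]
  split_ifs with hd
  · have : (Finset.univ.filter fun e' => G.tgt e' = G.tgt e) = {e} := by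
      ext e'
      simp only [Finset.mem_filter, Finset.mem_univ, true_and, Finset.mem_singleton]
      exact ⟨fun h => (dirichlet_tgt hd).1 e' h, fun h => by rw [h]⟩
    rw [this, Finset.sum_singleton]
    ring
  · ring

end Discretization

end QuantumGraph

/-! ### Rescaling by the eigenfunction to a magnetic Laplacian -/

namespace QuantumGraph

open ComplexConjugate

namespace Discretization

section Phase

variable {E : Type*}

/-- The phases that belong to a cochain. -/
noncomputable def cochainPhase (θ : E → ℝ) (e : E) : ℂ := Complex.exp (Complex.I * θ e)

theorem norm_cochainPhase (θ : E → ℝ) (e : E) : ‖cochainPhase θ e‖ = 1 := by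
  rw [cochainPhase, mul_comm, Complex.norm_exp_ofReal_mul_I]

theorem cochainPhase_zero : cochainPhase (0 : E → ℝ) = 1 := by
  ext e; simp [cochainPhase]

end Phase

variable {V E : Type*} [DecidableEq V] [Fintype E] {G : QuantumGraph V E} (D : G.Discretization)

/-- Multiplication by a real function. -/
def mulReal (ψ : D.Node → ℝ) : (D.Node → ℂ) →ₗ[ℂ] (D.Node → ℂ) where
  toFun x w := ψ w * x w
  map_add' x y := by ext w; simp [mul_add]
  map_smul' c x := by ext w; simp [mul_left_comm]

theorem eval_mulReal (ψ : D.Node → ℝ) (o : Option D.Node) (x : D.Node → ℂ) :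
    D.eval o (D.mulReal ψ x) = D.eval o (fun w => (ψ w : ℂ)) * D.eval o x := by
  cases o
  · simp
  · rfl

theorem conj_eval_ofReal (ψ : D.Node → ℝ) (o : Option D.Node) :
    conj (D.eval o (fun w => (ψ w : ℂ))) = D.eval o (fun w => (ψ w : ℂ)) := by
  cases o <;> simp

variable [Fintype V] {μ lam : ℝ} {z : E → ℂ}

/-- A linear rate is needed beyond strict decrease, since it makes the derivative in the spectral
parameter nonzero. One piece with a nonzero end value supplies it. -/
theorem exists_quad_le_sub (hinc : ∀ v, ∃ e, G.src e = v ∨ G.tgt e = v)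
    (hz : ∀ e, ‖z e‖ = 1) (hlam : lam ≤ D.M) {x : D.Node → ℂ} (hx : x ≠ 0) :
    ∃ c > 0, ∀ μ, lam ≤ μ → μ ≤ D.M → D.quad μ z x ≤ D.quad lam z x - (μ - lam) * c := by
  obtain ⟨w, hw⟩ := Function.ne_iff.1 hx
  obtain ⟨e, k, hk, hek⟩ := D.exists_piece_node hinc w
  have mono : ∀ μ, lam ≤ μ → μ ≤ D.M → ∀ e, ∀ k ≤ D.m, ∀ a b,
      (D.F e).pieceForm μ (D.point e k) (D.point e (k + 1)) a b ≤
      (D.F e).pieceForm lam (D.point e k) (D.point e (k + 1)) a b := by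
    intro μ h1 h2 e k hk a b
    rcases h1.eq_or_lt with rfl | h1
    · exact le_rfl
    by_cases hab : a ≠ 0 ∨ b ≠ 0
    · exact ((D.F e).pieceForm_strictAnti (D.isShort h2 e hk) (D.isPotential e) h1 hab).le
    · push Not at hab
      simp [hab.1, hab.2, FundamentalSystem.pieceForm]
  have mem : ∀ {k}, k ∈ Finset.range (D.m + 1) ↔ k ≤ D.m := by simp
  have h0 : D.edgeEval z e k x ≠ 0 ∨ D.edgeEval z e (k + 1) x ≠ 0 := by
    rw [D.edgeEval_ne_zero_iff hz, D.edgeEval_ne_zero_iff hz]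
    refine hek.imp (fun h => ?_) fun h => ?_ <;> rw [h] <;> exact hw
  set pf : ℝ → E → ℕ → ℝ := fun μ e k =>
    (D.F e).pieceForm μ (D.point e k) (D.point e (k + 1)) (D.edgeEval z e k x).re
        (D.edgeEval z e (k + 1) x).re +
      (D.F e).pieceForm μ (D.point e k) (D.point e (k + 1)) (D.edgeEval z e k x).im
        (D.edgeEval z e (k + 1) x).im with hpf
  have key : ∃ c > 0, ∀ μ, lam ≤ μ → μ ≤ D.M → pf μ e k ≤ pf lam e k - (μ - lam) * c := by
    by_cases hre : (D.edgeEval z e k x).re ≠ 0 ∨ (D.edgeEval z e (k + 1) x).re ≠ 0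
    · obtain ⟨c, hc, h⟩ := (D.F e).exists_pieceForm_le_sub (D.isShort hlam e hk)
        (D.isPotential e) hre
      refine ⟨c, hc, fun μ h1 h2 => ?_⟩
      have := h μ h1 (D.isShort h2 e hk)
      have := mono μ h1 h2 e k hk (D.edgeEval z e k x).im (D.edgeEval z e (k + 1) x).im
      simp only [hpf]
      linarith
    · push Not at hre
      obtain ⟨c, hc, h⟩ := (D.F e).exists_pieceForm_le_sub (D.isShort hlam e hk)
        (D.isPotential e) (x := (D.edgeEval z e k x).im) (y := (D.edgeEval z e (k + 1) x).im)
        (h0.imp (fun h h' => h (Complex.ext hre.1 h')) fun h h' => h (Complex.ext hre.2 h'))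
      refine ⟨c, hc, fun μ h1 h2 => ?_⟩
      have := h μ h1 (D.isShort h2 e hk)
      have := mono μ h1 h2 e k hk (D.edgeEval z e k x).re (D.edgeEval z e (k + 1) x).re
      simp only [hpf]
      linarith
  obtain ⟨c, hc, hle⟩ := key
  refine ⟨c, hc, fun μ h1 h2 => ?_⟩
  rw [quad_eq_sum, quad_eq_sum]
  have hle' : ∀ e, ∀ k ∈ Finset.range (D.m + 1), 0 ≤ pf lam e k - pf μ e k := fun e k hk => by
    have a1 := mono μ h1 h2 e k (mem.1 hk) (D.edgeEval z e k x).re (D.edgeEval z e (k + 1) x).re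
    have a2 := mono μ h1 h2 e k (mem.1 hk) (D.edgeEval z e k x).im (D.edgeEval z e (k + 1) x).im
    simp only [hpf]
    linarith
  have b1 := Finset.single_le_sum (f := fun k => pf lam e k - pf μ e k) (hle' e) (mem.2 hk)
  have b2 := Finset.single_le_sum
    (f := fun e => ∑ k ∈ Finset.range (D.m + 1), (pf lam e k - pf μ e k))
    (fun e _ => Finset.sum_nonneg (hle' e)) (Finset.mem_univ e)
  have b3 := hle μ h1 h2
  simp only [Finset.sum_sub_distrib] at b1 b2
  simp only [hpf] at b1 b2 b3
  linarith

theorem pairing_mulReal (ψ : D.Node → ℝ) (y x : D.Node → ℂ) :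
    pairing y (D.mulReal ψ x) = pairing (D.mulReal ψ y) x := by
  rw [pairing_apply, pairing_apply]
  refine Finset.sum_congr rfl fun w _ => ?_
  simp only [mulReal, LinearMap.coe_mk, AddHom.coe_mk, map_mul, Complex.conj_ofReal]
  congr 1
  ring

/-- The discretized operator acting on the quotient of a function by `ψ`. -/
noncomputable def scaledOp (ψ : D.Node → ℝ) (μ : ℝ) (z : E → ℂ) :
    (D.Node → ℂ) →L[ℝ] (D.Node → ℂ) :=
  LinearMap.toContinuousLinearMap
    ((D.mulReal ψ ∘ₗ D.op μ z ∘ₗ D.mulReal ψ).restrictScalars ℝ)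

theorem scaledOp_apply (ψ : D.Node → ℝ) (μ : ℝ) (z : E → ℂ) (x : D.Node → ℂ) :
    D.scaledOp ψ μ z x = D.mulReal ψ (D.op μ z (D.mulReal ψ x)) := rfl

theorem pairing_scaledOp (ψ : D.Node → ℝ) (μ : ℝ) (z : E → ℂ) (y x : D.Node → ℂ) :
    pairing y (D.scaledOp ψ μ z x) = (D.form μ z (D.mulReal ψ y) (D.mulReal ψ x)).re := by
  rw [scaledOp_apply, pairing_mulReal, pairing_op]

theorem contDiffAt_form {n : ℕ} (θ : (Fin n → ℝ) →ₗ[ℝ] (E → ℝ)) (hμ : μ ≤ D.M)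
    (α : Fin n → ℝ) (y x : D.Node → ℂ) :
    ContDiffAt ℝ 2 (fun t : ℝ × (Fin n → ℝ) => D.form t.1 (cochainPhase (θ t.2)) y x)
      (μ, α) := by
  have hθ : ContDiff ℝ 2 fun t : ℝ × (Fin n → ℝ) => θ t.2 :=
    (LinearMap.toContinuousLinearMap θ).contDiff.comp contDiff_snd
  have hconj : ∀ {f : ℝ × (Fin n → ℝ) → ℂ}, ContDiff ℝ 2 f →
      ContDiff ℝ 2 fun t => conj (f t) := fun h =>
    Complex.conjCLE.toContinuousLinearMap.contDiff.comp h
  have hph : ∀ e, ContDiff ℝ 2 fun t : ℝ × (Fin n → ℝ) => cochainPhase (θ t.2) e := by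
    intro e
    simp only [cochainPhase]
    have h1 : ContDiff ℝ 2 fun t : ℝ × (Fin n → ℝ) => θ t.2 e := contDiff_pi.1 hθ e
    have h2 : ContDiff ℝ 2 fun t : ℝ × (Fin n → ℝ) => ((θ t.2 e : ℝ) : ℂ) :=
      Complex.ofRealCLM.contDiff.comp h1
    exact (contDiff_const.mul h2).cexp
  have hee : ∀ (y : D.Node → ℂ) e k, ContDiff ℝ 2 fun t : ℝ × (Fin n → ℝ) =>
      D.edgeEval (cochainPhase (θ t.2)) e k y := by
    intro y e k
    simp only [edgeEval_apply, twist]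
    refine ContDiff.mul ?_ contDiff_const
    split_ifs
    · exact hconj (hph e)
    · exact contDiff_const
  simp only [form]
  refine ContDiffAt.add (ContDiffAt.sum fun e _ => ContDiffAt.sum fun k hk => ?_)
    contDiffAt_const
  have hk' : k ≤ D.m := by simpa [Nat.lt_succ_iff] using hk
  obtain ⟨h1, h2, h3⟩ := (D.F e).contDiffAt_coef (D.isShort hμ e hk') (D.isPotential e)
  have hfst : ContDiffAt ℝ 2 (fun t : ℝ × (Fin n → ℝ) => t.1) (μ, α) := contDiffAt_fst
  have c1 : ContDiffAt ℝ 2 (fun t : ℝ × (Fin n → ℝ) => (D.left t.1 e k : ℂ)) (μ, α) :=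
    Complex.ofRealCLM.contDiff.contDiffAt.comp (μ, α)
      (ContDiffAt.comp (μ, α) (g := fun μ => D.left μ e k) h1 hfst)
  have c2 : ContDiffAt ℝ 2 (fun t : ℝ × (Fin n → ℝ) => (D.mix t.1 e k : ℂ)) (μ, α) :=
    Complex.ofRealCLM.contDiff.contDiffAt.comp (μ, α)
      (ContDiffAt.comp (μ, α) (g := fun μ => D.mix μ e k) h2 hfst)
  have c3 : ContDiffAt ℝ 2 (fun t : ℝ × (Fin n → ℝ) => (D.right t.1 e k : ℂ)) (μ, α) :=
    Complex.ofRealCLM.contDiff.contDiffAt.comp (μ, α)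
      (ContDiffAt.comp (μ, α) (g := fun μ => D.right μ e k) h3 hfst)
  have x0 := (hee x e k).contDiffAt (x := (μ, α))
  have x1 := (hee x e (k + 1)).contDiffAt (x := (μ, α))
  have y0 := (hconj (hee y e k)).contDiffAt (x := (μ, α))
  have y1 := (hconj (hee y e (k + 1))).contDiffAt (x := (μ, α))
  exact (y0.mul ((c1.mul x0).sub (c2.mul x1))).add (y1.mul ((c3.mul x1).sub (c2.mul x0)))

/-- On the open half-space below `D.M`, smoothness of an operator-valued map in finite dimensions
can be checked vector by vector; this is why the inequality is strict. -/
theorem contDiffAt_scaledOp {n : ℕ} (θ : (Fin n → ℝ) →ₗ[ℝ] (E → ℝ)) (hμ : μ < D.M)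
    (ψ : D.Node → ℝ) (α : Fin n → ℝ) :
    ContDiffAt ℝ 2 (fun t : ℝ × (Fin n → ℝ) => D.scaledOp ψ t.1 (cochainPhase (θ t.2)))
      (μ, α) := by
  have hopen : IsOpen {t : ℝ × (Fin n → ℝ) | t.1 < D.M} := isOpen_lt continuous_fst continuous_const
  have h : ContDiffOn ℝ 2 (fun t : ℝ × (Fin n → ℝ) => D.scaledOp ψ t.1 (cochainPhase (θ t.2)))
      {t | t.1 < D.M} := by
    rw [contDiffOn_clm_apply]
    intro x t ht
    refine ContDiffAt.contDiffWithinAt (contDiffAt_pi.2 fun w => ?_)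
    exact contDiffAt_const.mul (D.contDiffAt_form θ (le_of_lt ht) t.2 _ _)
  exact h.contDiffAt (hopen.mem_nhds hμ)

/-- The weight of a piece. -/
noncomputable def weight (ψ : D.Node → ℝ) (lam : ℝ) (p : D.Piece) : ℝ :=
  D.mix lam p.1.1 p.1.2 * ψ (D.start p) * ψ (D.finish p)

/-- In the scale of a kernel vector the form becomes a magnetic Laplacian. -/
theorem form_mulReal {ψ : D.Node → ℝ} (hψ : D.op lam 1 (fun w => (ψ w : ℂ)) = 0)
    (θ : E → ℝ) (y x : D.Node → ℂ) :
    D.form lam (cochainPhase θ) (D.mulReal ψ y) (D.mulReal ψ x) =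
      ∑ p, (D.weight ψ lam p : ℂ) *
        (conj (y (D.finish p) - Complex.exp (Complex.I * D.lastPiece θ p) * y (D.start p)) *
          (x (D.finish p) - Complex.exp (Complex.I * D.lastPiece θ p) * x (D.start p))) := by
  set Ψ : D.Node → ℂ := fun w => (ψ w : ℂ) with hΨ
  set z := cochainPhase θ with hz
  have hev : ∀ e k, conj (D.eval (D.node e k) Ψ) = D.eval (D.node e k) Ψ := fun e k =>
    D.conj_eval_ofReal ψ _
  have htw : ∀ e k, conj (D.twist z e k) * D.twist z e k = 1 := fun e k =>
    conj_mul_self_of_norm (D.twist_norm (norm_cochainPhase θ) e k)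
  have htw1 : ∀ e k, D.twist 1 e k = 1 := fun e k => by simp [twist]
  -- The kernel equation for `ψ`, tested with `ψ y x̄`, has the same diagonal and vertex terms as
  -- the form in question. Subtracting it completes the mixed terms to a product of differences.
  have h0 := (D.op_eq_zero_iff lam 1 Ψ).1 hψ (D.mulReal ψ fun w => y w * conj (x w))
  have hη : ∀ o, conj (D.eval o (fun w => y w * conj (x w))) = conj (D.eval o y) * D.eval o x := by
    intro o; cases o <;> simp
  have h1 : D.form lam z (D.mulReal ψ y) (D.mulReal ψ x) =
      ∑ e, ∑ k ∈ Finset.range (D.m + 1), (D.mix lam e k * D.eval (D.node e k) Ψ *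
        D.eval (D.node e (k + 1)) Ψ) *
        (conj (D.edgeEval z e (k + 1) y - D.edgeEval z e k y) *
          (D.edgeEval z e (k + 1) x - D.edgeEval z e k x)) := by
    rw [← sub_zero (D.form lam z _ _), ← h0, form, form, add_sub_add_comm,
      ← Finset.sum_sub_distrib, ← Finset.sum_sub_distrib]
    have hv : ∑ v, ((G.χ v : ℂ) * (conj (D.eval (D.vertexNode v) (D.mulReal ψ y)) *
        D.eval (D.vertexNode v) (D.mulReal ψ x)) - (G.χ v : ℂ) *
        (conj (D.eval (D.vertexNode v) (D.mulReal ψ fun w => y w * conj (x w))) *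
          D.eval (D.vertexNode v) Ψ)) = 0 := by
      refine Finset.sum_eq_zero fun v _ => ?_
      rw [eval_mulReal, eval_mulReal, eval_mulReal, map_mul, map_mul, hη]
      ring
    rw [hv, add_zero]
    refine Finset.sum_congr rfl fun e _ => ?_
    rw [← Finset.sum_sub_distrib]
    refine Finset.sum_congr rfl fun k _ => ?_
    simp only [edgeEval_apply, htw1, one_mul, eval_mulReal, map_mul, hη, map_sub]
    rw [← hΨ, hev, hev]
    set t₀ := D.twist z e k
    set t₁ := D.twist z e (k + 1)
    have u0 : conj t₀ * t₀ = 1 := htw e k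
    have u1 : conj t₁ * t₁ = 1 := htw e (k + 1)
    set P₀ := D.eval (D.node e k) Ψ
    set P₁ := D.eval (D.node e (k + 1)) Ψ
    set X₀ := D.eval (D.node e k) x
    set X₁ := D.eval (D.node e (k + 1)) x
    set Y₀ := D.eval (D.node e k) y
    set Y₁ := D.eval (D.node e (k + 1)) y
    linear_combination (P₀ * conj Y₀ * X₀ * (D.left lam e k * P₀ - D.mix lam e k * P₁)) * u0 +
      (P₁ * conj Y₁ * X₁ * (D.right lam e k * P₁ - D.mix lam e k * P₀)) * u1
  rw [h1, D.sum_extend]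
  · refine Finset.sum_congr rfl fun p _ => ?_
    have hs := D.node_start p
    have ht := D.node_finish p
    simp only [edgeEval_apply, hs, ht, eval_some]
    have hp := p.1.2.2
    have t0 : D.twist z p.1.1 p.1.2 = 1 := by rw [twist, if_neg (by lia)]
    have t1 : D.twist z p.1.1 (p.1.2 + 1) = conj (Complex.exp (Complex.I * D.lastPiece θ p)) := by
      rw [twist, lastPiece_apply]
      by_cases hm : (p.1.2 : ℕ) = D.m
      · rw [if_pos (by lia), if_pos hm]; rfl
      · rw [if_neg (by lia), if_neg hm]; simp
    rw [t0, t1, weight, hΨ]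
    have hζ : conj (Complex.exp (Complex.I * D.lastPiece θ p)) *
        Complex.exp (Complex.I * D.lastPiece θ p) = 1 :=
      conj_mul_self_of_norm (by rw [mul_comm, Complex.norm_exp_ofReal_mul_I])
    set ζ := Complex.exp (Complex.I * D.lastPiece θ p)
    simp only [map_sub, map_mul, Complex.conj_conj, map_one]
    push_cast
    linear_combination (D.mix lam p.1.1 p.1.2 * ψ (D.start p) * ψ (D.finish p) : ℂ) *
      ((conj (y (D.finish p)) * x (D.finish p)) - conj (y (D.start p)) * x (D.start p)) * hζ
  · rintro e k - (h | h) <;> rw [h] <;> simp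

theorem exists_magneticFamily (hinc : ∀ v, ∃ e, G.src e = v ∨ G.tgt e = v) (hlam : lam < D.M)
    {ψ : D.Node → ℝ} (hψ : D.op lam 1 (fun w => (ψ w : ℂ)) = 0) (hψ0 : ∀ w, ψ w ≠ 0)
    [Nonempty D.Node]
    (hker : Module.finrank ℂ (LinearMap.ker (D.op lam 1)) = 1) {n : ℕ}
    (θ : (Fin n → ℝ) →ₗ[ℝ] (E → ℝ)) :
    ∃ c₀, MagneticFamily n D.start D.finish (D.weight ψ lam) (D.lastPiece ∘ₗ θ) lam c₀
      fun t => D.scaledOp ψ t.1 (cochainPhase (θ t.2)) := by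
  have hΨ0 : (fun w => (ψ w : ℂ)) ≠ 0 := by
    obtain ⟨w⟩ := ‹Nonempty D.Node›
    exact fun h => hψ0 w (by simpa using congrFun h w)
  have hquad : ∀ μ, pairing (1 : D.Node → ℂ) (D.scaledOp ψ μ (cochainPhase (θ 0)) 1) =
      D.quad μ 1 (fun w => (ψ w : ℂ)) := by
    intro μ
    have : D.mulReal ψ 1 = fun w => (ψ w : ℂ) := by ext w; simp [mulReal]
    rw [pairing_scaledOp, quad_apply, pairing_op, map_zero, cochainPhase_zero, this]
  have hcd := D.contDiffAt_scaledOp θ hlam ψ 0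
  have hdiff : DifferentiableAt ℝ (fun μ => D.quad μ 1 (fun w => (ψ w : ℂ))) lam := by
    have h1 : DifferentiableAt ℝ (fun μ : ℝ => (μ, (0 : Fin n → ℝ))) lam := by fun_prop
    have h2 := (hcd.differentiableAt (by norm_num)).comp lam h1
    have h3 := (pairing (1 : D.Node → ℂ)).differentiableAt.comp lam
      (h2.clm_apply (differentiableAt_const (1 : D.Node → ℂ)))
    refine h3.congr_of_eventuallyEq (Eventually.of_forall fun μ => (hquad μ).symm)
  obtain ⟨c, hc, hle⟩ := D.exists_quad_le_sub hinc (z := 1) (by simp) hlam.le hΨ0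
  set d := deriv (fun μ => D.quad μ 1 (fun w => (ψ w : ℂ))) lam with hd
  -- The linear rate bounds the difference quotients from the right; hence `c₀ = -d` is positive.
  have hdc : d ≤ -c := by
    have h1 := hdiff.hasDerivAt.hasDerivWithinAt (s := Set.Ioi lam)
    rw [hasDerivWithinAt_iff_tendsto_slope' (by simp)] at h1
    refine le_of_tendsto h1 ?_
    filter_upwards [Ioo_mem_nhdsGT hlam] with μ hμ
    rw [slope_def_field, div_le_iff₀ (by linarith [hμ.1])]
    linarith [hle μ hμ.1.le hμ.2.le]
  refine ⟨-d, hcd, fun t f => ?_, fun t g f => ?_, fun α g f => ?_, fun f hf => ?_, ?_, ?_⟩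
  · simp only [scaledOp_apply, map_smul]
  · rw [pairing_comm (D.scaledOp ψ _ _ g), pairing_scaledOp, pairing_scaledOp, ← conj_form,
      Complex.conj_re]
  · rw [pairing_scaledOp, D.form_mulReal hψ, Complex.re_sum]
    refine Finset.sum_congr rfl fun p _ => ?_
    rw [Complex.re_ofReal_mul]
    rfl
  · rw [scaledOp_apply, map_zero, cochainPhase_zero] at hf
    have h1 : D.op lam 1 (D.mulReal ψ f) = 0 := by
      ext w
      have := congrFun hf w
      simpa [mulReal, hψ0 w] using this
    obtain ⟨a, ha⟩ := (finrank_eq_one_iff_of_nonzero'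
      (⟨fun w => (ψ w : ℂ), hψ⟩ : LinearMap.ker (D.op lam 1))
      (fun h => hΨ0 (congrArg Subtype.val h))).1 hker ⟨_, h1⟩
    refine ⟨a, funext fun w => ?_⟩
    have := congrFun (congrArg Subtype.val ha) w
    have hw : (ψ w : ℂ) ≠ 0 := by exact_mod_cast hψ0 w
    simp only [SetLike.val_smul, Pi.smul_apply, smul_eq_mul, mulReal, LinearMap.coe_mk,
      AddHom.coe_mk] at this
    refine mul_left_cancel₀ hw ?_
    rw [← this, mul_comm]
  · rw [neg_neg]
    refine hdiff.hasDerivAt.congr_of_eventuallyEq (Eventually.of_forall hquad)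
  · linarith

end Discretization

end QuantumGraph

/-! ### The eigenvalue branch at zero flux and its Morse index -/

namespace QuantumGraph

open ComplexConjugate

variable {V E : Type*} [DecidableEq V] [Fintype E] {G : QuantumGraph V E}

theorem MagneticPotential.phase_eq_cochainPhase (A : G.MagneticPotential) :
    A.phase = Discretization.cochainPhase fun e => ∫ x in (0 : ℝ)..G.length e, A.A e x := rfl

theorem MagneticPotential.phase_zero : (0 : G.MagneticPotential).phase = 1 := by
  have h : ∀ e, (0 : G.MagneticPotential).A e = fun _ => 0 := fun _ => rfl
  ext e
  simp [MagneticPotential.phase, magneticPhase, h]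

/-- The potential that is constant on every edge and has the given integrals over the edges. -/
noncomputable def MagneticPotential.ofCochain (G : QuantumGraph V E) (θ : E → ℝ) :
    G.MagneticPotential where
  A e _ := θ e / G.length e
  regular e := ⟨fun _ => 0, MemLp.zero, fun x _ => by simp⟩

theorem MagneticPotential.integral_ofCochain (G : QuantumGraph V E) (θ : E → ℝ) (e : E) :
    ∫ x in (0 : ℝ)..G.length e, (MagneticPotential.ofCochain G θ).A e x = θ e := by
  simp only [MagneticPotential.ofCochain, intervalIntegral.integral_const, sub_zero, smul_eq_mul]
  exact mul_div_cancel₀ _ (G.length_pos e).ne'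

theorem MagneticPotential.phase_ofCochain (G : QuantumGraph V E) (θ : E → ℝ) :
    (MagneticPotential.ofCochain G θ).phase = Discretization.cochainPhase θ := by
  simp only [phase_eq_cochainPhase, integral_ofCochain]

theorem flux_ofCochain {k : ℕ} (σ : Fin k → FreeGroup E) (θ : E → ℝ) (j : Fin k) :
    flux (MagneticPotential.ofCochain G θ) (σ j) = cochainFlux σ θ j := by
  simp only [flux_eq_cochainFlux, MagneticPotential.integral_ofCochain]

namespace Discretization

variable [Fintype V] (D : G.Discretization) {lam : ℝ}

/-- The index of the discretized form is that of the weighted Laplacian of a kernel vector. -/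
theorem sigNeg_quad_eq {ψ : D.Node → ℝ} (hψ : D.op lam 1 (fun w => (ψ w : ℂ)) = 0)
    (hψ0 : ∀ w, ψ w ≠ 0) : sigNeg (D.quad lam 1) = 2 * sigNeg
      ((QuadraticMap.weightedSumSquares ℝ (D.weight ψ lam)).comp
        (MagneticFamily.coboundary D.start D.finish)) := by
  have hinv : ∀ w, (ψ w : ℂ) ≠ 0 := fun w => by exact_mod_cast hψ0 w
  let e : (D.Node → ℂ) ≃ₗ[ℝ] (D.Node → ℂ) :=
    LinearEquiv.ofBijective ((D.mulReal ψ).restrictScalars ℝ)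
      ⟨fun x y h => funext fun w => mul_left_cancel₀ (hinv w) (congrFun h w),
        fun y => ⟨fun w => (ψ w : ℂ)⁻¹ * y w, funext fun w => mul_inv_cancel_left₀ (hinv w) _⟩⟩
  have heq : ((D.quad lam 1).comp e.toLinearMap).Equivalent (D.quad lam 1) :=
    ⟨{ e with map_app' := fun _ => rfl }⟩
  rw [← heq.sigNeg_eq]
  refine sigNeg_complexification fun f => ?_
  have h1 : D.quad lam 1 (e f) = (D.form lam (cochainPhase 0) (D.mulReal ψ f) (D.mulReal ψ f)).re := by
    rw [quad_apply, pairing_op, cochainPhase_zero]; rfl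
  rw [QuadraticMap.comp_apply, LinearEquiv.coe_coe, h1, D.form_mulReal hψ, Complex.re_sum,
    QuadraticMap.comp_apply, QuadraticMap.comp_apply, QuadraticMap.weightedSumSquares_apply,
    QuadraticMap.weightedSumSquares_apply, ← Finset.sum_add_distrib]
  refine Finset.sum_congr rfl fun p _ => ?_
  rw [Complex.re_ofReal_mul, map_zero]
  simp only [Pi.zero_apply, Complex.ofReal_zero, mul_zero, Complex.exp_zero, one_mul,
    MagneticFamily.coboundary, LinearMap.coe_mk, AddHom.coe_mk, smul_eq_mul, Complex.mul_re,
    Complex.conj_re, Complex.conj_im, Complex.sub_re, Complex.sub_im]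
  ring

/-- Near the zero flux a differentiable branch of eigenvalues is the `n`-th eigenvalue. -/
theorem eventually_isNthEigenvalue (hinc : ∀ v, ∃ e, G.src e = v ∨ G.tgt e = v)
    (hlam : lam < D.M) {ψ : D.Node → ℝ} (hψ : D.op lam 1 (fun w => (ψ w : ℂ)) = 0)
    (hψ0 : ∀ w, ψ w ≠ 0) (hker : Module.finrank ℂ (LinearMap.ker (D.op lam 1)) = 1)
    {n : ℕ} (hn : D.index lam 1 + 1 = n) {k : ℕ} (θ : (Fin k → ℝ) →ₗ[ℝ] (E → ℝ))
    {Y : (Fin k → ℝ) → D.Node → ℂ} {Λ : (Fin k → ℝ) → ℝ} (hΛ : ContinuousAt Λ 0)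
    (hΛ0 : Λ 0 = lam) {v₀ : D.Node}
    (heq : ∀ᶠ α in 𝓝 0, D.scaledOp ψ (Λ α) (cochainPhase (θ α)) (Y α) = 0 ∧ Y α v₀ = 1) :
    ∀ᶠ α in 𝓝 0, IsNthEigenvalue (MagneticPotential.ofCochain G (θ α)) n (Λ α) := by
  have hθ : Continuous θ := (LinearMap.toContinuousLinearMap θ).continuous
  have hph : Continuous fun α => cochainPhase (θ α) := by
    refine continuous_pi fun e => ?_
    have := (continuous_apply e).comp hθ
    simp only [cochainPhase]
    fun_prop
  have hcont : ContinuousAt (fun α => (Λ α, cochainPhase (θ α))) 0 := hΛ.prodMk hph.continuousAt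
  have hsig := D.eventually_sig_le hlam.le 1
  have h0 : (fun α => (Λ α, cochainPhase (θ α))) 0 = (lam, 1) := by
    simp only [map_zero, cochainPhase_zero, hΛ0]
  rw [← h0] at hsig
  have hM : ∀ᶠ α in 𝓝 0, Λ α < D.M := hΛ.eventually_lt_const (by rwa [hΛ0])
  filter_upwards [hcont.eventually hsig, heq, hM] with α h1 h2 h3
  rw [D.isNthEigenvalue_iff hinc _ h3.le, MagneticPotential.phase_ofCochain]
  have h4 : D.op (Λ α) (cochainPhase (θ α)) (D.mulReal ψ (Y α)) = 0 := by
    have := h2.1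
    rw [scaledOp_apply] at this
    ext w
    have hw : (ψ w : ℂ) ≠ 0 := by exact_mod_cast hψ0 w
    exact (mul_eq_zero.1 (congrFun this w)).resolve_left hw
  have h5 : 0 < Module.finrank ℂ (LinearMap.ker (D.op (Λ α) (cochainPhase (θ α)))) := by
    rw [Module.finrank_pos_iff_exists_ne_zero]
    refine ⟨⟨_, h4⟩, fun h => ?_⟩
    have := congrFun (congrArg Subtype.val h) v₀
    have hv : (ψ v₀ : ℂ) ≠ 0 := by exact_mod_cast hψ0 v₀
    exact hv (by simpa [mulReal, h2.2] using this)
  have e0 := D.sigNeg_quad_eq hψ hψ0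
  have e1 := QuadraticForm.sigPos_add_sigNeg_add_radical (Q := D.quad lam 1)
  have e2 := QuadraticForm.sigPos_add_sigNeg_add_radical (Q := D.quad (Λ α) (cochainPhase (θ α)))
  rw [finrank_radical_quad] at e1 e2
  simp only [index] at hn ⊢
  -- Near zero flux neither index nor coindex can drop, while the kernel stays nontrivial. The
  -- dimension formula with a one-dimensional kernel at zero flux leaves no room, so the index is
  -- unchanged; `e0` shows that it is even, so halving loses nothing.
  lia

theorem isNondegenerateCriticalPoint (hG : G.Connected) {v₀ : V}
    {σ : Fin G.betti → FreeGroup E}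
    (hσ : Subgroup.closure (Set.range σ) = G.fundamentalGroup v₀) (hm : 0 < D.m)
    (hinc : ∀ v, ∃ e, G.src e = v ∨ G.tgt e = v) (hlam : lam < D.M)
    {ψ : D.Node → ℝ} (hψ : D.op lam 1 (fun w => (ψ w : ℂ)) = 0) (hψ0 : ∀ w, ψ w ≠ 0)
    [Nonempty D.Node] (hker : Module.finrank ℂ (LinearMap.ker (D.op lam 1)) = 1)
    {n : ℕ} (hn : IsNthEigenvalue (0 : G.MagneticPotential) n lam)
    {Λ : (Fin G.betti → ℝ) → ℝ} (hΛ : G.IsMagneticEigenvalue σ n Λ) :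
    IsNondegenerateCriticalPoint Λ 0 ∧
      morseIndex Λ 0 + n = (Finset.univ.filter fun p => D.weight ψ lam p < 0).card + 1 := by
  obtain ⟨w₀⟩ := ‹Nonempty D.Node›
  have : Nonempty D.Node := ⟨w₀⟩
  rw [D.isNthEigenvalue_iff hinc _ hlam.le, MagneticPotential.phase_zero, hker] at hn
  have hn' : D.index lam 1 + 1 = n := by lia
  -- A linear section is used so that the phases depend smoothly on the fluxes.
  obtain ⟨θ, hθ⟩ := (cochainFlux σ).exists_rightInverse_of_surjective
    (LinearMap.range_eq_top.2 (cochainFlux_surjective hG hσ))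
  have hθ' : ∀ α, cochainFlux σ (θ α) = α := fun α => LinearMap.congr_fun hθ α
  obtain ⟨c₀, hfam⟩ := D.exists_magneticFamily hinc hlam hψ hψ0 hker θ
  obtain ⟨Y, Λ', hY, hΛ', hY0, hΛ0, heq⟩ := hfam.exists_branch w₀
  have hev := D.eventually_isNthEigenvalue hinc hlam hψ hψ0 hker hn' θ hΛ'.continuousAt hΛ0 heq
  have hΛΛ : Λ =ᶠ[𝓝 0] Λ' := by
    filter_upwards [hev] with α hα
    refine IsNthEigenvalue.unique (hΛ (MagneticPotential.ofCochain G (θ α)) α fun j => ?_) hα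
    rw [flux_ofCochain, hθ']
  have hw : ∀ p, D.weight ψ lam p ≠ 0 := fun p => by
    have hk : (p.1.2 : ℕ) ≤ D.m := Nat.lt_succ_iff.1 p.1.2.2
    exact mul_ne_zero (mul_ne_zero
      ((D.F p.1.1).coefMix_pos (D.isShort hlam.le p.1.1 hk) (D.isPotential p.1.1)).ne' (hψ0 _))
      (hψ0 _)
  have heq₁ := heq.mono fun α h => h.1
  have hFl : ∀ α, D.pieceFlux σ ((D.lastPiece ∘ₗ θ) α) = α := fun α => by
    rw [LinearMap.comp_apply, D.pieceFlux_lastPiece hG hσ hm, hθ']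
  obtain ⟨hnd, hidx⟩ := hfam.nondegenerate_hessian_and_index hY hΛ' hY0 hΛ0 heq₁
    (heq.mono fun α h => h.2) hw hFl (D.pieceFlux_eq_zero_iff hG hσ hm)
  have hhess : hessianAt Λ 0 = hessianAt Λ' 0 := by
    rw [hessianAt, hessianAt, hΛΛ.fderiv.fderiv_eq]
  refine ⟨⟨hΛ'.congr_of_eventuallyEq hΛΛ, ?_, hhess ▸ hnd⟩, ?_⟩
  · rw [hΛΛ.fderiv_eq]
    exact hfam.fderiv_eq_zero hY hΛ' hY0 hΛ0 heq₁
  · have e0 := D.sigNeg_quad_eq hψ hψ0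
    have : morseIndex Λ 0 = morseIndex Λ' 0 := by rw [morseIndex, morseIndex, hhess]
    simp only [index] at hn'
    lia

end Discretization

end QuantumGraph

/-! ### Real eigenfunctions and their zeros -/

open ComplexConjugate in
theorem HasH1Deriv.conj {L : ℝ} {f g : ℝ → ℂ} (h : HasH1Deriv L f g) :
    HasH1Deriv L (fun x => conj (f x)) (fun x => conj (g x)) := by
  refine ⟨h.1.star, fun x hx => ?_⟩
  simp only
  rw [h.2 x hx, map_add, intervalIntegral.intervalIntegral_conj]

/-- A solution changes its sign at a zero inside a short interval. -/
theorem IsShort.mul_neg_of_zero {L Q μ p r x : ℝ} {q u v : ℝ → ℝ} (hs : IsShort L Q μ p r)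
    (h : IsPotential L Q q) (F : FundamentalSystem L q) (hu : IsSolution L q μ u v)
    (hx : x ∈ Set.Ioo p r) (h0 : u x = 0) (hp : u p ≠ 0) : u p * u r < 0 := by
  have s1 := hs.mono le_rfl le_rfl hx.2.le hx.1
  have s2 := hs.mono le_rfl hx.1.le le_rfl hx.2
  have e1 := F.deriv_right s1 h hu
  have e2 := F.deriv_left s2 h hu
  have m1 := F.coefMix_pos s1 h
  have m2 := F.coefMix_pos s2 h
  rw [h0] at e1 e2
  have e3 : F.coefMix μ x r * (u p * u r) = -(F.coefMix μ p x * (u p * u p)) := by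
    linear_combination u p * (e1 - e2)
  have := mul_pos m1 (mul_self_pos.2 hp)
  by_contra hneg
  have := mul_nonneg m2.le (not_lt.1 hneg)
  linarith

/-- A nontrivial solution has at most one zero in a short interval. -/
theorem IsShort.zero_unique {L Q μ p r x y : ℝ} {q u v : ℝ → ℝ} (hs : IsShort L Q μ p r)
    (h : IsPotential L Q q) (hu : IsSolution L q μ u v) (hne : ∃ y ∈ Set.Icc 0 L, u y ≠ 0)
    (hx : x ∈ Set.Icc p r) (hy : y ∈ Set.Icc p r) (hx0 : u x = 0) (hy0 : u y = 0) : x = y := by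
  obtain ⟨t, ht, hut⟩ := hne
  rcases lt_trichotomy x y with hlt | rfl | hlt
  · exact absurd ((hs.mono le_rfl hx.1 hy.2 hlt).eq_zero_of_dirichlet h hu hx0 hy0 t ht).1 hut
  · rfl
  · exact absurd ((hs.mono le_rfl hy.1 hx.2 hlt).eq_zero_of_dirichlet h hu hy0 hx0 t ht).1 hut

/-- Subdivisions into a large prime number of equal parts avoid a finite set. -/
theorem eventually_ne_div_of_prime {S : Set ℝ} (hS : S.Finite) :
    ∀ᶠ m : ℕ in atTop, (m + 1).Prime → ∀ r ∈ S, ∀ k : ℕ, 0 < k → k ≤ m →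
      r ≠ k / (m + 1 : ℝ) := by
  have key : ∀ r ∈ S, {m : ℕ | (m + 1).Prime ∧ ∃ k : ℕ, 0 < k ∧ k ≤ m ∧
      r = k / (m + 1 : ℝ)}.Finite := by
    intro r _
    -- A number with two representations `k / (m + 1)` and `k' / (m' + 1)` in the open unit
    -- interval, with both denominators prime, has equal denominators; thus each point of `S`
    -- excludes at most one `m`.
    refine Set.Subsingleton.finite ?_
    rintro m ⟨hm, k, hk, hkm, hr⟩ m' ⟨hm', k', hk', hkm', hr'⟩
    have h1 : k * (m' + 1) = k' * (m + 1) := by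
      rw [hr, div_eq_div_iff (by positivity) (by positivity)] at hr'
      exact_mod_cast hr'
    have h2 : m + 1 ∣ k * (m' + 1) := ⟨k', by rw [h1, mul_comm]⟩
    rcases hm.dvd_mul.1 h2 with h3 | h3
    · exact absurd (Nat.le_of_dvd hk h3) (by lia)
    · have := (Nat.prime_dvd_prime_iff_eq hm hm').1 h3
      lia
  have hfin := hS.biUnion key
  have h2 : ∀ᶠ m : ℕ in atTop, m ∉ ⋃ r ∈ S, {m : ℕ | (m + 1).Prime ∧ ∃ k : ℕ, 0 < k ∧ k ≤ m ∧
      r = k / (m + 1 : ℝ)} := by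
    rw [← Nat.cofinite_eq_atTop]
    exact hfin.compl_mem_cofinite
  filter_upwards [h2] with m hm hp r hr k hk hkm h
  exact hm (Set.mem_biUnion hr ⟨hp, k, hk, hkm, h⟩)

namespace QuantumGraph

open ComplexConjugate

variable {V E : Type*} [DecidableEq V] [Fintype E] {G : QuantumGraph V E}

theorem conj_mem_eigenspace {lam : ℝ} {ψ : E → ℝ → ℂ}
    (hψ : ψ ∈ eigenspace (0 : G.MagneticPotential) lam) :
    (fun e x => conj (ψ e x)) ∈ eigenspace (0 : G.MagneticPotential) lam := by
  have hA : ∀ e x, (0 : G.MagneticPotential).A e x = 0 := fun _ _ => rfl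
  have hcov : ∀ f f' : E → ℝ → ℂ, covDeriv (0 : G.MagneticPotential) f f' = f' := fun f f' => by
    funext e x; simp [covDeriv, hA]
  obtain ⟨h0, f', f'', D', h1, h2, h3, ⟨val, hv1, hv2, hv3⟩, h4⟩ := hψ
  simp only [hcov] at h3 h4 hv3
  refine ⟨fun e x hx => by simp [h0 e x hx], fun e x => conj (f' e x), fun e x => conj (f'' e x),
    fun e x => conj (D' e x), fun e => (h1 e).conj, fun e => (h2 e).conj, ?_,
    ⟨fun v => conj (val v), fun e => by simp [hv1 e], fun v hv => by simp [hv2 v hv], ?_⟩, ?_⟩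
  · simp only [hcov]; exact fun e => (h3 e).conj
  · intro v hv
    simpa [hcov] using congrArg conj (hv3 v hv)
  · intro e
    filter_upwards [h4 e] with x hx
    simpa [hcov] using congrArg conj hx

/-- A simple eigenvalue of the operator without magnetic field has a real eigenfunction. -/
theorem exists_real_eigenfunction {lam : ℝ}
    (hsimple : Module.finrank ℂ (eigenspace (0 : G.MagneticPotential) lam) = 1) {ψ : E → ℝ → ℂ}
    (hψ : ψ ∈ eigenspace (0 : G.MagneticPotential) lam) (hψ0 : ψ ≠ 0) :
    ∃ ρ : E → ℝ → ℝ, (fun e x => (ρ e x : ℂ)) ∈ eigenspace (0 : G.MagneticPotential) lam ∧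
      ∀ e x, ψ e x = 0 ↔ ρ e x = 0 := by
  obtain ⟨e₀, he₀⟩ := Function.ne_iff.1 hψ0
  obtain ⟨x₀, hx₀⟩ := Function.ne_iff.1 he₀
  set c := ψ e₀ x₀ with hc
  have hc0 : c ≠ 0 := hx₀
  -- By simplicity the conjugate of `ψ` is a multiple of `ψ`, so dividing by a nonzero value `c` of
  -- `ψ` gives a real function.
  obtain ⟨a, ha⟩ := (finrank_eq_one_iff_of_nonzero'
    (⟨ψ, hψ⟩ : eigenspace (0 : G.MagneticPotential) lam)
    (fun h => hψ0 (congrArg Subtype.val h))).1 hsimple ⟨_, conj_mem_eigenspace hψ⟩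
  have ha' : ∀ e x, a * ψ e x = conj (ψ e x) := fun e x =>
    congrFun (congrFun (congrArg Subtype.val ha) e) x
  have ha0 : a ≠ 0 := by
    rintro rfl
    have := ha' e₀ x₀
    rw [zero_mul, ← hc, eq_comm, map_eq_zero] at this
    exact hc0 this
  have hreal : ∀ e x, ((c⁻¹ * ψ e x).re : ℂ) = c⁻¹ * ψ e x := by
    intro e x
    rw [← Complex.conj_eq_iff_re, map_mul, map_inv₀, ← ha' e x, hc, ← ha' e₀ x₀, ← hc]
    field_simp
  refine ⟨fun e x => (c⁻¹ * ψ e x).re, ?_, fun e x => ?_⟩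
  · simp only [hreal]
    exact (eigenspace (0 : G.MagneticPotential) lam).smul_mem c⁻¹ hψ
  · rw [← Complex.ofReal_eq_zero, hreal]
    simp [hc0]

/-- The eigenfunction does not vanish identically on any edge. -/
theorem exists_ne_zero_of_nonzeroAtVertices (hG : G.Connected) {A : G.MagneticPotential} {lam : ℝ}
    {ψ : E → ℝ → ℂ} (hψ : ψ ∈ eigenspace A lam) (hψ0 : ψ ≠ 0) (hψv : G.NonzeroAtVertices ψ)
    (e : E) : ∃ x ∈ Set.Icc 0 (G.length e), ψ e x ≠ 0 := by
  have hL := (G.length_pos e).le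
  by_cases hs : G.src e ∈ G.dirichlet
  swap
  · exact ⟨0, ⟨le_rfl, hL⟩, (hψv e).1 hs⟩
  by_cases ht : G.tgt e ∈ G.dirichlet
  swap
  · exact ⟨G.length e, ⟨hL, le_rfl⟩, (hψv e).2 ht⟩
  obtain ⟨s1, s2⟩ := dirichlet_src hs
  obtain ⟨t1, t2⟩ := dirichlet_tgt ht
  -- With Dirichlet vertices of degree one at both ends, the edge is a connected component, hence
  -- the whole graph, and `ψ` must be nonzero on it.
  have hg : ∀ e', (G.src e' = G.src e ∨ G.src e' = G.tgt e) =
      (G.tgt e' = G.src e ∨ G.tgt e' = G.tgt e) := by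
    intro e'
    by_cases he : e' = e
    · simp [he]
    · simp [s2 e', t2 e', mt (s1 e') he, mt (t1 e') he]
  obtain ⟨e', he'⟩ := Function.ne_iff.1 hψ0
  obtain ⟨x, hx⟩ := Function.ne_iff.1 he'
  have := hG.eq_of_src_eq_tgt (g := fun v => v = G.src e ∨ v = G.tgt e) hg (G.src e) (G.src e')
  simp only [true_or, eq_iff_iff, true_iff] at this
  obtain rfl : e' = e := s1 e' (this.resolve_right (t2 e'))
  refine ⟨x, ?_, hx⟩
  by_contra hx'
  exact hx (hψ.1 e' x hx')

namespace Discretization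

variable (D : G.Discretization) {lam : ℝ}

theorem exists_point_le_lt {e : E} {x : ℝ} (hx : x ∈ Set.Ioo 0 (G.length e)) :
    ∃ k ≤ D.m, D.point e k ≤ x ∧ x < D.point e (k + 1) := by
  have hex : ∃ k, x < D.point e k := ⟨D.m + 1, by rw [point_last]; exact hx.2⟩
  classical
  have h1 := Nat.find_spec hex
  have h2 : Nat.find hex ≠ 0 := fun h => by
    rw [h, point_zero] at h1
    exact absurd hx.1 h1.not_gt
  obtain ⟨k, hk⟩ := Nat.exists_eq_succ_of_ne_zero h2
  refine ⟨k, ?_, ?_, by rw [hk] at h1; exact h1⟩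
  · have : Nat.find hex ≤ D.m + 1 := Nat.find_min' hex (by rw [point_last]; exact hx.2)
    lia
  · exact not_lt.1 (Nat.find_min hex (by lia))

/-- Each of the finitely many pieces contains at most one zero, since two zeros would give a
Dirichlet solution on a short interval. -/
theorem finite_zeros (hlam : lam ≤ D.M) {u v : E → ℝ → ℝ}
    (hu : ∀ e, IsSolution (G.length e) (G.q e) lam (u e) (v e))
    (hne : ∀ e, ∃ y ∈ Set.Icc 0 (G.length e), u e y ≠ 0) :
    {p : E × ℝ | p.2 ∈ Set.Ioo 0 (G.length p.1) ∧ u p.1 p.2 = 0}.Finite := by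
  have hsub : {p : E × ℝ | p.2 ∈ Set.Ioo 0 (G.length p.1) ∧ u p.1 p.2 = 0} ⊆
      ⋃ i : E × Fin (D.m + 1), {p | p.1 = i.1 ∧
        p.2 ∈ Set.Icc (D.point i.1 i.2) (D.point i.1 (i.2 + 1)) ∧ u i.1 p.2 = 0} := by
    rintro ⟨e, x⟩ ⟨hx, h0⟩
    obtain ⟨k, hk, h1, h2⟩ := D.exists_point_le_lt hx
    exact Set.mem_iUnion.2 ⟨(e, ⟨k, by lia⟩), rfl, ⟨h1, h2.le⟩, h0⟩
  refine (Set.finite_iUnion fun i => Set.Subsingleton.finite ?_).subset hsub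
  rintro ⟨e, x⟩ ⟨rfl, hx, hx0⟩ ⟨e', y⟩ ⟨rfl, hy, hy0⟩
  exact Prod.ext rfl ((D.isShort hlam _ (Nat.lt_succ_iff.1 i.2.2)).zero_unique (D.isPotential _)
    (hu _) (hne _) hx hy hx0 hy0)

/-- The zeros on the open edges correspond to the pieces at whose ends the signs differ. -/
theorem ncard_zeros (hlam : lam ≤ D.M) {u v : E → ℝ → ℝ}
    (hu : ∀ e, IsSolution (G.length e) (G.q e) lam (u e) (v e))
    (hne : ∀ e, ∃ y ∈ Set.Icc 0 (G.length e), u e y ≠ 0)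
    (hnode : ∀ e, ∀ k ≤ D.m + 1, u e (D.point e k) = 0 ↔ D.node e k = none) :
    {p : E × ℝ | p.2 ∈ Set.Ioo 0 (G.length p.1) ∧ u p.1 p.2 = 0}.ncard =
      (Finset.univ.filter fun p : D.Piece =>
        u p.1.1 (D.point p.1.1 p.1.2) * u p.1.1 (D.point p.1.1 (p.1.2 + 1)) < 0).card := by
  have hle : ∀ p : D.Piece, (p.1.2 : ℕ) ≤ D.m := fun p => Nat.lt_succ_iff.1 p.1.2.2
  have hIVT : ∀ p : D.Piece,
      u p.1.1 (D.point p.1.1 p.1.2) * u p.1.1 (D.point p.1.1 (p.1.2 + 1)) < 0 →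
      ∃ x ∈ Set.Ioo (D.point p.1.1 p.1.2) (D.point p.1.1 (p.1.2 + 1)), u p.1.1 x = 0 := by
    intro p hp
    have hlt := D.point_strictMono p.1.1 (Nat.lt_succ_self p.1.2)
    have hs := D.isShort hlam p.1.1 (hle p)
    have hc := (hu p.1.1).left.continuousOn.mono hs.Icc_subset
    rcases mul_neg_iff.1 hp with ⟨h1, h2⟩ | ⟨h1, h2⟩
    · exact intermediate_value_Ioo' hlt.le hc ⟨h2, h1⟩
    · exact intermediate_value_Ioo hlt.le hc ⟨h1, h2⟩
  choose! ζ hζ hζ0 using hIVT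
  have himage : {p : E × ℝ | p.2 ∈ Set.Ioo 0 (G.length p.1) ∧ u p.1 p.2 = 0} =
      (fun p : D.Piece => (p.1.1, ζ p)) '' {p : D.Piece |
        u p.1.1 (D.point p.1.1 p.1.2) * u p.1.1 (D.point p.1.1 (p.1.2 + 1)) < 0} := by
    ext ⟨e, x⟩
    constructor
    · rintro ⟨hx, h0⟩
      obtain ⟨k, hk, h1, h2⟩ := D.exists_point_le_lt hx
      have hs := D.isShort hlam e hk
      simp only at h0 hx h1 h2
      have huniq : ∀ y ∈ Set.Icc (D.point e k) (D.point e (k + 1)), u e y = 0 → x = y :=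
        fun y hy hy0 => hs.zero_unique (D.isPotential e) (hu e) (hne e) ⟨h1, h2.le⟩ hy h0 hy0
      -- A division point that is a zero must be a Dirichlet vertex. Internal zeros are therefore
      -- interior to their pieces, and by uniqueness such pieces have no Dirichlet end.
      have h1' : D.point e k < x := by
        refine h1.lt_of_ne fun h => ?_
        rw [← h, hnode e k (by lia)] at h0
        rcases D.node_eq_none (by lia) h0 with ⟨rfl, -⟩ | ⟨rfl, -⟩
        · rw [point_zero] at h
          exact hx.1.ne h
        · lia
      have hsome : u e (D.point e k) ≠ 0 := fun h =>
        h1'.ne' (huniq _ (Set.left_mem_Icc.2 hs.lt.le) h)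
      have hsome' : u e (D.point e (k + 1)) ≠ 0 := fun h =>
        h2.ne (huniq _ (Set.right_mem_Icc.2 hs.lt.le) h)
      have hneg := hs.mul_neg_of_zero (D.isPotential e) (D.F e) (hu e) ⟨h1', h2⟩ h0 hsome
      rw [Ne, hnode e _ (by lia), ← Ne, Option.ne_none_iff_isSome] at hsome hsome'
      let p : D.Piece := ⟨(e, ⟨k, by lia⟩), hsome, hsome'⟩
      exact ⟨p, hneg, Prod.ext rfl (huniq _ (Set.Ioo_subset_Icc_self (hζ p hneg))
        (hζ0 p hneg)).symm⟩
    · rintro ⟨p, hp, hpe⟩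
      obtain ⟨rfl, rfl⟩ := Prod.ext_iff.1 hpe
      have hs := D.isShort hlam p.1.1 (hle p)
      exact ⟨⟨hs.nonneg.trans_lt (hζ p hp).1, (hζ p hp).2.trans_le hs.le⟩, hζ0 p hp⟩
  rw [himage, Set.InjOn.ncard_image, Set.ncard_eq_toFinset_card', Set.toFinset_ofPred]
  rintro p hp p' hp' heq
  obtain ⟨he, hx⟩ := Prod.ext_iff.1 heq
  simp only at he hx
  refine Subtype.ext (Prod.ext he (Fin.ext ?_))
  have a1 := hζ p hp
  have a2 := hζ p' hp'
  rw [← he, ← hx] at a2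
  have b1 := (D.point_strictMono p.1.1).lt_iff_lt.1 (a1.1.trans a2.2)
  have b2 := (D.point_strictMono p.1.1).lt_iff_lt.1 (a2.1.trans a1.2)
  lia

end Discretization

end QuantumGraph

/-! ### Existence and uniqueness of the flux function, and the conclusion -/

namespace QuantumGraph

open ComplexConjugate

variable {V E : Type*} [DecidableEq V] [Fintype E] {G : QuantumGraph V E}

theorem Connected.exists_incident [Nonempty E] (hG : G.Connected) (v : V) :
    ∃ e, G.src e = v ∨ G.tgt e = v := by
  by_contra! h
  obtain ⟨e⟩ := ‹Nonempty E›
  have := hG.eq_of_src_eq_tgt (g := fun u => u = v) (fun e => by simp [h e]) v (G.src e)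
  simp [h e] at this

theorem exists_isSolution_of_ofReal {lam : ℝ} {ρ : E → ℝ → ℝ}
    (hρ : (fun e x => (ρ e x : ℂ)) ∈ eigenspace (0 : G.MagneticPotential) lam) (e : E) :
    ∃ v, IsSolution (G.length e) (G.q e) lam (ρ e) v := by
  obtain ⟨v, hv⟩ := exists_isComplexSolution hρ e
  have hA : (0 : G.MagneticPotential).A e = fun _ => 0 := rfl
  exact ⟨_, by simpa [magneticPhase, hA] using hv.re⟩

variable [Fintype V]

namespace Discretization

variable (D : G.Discretization) {lam : ℝ}

/-- The values of a real eigenfunction at the nodes. -/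
theorem exists_node_values (hlam : lam ≤ D.M) {ρ : E → ℝ → ℝ}
    (hinc : ∀ v, ∃ e, G.src e = v ∨ G.tgt e = v)
    (hρ : (fun e x => (ρ e x : ℂ)) ∈ eigenspace (0 : G.MagneticPotential) lam) :
    ∃ ψ : D.Node → ℝ, D.op lam 1 (fun w => (ψ w : ℂ)) = 0 ∧
      (∀ e, ∀ k ≤ D.m + 1, ∀ w, D.node e k = some w → ρ e (D.point e k) = ψ w) ∧
      ∀ e, ∀ k ≤ D.m + 1, D.node e k = none → ρ e (D.point e k) = 0 := by
  obtain ⟨hop, u, v, -, hu, hx⟩ := D.sample_mem_ker (hinc := hinc) hlam hρ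
  have hA : ∀ e, (0 : G.MagneticPotential).A e = fun _ => 0 := fun _ => rfl
  set y := D.sample hinc 0 fun e x => (ρ e x : ℂ)
  have hev : ∀ e, ∀ k ≤ D.m + 1, D.eval (D.node e k) y = (ρ e (D.point e k) : ℂ) := by
    intro e k hk
    have := hx e k hk
    rw [hu, edgeEval_apply, MagneticPotential.phase_zero] at this
    simpa [twist, magneticPhase, hA] using this.symm
  have hreal : ∀ w, ((y w).re : ℂ) = y w := by
    intro w
    obtain ⟨e, k, hk, h | h⟩ := D.exists_piece_node hinc w
    · have := hev e k (by lia)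
      rw [h, eval_some] at this
      rw [this, Complex.ofReal_re]
    · have := hev e (k + 1) (by lia)
      rw [h, eval_some] at this
      rw [this, Complex.ofReal_re]
  refine ⟨fun w => (y w).re, ?_, fun e k hk w hw => ?_, fun e k hk h => ?_⟩
  · simp only [hreal]
    rwa [MagneticPotential.phase_zero] at hop
  · have := hev e k hk
    rw [hw, eval_some] at this
    simp only [this, Complex.ofReal_re]
  · have := hev e k hk
    rw [h, eval_none] at this
    exact_mod_cast this.symm

end Discretization

/-- The value at `α` is defined by a potential that is constant on each edge and has flux `α`. Any
other admissible potential has gauge equivalent phases, hence the same index and kernel dimension at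
that value. -/
theorem exists_isMagneticEigenvalue (hG : G.Connected) {v₀ : V} {σ : Fin G.betti → FreeGroup E}
    (hσ : Subgroup.closure (Set.range σ) = G.fundamentalGroup v₀)
    (hinc : ∀ v, ∃ e, G.src e = v ∨ G.tgt e = v) (D : G.Discretization) {n : ℕ} (hn : 0 < n)
    (hM : ∀ z, n ≤ D.index D.M z) : ∃ Λ, G.IsMagneticEigenvalue σ n Λ := by
  choose θ hθ using cochainFlux_surjective hG hσ
  choose Λ hΛM hΛ using fun α =>
    D.exists_isNthEigenvalue hinc (MagneticPotential.ofCochain G (θ α)) hn (hM _)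
  refine ⟨Λ, fun A α hA => ?_⟩
  obtain ⟨u, hu, hz⟩ := exists_gauge hG hσ (c := θ α)
    (c' := fun e => ∫ x in (0 : ℝ)..G.length e, A.A e x) fun j => by
      rw [hθ, hA j, flux_eq_cochainFlux]
  obtain ⟨h1, h2⟩ := D.index_eq_of_gauge (μ := Λ α) (z := Discretization.cochainPhase (θ α))
    (z' := A.phase) hu hz
  have := hΛ α
  rw [D.isNthEigenvalue_iff hinc _ (hΛM α).le, MagneticPotential.phase_ofCochain] at this
  rwa [D.isNthEigenvalue_iff hinc _ (hΛM α).le, ← h1, ← h2]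

theorem IsMagneticEigenvalue.unique (hG : G.Connected) {v₀ : V} {σ : Fin G.betti → FreeGroup E}
    (hσ : Subgroup.closure (Set.range σ) = G.fundamentalGroup v₀) {n : ℕ}
    {Λ Λ' : (Fin G.betti → ℝ) → ℝ} (h : G.IsMagneticEigenvalue σ n Λ)
    (h' : G.IsMagneticEigenvalue σ n Λ') : Λ = Λ' := by
  funext α
  obtain ⟨θ, hθ⟩ := cochainFlux_surjective hG hσ α
  have hf : ∀ j, (α j : Real.Angle) =
      (flux (MagneticPotential.ofCochain G θ) (σ j) : Real.Angle) := fun j => by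
    rw [flux_ofCochain, hθ]
  exact (h _ α hf).unique (h' _ α hf)

end QuantumGraph

theorem mainTheorem1 {V E : Type*} [Fintype V] [DecidableEq V] [Fintype E]
    (G : QuantumGraph V E) (hG : G.Connected)
    (v₀ : V) (σ : Fin G.betti → FreeGroup E)
    (hσ : Subgroup.closure (Set.range σ) = G.fundamentalGroup v₀)
    (n : ℕ) (lam : ℝ)
    (hn : QuantumGraph.IsNthEigenvalue (0 : G.MagneticPotential) n lam)
    (hsimple : Module.finrank ℂ (QuantumGraph.eigenspace (0 : G.MagneticPotential) lam) = 1)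
    (ψ : E → ℝ → ℂ)
    (hψ : ψ ∈ QuantumGraph.eigenspace (0 : G.MagneticPotential) lam)
    (hψ0 : ψ ≠ 0) (hψv : G.NonzeroAtVertices ψ) :
    (∃! Λ : (Fin G.betti → ℝ) → ℝ, G.IsMagneticEigenvalue σ n Λ) ∧
      (G.internalZeros ψ).Finite ∧
      ∀ Λ : (Fin G.betti → ℝ) → ℝ, G.IsMagneticEigenvalue σ n Λ →
        IsNondegenerateCriticalPoint Λ 0 ∧
        (morseIndex Λ 0 : ℤ) = ((G.internalZeros ψ).ncard : ℤ) - ((n : ℤ) - 1) := by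
  have : Nonempty E := by
    obtain ⟨e, -⟩ := Function.ne_iff.1 hψ0
    exact ⟨e⟩
  have hinc := hG.exists_incident
  obtain ⟨ρ, hρ, hψρ⟩ := QuantumGraph.exists_real_eigenfunction hsimple hψ hψ0
  choose v hv using QuantumGraph.exists_isSolution_of_ofReal hρ
  have hne : ∀ e, ∃ y ∈ Set.Icc 0 (G.length e), ρ e y ≠ 0 := fun e => by
    obtain ⟨y, hy, h⟩ := QuantumGraph.exists_ne_zero_of_nonzeroAtVertices hG hψ hψ0 hψv e
    exact ⟨y, hy, mt (hψρ e y).2 h⟩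
  have hzeros : G.internalZeros ψ =
      {p : E × ℝ | p.2 ∈ Set.Ioo 0 (G.length p.1) ∧ ρ p.1 p.2 = 0} := by
    ext p
    simp only [QuantumGraph.internalZeros, Set.mem_ofPred_eq, hψρ]
  have hD := QuantumGraph.eventually_exists_discretization G n lam
  have hfin : (G.internalZeros ψ).Finite := by
    obtain ⟨_, D, -, hlam, -⟩ := hD.exists
    exact hzeros ▸ D.finite_zeros hlam.le hv hne
  -- The relative positions of the zeros on their edges form a finite set. A large prime number of
  -- pieces keeps all division points away from it, which makes `ψ` nonzero at every node.
  obtain ⟨N, hN⟩ := eventually_atTop.1 (hD.and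
    (eventually_ne_div_of_prime (hfin.image fun p => p.2 / G.length p.1)))
  obtain ⟨_ | m, hNm, hprime⟩ := Nat.exists_infinite_primes (N + 1)
  · lia
  obtain ⟨⟨D, rfl, hlam, hM⟩, hgrid⟩ := hN m (by lia)
  have hm : 0 < D.m := by have := hprime.two_le; lia
  have hker : Module.finrank ℂ (LinearMap.ker (D.op lam 1)) = 1 := by
    have h := congrArg Cardinal.toNat (D.rank_eigenspace hinc 0 hlam.le)
    rw [Cardinal.toNat_natCast, QuantumGraph.MagneticPotential.phase_zero] at h
    exact h.symm.trans hsimple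
  -- Positivity of `n` need not be assumed: it follows from the strict inequality in
  -- `IsNthEigenvalue`.
  have hn0 : 0 < n := by
    rw [D.isNthEigenvalue_iff hinc _ hlam.le] at hn
    lia
  obtain ⟨y, hy, hysome, hynone⟩ := D.exists_node_values hlam.le hinc hρ
  have hnode : ∀ e, ∀ k ≤ D.m + 1, ρ e (D.point e k) = 0 ↔ D.node e k = none := by
    refine fun e k hk => ⟨fun h => ?_, hynone e k hk⟩
    rw [← hψρ] at h
    by_cases h0 : k = 0
    · subst h0
      rw [D.point_zero] at h
      rw [D.node_zero]
      by_contra hne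
      exact (hψv e).1 (fun hd => hne (D.vertexNode_of_mem hd)) h
    by_cases h1 : k = D.m + 1
    · subst h1
      rw [D.point_last] at h
      rw [D.node_last]
      by_contra hne
      exact (hψv e).2 (fun hd => hne (D.vertexNode_of_mem hd)) h
    have hL := G.length_pos e
    have hpos : D.point e k ∈ Set.Ioo 0 (G.length e) := by
      rw [← D.point_zero e, ← D.point_last e]
      exact ⟨D.point_strictMono e (by lia), D.point_strictMono e (by lia)⟩
    refine absurd ?_ (hgrid hprime _ ⟨(e, D.point e k), ⟨hpos, h⟩, rfl⟩ k (by lia) (by lia))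
    simp only [QuantumGraph.Discretization.point]
    field_simp
  have hy0 : ∀ w, y w ≠ 0 := by
    intro w
    obtain ⟨e, k, hk, h | h⟩ := D.exists_piece_node hinc w
    · rw [← hysome e k (by lia) w h, Ne, hnode e k (by lia), h]
      simp
    · rw [← hysome e (k + 1) (by lia) w h, Ne, hnode e (k + 1) (by lia), h]
      simp
  -- The mixed coefficient is positive, so the sign of a weight is that of the product of the end
  -- values.
  have hcard : (G.internalZeros ψ).ncard =
      (Finset.univ.filter fun p => D.weight y lam p < 0).card := by
    rw [hzeros, D.ncard_zeros hlam.le hv hne hnode]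
    congr 1
    refine Finset.filter_congr fun p _ => ?_
    have hp : (p.1.2 : ℕ) ≤ D.m := Nat.lt_succ_iff.1 p.1.2.2
    have hmix : 0 < D.mix lam p.1.1 p.1.2 :=
      (D.F p.1.1).coefMix_pos (D.isShort hlam.le p.1.1 hp) (D.isPotential p.1.1)
    rw [hysome _ _ (by lia) _ (D.node_start p), hysome _ _ (by lia) _ (D.node_finish p),
      QuantumGraph.Discretization.weight, mul_assoc]
    exact ⟨fun h => mul_neg_of_pos_of_neg hmix h, fun h => (pos_iff_neg_of_mul_neg h).1 hmix⟩
  obtain ⟨e₀⟩ := this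
  have : Nonempty D.Node := ⟨.inner e₀ ⟨0, hm⟩⟩
  obtain ⟨Λ, hΛ⟩ := QuantumGraph.exists_isMagneticEigenvalue hG hσ hinc D hn0 hM
  refine ⟨⟨Λ, hΛ, fun Λ' hΛ' => hΛ'.unique hG hσ hΛ⟩, hfin, fun Λ' hΛ' => ?_⟩
  obtain ⟨hcrit, hidx⟩ := D.isNondegenerateCriticalPoint hG hσ hm hinc hlam hy hy0 hker hn hΛ'
  refine ⟨hcrit, ?_⟩
  rw [hcard]
  lia
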